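/- **Definitions.** For $S\subseteq\mathbb R^2$ and $p\in\mathbb R^2$, the *curvature of locally convex type* $K_{lct}(p)\in[0,\infty]$ is the inverse of the infimum of all $r>0$ for which $\overline B(p,r)\cap S$ is disconnected (so $K_{lct}(p)=0$ if there is no such $r$), and $\Pi(S)=\{p: K_{lct}(p)>0\}$. For $p\in S$ and a unit vector $u$ let $R(p,u)$ be the supremum of all $r>0$ with $\overline B(p+ru,r)\cap S=\{p\}$. The *Divider* of $S$ is the set of all centres $p+R(p,u)\,u$ for which such radii exist and $R(p,u)<\infty$. A point $e$ of a set $X\subseteq\mathbb R^2$ is an *end point* of $X$ if some neighbourhood of $e$ in $X$ is homeomorphic to $[0,1)$ with $e$ corresponding to $0$. For a regular $C^2$ curve $\gamma$ let $k(t)\ge 0$ be the curvature of the osculating circle at $\gamma(t)$ and, where $k(t)\ne0$, let $E(t)$ be its centre; these centres form the *evolute* $E$, whose tangent at $E(t)$ is the normal of the curve at $\gamma(t)$. The *convex side* of $E$ is the set of the points $p$ such that, for some $t$ with $k(t)\neq 0$, the point of contact $E(t)$ lies strictly between $\gamma(t)$ and $p$ on this line. $E$ has a *cusp* at $E(t)$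 if $k(t)\ne0$ and the unit vectors $\frac{E(s)-E(t)}{|E(s)-E(t)|}$ converge to one and the same unit vector as $s\to t$ from either side; the cusp *corresponds to maximum curvature* if $k$ has a local maximum at $t$. **Theorem.** Let $S=\gamma((0,1))\subset\mathbb R^2$ be an unbounded curve, where $\gamma$ is a regular, twice continuously differentiable homeomorphism of $(0,1)$ onto $S$. Suppose that $S$ contains no arc of constant curvature and that $k$ has exactly one local maximum on $(0,1)$. Then: 1. the Divider of $S$ is contained in the closure of $\Pi(S)$ and in the closure of the convex side of the evolute $E$; 2. every end point of the Divider is a cusp of $E$ that corresponds to maximum curvature, and there is exactly one such cusp; 3. if moreover both ends of $S$ are unbounded (that is, $\gamma((0,t))$ and $\gamma((t,1))$ are unbounded for all $t\in(0,1)$), then $\Pi(S)$ is equal to the convex side of $E$, and the set of end points of the Divider is equal to the set of cusps of $E$ that correspond to maximum curvature. -/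

import Mathlib

open Set Filter Topology
open scoped ENNReal

noncomputable section

namespace DividerSet

/-- The Euclidean plane. -/
abbrev Plane : Type := EuclideanSpace ℝ (Fin 2)

/-! ### Notions attached to an arbitrary subset `S` of the plane -/

/-- The infimum, in `[0, ∞]`, of the radii `r > 0` of the closed disks with centre `p` whose
intersection with `S` is disconnected (the empty set is not disconnected; `inf ∅ = ∞`). -/
def lctRadius (S : Set Plane) (p : Plane) : ℝ≥0∞ :=
  sInf {ρ | ∃ r : ℝ, 0 < r ∧ ¬ IsPreconnected (Metric.closedBall p r ∩ S) ∧ ρ = ENNReal.ofReal r}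

/-- The curvature of locally convex type of `S` at `p`, with `1 / ∞ = 0` and `1 / 0 = ∞`. -/
def lctCurvature (S : Set Plane) (p : Plane) : ℝ≥0∞ := (lctRadius S p)⁻¹

/-- `Π(S)`: the points where the curvature of locally convex type is positive. -/
def piSet (S : Set Plane) : Set Plane := {p | 0 < lctCurvature S p}

/-- The radii of the closed disks that meet `S` exactly in the point `p` and whose centre lies
from `p` in the direction of the unit vector `u`. -/
def contactRadii (S : Set Plane) (p u : Plane) : Set ℝ :=
  {r | 0 < r ∧ Metric.closedBall (p + r • u) r ∩ S = {p}}

/-- The Divider of `S`: the centres of the supremum contact disks, one for each point `p` of `S`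
and each contact direction `u` at `p` in which the supremum is finite. (`IsLUB` in `ℝ` implies
that the set of radii is nonempty, so that `u` is a contact direction, and bounded above.) -/
def divider (S : Set Plane) : Set Plane :=
  {c | ∃ p ∈ S, ∃ u : Plane, ‖u‖ = 1 ∧ ∃ R : ℝ, IsLUB (contactRadii S p u) R ∧ c = p + R • u}

/-- `e` is an end point of `X`: near `e` the set `X` is a half-open arc that starts at `e`. -/
def IsEndPoint (X : Set Plane) (e : Plane) : Prop :=
  ∃ (U : Set Plane) (he : e ∈ X ∩ U), IsOpen U ∧
    ∃ φ : ↥(X ∩ U) ≃ₜ ↥(Ico (0 : ℝ) 1), (φ ⟨e, he⟩ : ℝ) = 0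

/-! ### Plane curves and their evolutes -/

/-- `γ`, restricted to `(0, 1)`, is a twice continuously differentiable regular parametrization
that is a homeomorphism of `(0, 1)` onto its image. -/
structure IsC2OpenArc (γ : ℝ → Plane) : Prop where
  contDiffOn : ContDiffOn ℝ 2 γ (Ioo 0 1)
  deriv_ne_zero : ∀ t ∈ Ioo (0 : ℝ) 1, deriv γ t ≠ 0
  isEmbedding : IsEmbedding ((Ioo (0 : ℝ) 1).domRestrict γ)

/-- The curve as a set of points. -/
def trace (γ : ℝ → Plane) : Set Plane := γ '' Ioo 0 1

/-- The determinant of two plane vectors. -/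
def cross (v w : Plane) : ℝ := v 0 * w 1 - v 1 * w 0

/-- Rotation by a right angle. -/
def rot (v : Plane) : Plane := !₂[-(v 1), v 0]

/-- The curvature of the osculating circle at parameter `t` (nonnegative). -/
def curvature (γ : ℝ → Plane) (t : ℝ) : ℝ :=
  |cross (deriv γ t) (deriv (deriv γ) t)| / ‖deriv γ t‖ ^ 3

/-- The centre of the osculating circle at parameter `t`, meaningful where the curvature is not
zero; these points form the evolute. -/
def evolute (γ : ℝ → Plane) (t : ℝ) : Plane :=
  γ t + (‖deriv γ t‖ ^ 2 / cross (deriv γ t) (deriv (deriv γ) t)) • rot (deriv γ t)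

/-- No arc of the curve has constant curvature. -/
def NoConstantCurvatureArc (γ : ℝ → Plane) : Prop :=
  ∀ a b : ℝ, 0 < a → a < b → b < 1 → ¬ ∃ k : ℝ, ∀ t ∈ Icc a b, curvature γ t = k

/-- The side to which the evolute turns its convex side: the points `p` from which there is a
tangent to the evolute, namely a normal of the curve at some `γ t`, whose point of contact with
the evolute lies strictly between `γ t` and `p`. -/
def convexSide (γ : ℝ → Plane) : Set Plane :=
  {p | ∃ t ∈ Ioo (0 : ℝ) 1, curvature γ t ≠ 0 ∧ Sbtw ℝ (γ t) (evolute γ t) p}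

/-- The evolute has a cusp at parameter `t`: the curvature is not zero there and the two branches
of the evolute leave the point `evolute γ t` with the same direction `v`. -/
def IsEvoluteCusp (γ : ℝ → Plane) (t : ℝ) : Prop :=
  curvature γ t ≠ 0 ∧ ∃ v : Plane, ‖v‖ = 1 ∧
    Tendsto (fun s => ‖evolute γ s - evolute γ t‖⁻¹ • (evolute γ s - evolute γ t))
      (𝓝[≠] t) (𝓝 v)

/-- The cusps of the evolute that correspond to maxima of the curvature. -/
def maxCurvatureCusps (γ : ℝ → Plane) : Set Plane :=
  {c | ∃ t ∈ Ioo (0 : ℝ) 1, IsLocalMax (curvature γ) t ∧ IsEvoluteCusp γ t ∧ c = evolute γ t}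

/-- Each of the two ends of the curve is unbounded. -/
def BothEndsUnbounded (γ : ℝ → Plane) : Prop :=
  ∀ t ∈ Ioo (0 : ℝ) 1,
    ¬ Bornology.IsBounded (γ '' Ioo 0 t) ∧ ¬ Bornology.IsBounded (γ '' Ioo t 1)

end DividerSet

end

/-! Everything is read off from the functions `s ↦ dist z (γ s)`. At an extremum of such a function
`z` lies on the normal at `γ s`; a local maximum puts `z` at or beyond the centre of curvature, and
a degenerate critical point puts it exactly there. A centre belongs to Π(S) iff its distance
function takes, between two parameters, a value larger than at both (`mem_piSet_iff`). Beyond the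
centre of curvature the distance has a strict local maximum, so the convex side lies in Π(S);
conversely a hump contains a local maximum, so Π(S) lies in the closure of the convex side.

The supremum contact disk at a Divider centre `c` has radius `infDist c S`, so its point of contact
is a foot, that is, a nearest point of the closure of S. If it were the only foot and nondegenerate,
the disk could be enlarged. Hence `c` has a second foot or is a centre of curvature
(`two_feet_or_eq_evolute`). In the first case the distance exceeds its minimum somewhere between the
feet, since S contains no circular arc, so `c` is in Π(S); in the second case `c` is a limit of
points of the convex side. This gives the first claim.

A centre with two feet is no end point: the radii to the feet cut a neighbourhood into two sectors,
the Divider avoids the radii, and by connectedness it meets every small path that joins the radii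
inside either sector. There remain the centres of curvature whose open disk misses S. Here Kneser's
nesting of osculating circles enters: where the curvature is strictly monotone, the distance of two
centres of curvature is less than the difference of the radii. So at any parameter other than the
maximum `t₀` the curve enters its osculating disk, and only `evolute γ t₀` survives. The same
estimate makes this point a cusp.

If both ends are unbounded, the curvature increases strictly up to `t₀` and decreases strictly
afterwards, since otherwise an end would be trapped in an osculating disk. The osculating disk at
`t₀` then meets S only in `γ t₀`, and feet of centres near `evolute γ t₀` stay near `γ t₀`. There
the Divider consists of the centre `evolute γ t₀` and of the centres with feet on both sides of
`t₀`; monotonicity of nearest points makes it a graph over the normal, and connectedness shows that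
all small heights occur. -/

namespace DividerSet

/-! ### Kneser's nesting of osculating circles for merely monotone curvature -/

section FramedArc

variable {V : Type*} [NormedAddCommGroup V] [InnerProductSpace ℝ V]

/-- A regular arc with velocity `γ'`, a unit normal field `N` and positive curvature `κ` with
respect to `N`. -/
structure IsFramedOn (γ γ' N : ℝ → V) (κ : ℝ → ℝ) (a b : ℝ) : Prop where
  hasDerivAt : ∀ t ∈ Icc a b, HasDerivAt γ (γ' t) t
  hasDerivAt_normal : ∀ t ∈ Icc a b, HasDerivAt N (-(κ t) • γ' t) t
  norm_normal : ∀ t ∈ Icc a b, ‖N t‖ = 1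
  pos : ∀ t ∈ Icc a b, 0 < κ t
  ne_zero : ∀ t ∈ Icc a b, γ' t ≠ 0
  continuousOn_deriv : ContinuousOn γ' (Icc a b)

/-- The centre of curvature of a framed arc. -/
noncomputable def focal (γ N : ℝ → V) (κ : ℝ → ℝ) (t : ℝ) : V := γ t + (κ t)⁻¹ • N t

variable {γ γ' N : ℝ → V} {κ : ℝ → ℝ} {a b : ℝ}

theorem IsFramedOn.comp_neg (h : IsFramedOn γ γ' N κ a b) :
    IsFramedOn (fun t => γ (-t)) (fun t => -γ' (-t)) (fun t => N (-t)) (fun t => κ (-t))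
      (-b) (-a) := by
  have hs : ∀ t ∈ Icc (-b) (-a), -t ∈ Icc a b := fun t ht =>
    ⟨by linarith [ht.2], by linarith [ht.1]⟩
  refine ⟨fun t ht => ?_, fun t ht => ?_, fun t ht => h.3 _ (hs t ht), fun t ht => h.4 _ (hs t ht),
    fun t ht => neg_ne_zero.2 (h.5 _ (hs t ht)), ?_⟩
  · simpa [Function.comp_def] using (h.1 _ (hs t ht)).scomp t (hasDerivAt_neg t)
  · simpa [Function.comp_def] using (h.2 _ (hs t ht)).scomp t (hasDerivAt_neg t)
  · exact (h.6.comp continuous_neg.continuousOn hs).neg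

theorem IsFramedOn.exists_speed_bound (h : IsFramedOn γ γ' N κ a b) :
    ∃ M : ℝ, 0 ≤ M ∧ ∀ t ∈ Icc a b, ‖γ' t‖ ≤ M := by
  obtain ⟨M, hM⟩ := isCompact_Icc.exists_bound_of_continuousOn h.6
  exact ⟨max M 0, le_max_right _ _, fun t ht => (hM t ht).trans (le_max_left _ _)⟩

theorem IsFramedOn.inv_le_inv (h : IsFramedOn γ γ' N κ a b) (hκ : AntitoneOn κ (Icc a b))
    {x y : ℝ} (hx : x ∈ Icc a b) (hy : y ∈ Icc a b) (hxy : x ≤ y) : (κ x)⁻¹ ≤ (κ y)⁻¹ :=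
  inv_anti₀ (h.pos y hy) (hκ hx hy hxy)

/-- A substitute for `dE = N dρ` with `ρ = κ⁻¹`: the curvature is only monotone, so the evolute
cannot be differentiated. The vector estimated is the increment from `x` to `y` of the parallel
curve `γ + ρ(y) N` at a fixed distance, whose velocity `(1 - ρ(y) κ) γ'` is small because `κ` varies
little. -/
theorem IsFramedOn.norm_focal_sub_sub_le (h : IsFramedOn γ γ' N κ a b)
    (hκ : AntitoneOn κ (Icc a b)) {M : ℝ} (hM : ∀ t ∈ Icc a b, ‖γ' t‖ ≤ M)
    {x y : ℝ} (hx : x ∈ Icc a b) (hy : y ∈ Icc a b) (hxy : x ≤ y) :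
    ‖focal γ N κ y - focal γ N κ x - ((κ y)⁻¹ - (κ x)⁻¹) • N x‖
      ≤ M * κ a * (y - x) * ((κ y)⁻¹ - (κ x)⁻¹) := by
  have hs : Icc x y ⊆ Icc a b := Icc_subset_Icc hx.1 hy.2
  have hab : a ∈ Icc a b := ⟨le_rfl, hx.1.trans hx.2⟩
  have hx0 := h.pos x hx
  have hy0 := h.pos y hy
  have hM0 : 0 ≤ M := (norm_nonneg _).trans (hM x hx)
  have hρ := h.inv_le_inv hκ hx hy hxy
  have key : ∀ σ ∈ Icc x y, ‖γ' σ + (κ y)⁻¹ • (-(κ σ) • γ' σ)‖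
      ≤ M * κ a * ((κ y)⁻¹ - (κ x)⁻¹) := by
    intro σ hσ
    have e : γ' σ + (κ y)⁻¹ • (-(κ σ) • γ' σ) = (1 - (κ y)⁻¹ * κ σ) • γ' σ := by
      rw [sub_smul, one_smul, smul_smul, mul_neg, neg_smul, sub_eq_add_neg]
    have h1 : κ y ≤ κ σ := hκ (hs hσ) hy hσ.2
    have h2 : κ σ ≤ κ x := hκ hx (hs hσ) hσ.1
    have h3 : 1 ≤ (κ y)⁻¹ * κ σ := by
      rw [inv_mul_eq_div, one_le_div hy0]; exact h1
    have h4 : (κ y)⁻¹ * κ σ ≤ (κ y)⁻¹ * κ x := mul_le_mul_of_nonneg_left h2 (inv_nonneg.2 hy0.le)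
    have h5 : (κ y)⁻¹ * κ x - 1 = κ x * ((κ y)⁻¹ - (κ x)⁻¹) := by
      field_simp
    have h6 : κ x * ((κ y)⁻¹ - (κ x)⁻¹) ≤ κ a * ((κ y)⁻¹ - (κ x)⁻¹) :=
      mul_le_mul_of_nonneg_right (hκ hab hx hx.1) (sub_nonneg.2 hρ)
    rw [e, norm_smul, Real.norm_eq_abs, abs_of_nonpos (by linarith)]
    calc -(1 - (κ y)⁻¹ * κ σ) * ‖γ' σ‖ ≤ (κ a * ((κ y)⁻¹ - (κ x)⁻¹)) * M := by
          apply mul_le_mul _ (hM σ (hs hσ)) (norm_nonneg _)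
          · exact mul_nonneg (h.pos a hab).le (sub_nonneg.2 hρ)
          · linarith
      _ = _ := by ring
  have hd : ∀ σ ∈ Icc x y, HasDerivWithinAt (fun σ => γ σ + (κ y)⁻¹ • N σ)
      (γ' σ + (κ y)⁻¹ • (-(κ σ) • γ' σ)) (Icc x y) σ := fun σ hσ =>
    ((h.1 σ (hs hσ)).add ((h.2 σ (hs hσ)).const_smul _)).hasDerivWithinAt
  have := (convex_Icc x y).norm_image_sub_le_of_norm_hasDerivWithin_le hd key
    (left_mem_Icc.2 hxy) (right_mem_Icc.2 hxy)
  rw [Real.norm_eq_abs, abs_of_nonneg (sub_nonneg.2 hxy)] at this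
  calc _ = ‖γ y + (κ y)⁻¹ • N y - (γ x + (κ y)⁻¹ • N x)‖ := by
        congr 1; simp only [focal, sub_smul]; abel
    _ ≤ _ := this
    _ = _ := by ring

/-- The preceding estimate gives the bound up to a factor `1 + C δ` on steps of length at most `δ`.
The differences of radii telescope over a subdivision, so the factor persists on the whole interval,
and then `δ` tends to `0`. -/
theorem IsFramedOn.norm_focal_sub_le (h : IsFramedOn γ γ' N κ a b)
    (hκ : AntitoneOn κ (Icc a b)) {x y : ℝ} (hx : x ∈ Icc a b) (hy : y ∈ Icc a b) (hxy : x ≤ y) :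
    ‖focal γ N κ y - focal γ N κ x‖ ≤ (κ y)⁻¹ - (κ x)⁻¹ := by
  obtain ⟨M, hM0, hM⟩ := h.exists_speed_bound
  have hab : a ∈ Icc a b := ⟨le_rfl, hx.1.trans hx.2⟩
  set C := M * κ a
  have hC : 0 ≤ C := mul_nonneg hM0 (h.pos a hab).le
  have step : ∀ δ : ℝ, ∀ x ∈ Icc a b, ∀ y ∈ Icc a b, x ≤ y → y - x ≤ δ →
      ‖focal γ N κ y - focal γ N κ x‖ ≤ (1 + C * δ) * ((κ y)⁻¹ - (κ x)⁻¹) := by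
    intro δ x hx y hy hxy hδ
    have h1 := h.norm_focal_sub_sub_le hκ hM hx hy hxy
    have hρ := sub_nonneg.2 (h.inv_le_inv hκ hx hy hxy)
    have h2 := norm_le_norm_sub_add (focal γ N κ y - focal γ N κ x)
      (((κ y)⁻¹ - (κ x)⁻¹) • N x)
    rw [norm_smul, h.norm_normal x hx, Real.norm_eq_abs, abs_of_nonneg hρ, mul_one] at h2
    have h3 : C * (y - x) * ((κ y)⁻¹ - (κ x)⁻¹) ≤ C * δ * ((κ y)⁻¹ - (κ x)⁻¹) :=
      mul_le_mul_of_nonneg_right (mul_le_mul_of_nonneg_left hδ hC) hρ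
    linarith
  have multi : ∀ δ : ℝ, 0 < δ → ∀ n : ℕ, ∀ x ∈ Icc a b, ∀ y ∈ Icc a b, x ≤ y → y - x ≤ n * δ →
      ‖focal γ N κ y - focal γ N κ x‖ ≤ (1 + C * δ) * ((κ y)⁻¹ - (κ x)⁻¹) := by
    intro δ hδ n
    induction n with
    | zero =>
      intro x hx y hy hxy hn
      exact step δ x hx y hy hxy (by simp at hn; linarith)
    | succ n ih =>
      intro x hx y hy hxy hn
      rcases le_total (y - x) δ with h1 | h1
      · exact step δ x hx y hy hxy h1
      · have hz : y - δ ∈ Icc a b := ⟨by linarith [hx.1], by linarith [hy.2]⟩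
        have h2 := ih x hx (y - δ) hz (by linarith) (by push_cast at hn; linarith)
        have h3 := step δ (y - δ) hz y hy (by linarith) (by linarith)
        have h4 := norm_sub_le_norm_sub_add_norm_sub (focal γ N κ y) (focal γ N κ (y - δ))
          (focal γ N κ x)
        linarith
  have all : ∀ δ : ℝ, 0 < δ →
      ‖focal γ N κ y - focal γ N κ x‖ ≤ (1 + C * δ) * ((κ y)⁻¹ - (κ x)⁻¹) := by
    intro δ hδ
    obtain ⟨n, hn⟩ := exists_nat_ge ((y - x) / δ)
    exact multi δ hδ n x hx y hy hxy ((div_le_iff₀ hδ).1 hn)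
  have lim : Tendsto (fun δ : ℝ => (1 + C * δ) * ((κ y)⁻¹ - (κ x)⁻¹)) (𝓝[>] 0)
      (𝓝 ((1 + C * 0) * ((κ y)⁻¹ - (κ x)⁻¹))) := by
    refine Tendsto.mono_left ?_ nhdsWithin_le_nhds
    exact Continuous.tendsto (by fun_prop) 0
  have := ge_of_tendsto lim (eventually_nhdsWithin_of_forall all)
  simpa using this

/-- Equality would force the evolute to run straight in one direction `v` at full speed; the
first-order estimate then gives `N = v` throughout, against `N' = -κ γ' ≠ 0`. -/
theorem IsFramedOn.norm_focal_sub_lt (h : IsFramedOn γ γ' N κ a b) (hab : a < b)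
    (hκ : StrictAntiOn κ (Icc a b)) :
    ‖focal γ N κ b - focal γ N κ a‖ < (κ b)⁻¹ - (κ a)⁻¹ := by
  have ha : a ∈ Icc a b := left_mem_Icc.2 hab.le
  have hb : b ∈ Icc a b := right_mem_Icc.2 hab.le
  have hanti := hκ.antitoneOn
  refine lt_of_le_of_ne (h.norm_focal_sub_le hanti ha hb hab.le) fun heq => ?_
  obtain ⟨M, hM0, hM⟩ := h.exists_speed_bound
  have hρ : ∀ x ∈ Icc a b, ∀ y ∈ Icc a b, x < y → 0 < (κ y)⁻¹ - (κ x)⁻¹ := fun x hx y hy hxy =>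
    sub_pos.2 (inv_strictAnti₀ (h.pos y hy) (hκ hx hy hxy))
  set L := (κ b)⁻¹ - (κ a)⁻¹
  have hL : 0 < L := hρ a ha b hb hab
  set v : V := L⁻¹ • (focal γ N κ b - focal γ N κ a) with hv
  have hv1 : ‖v‖ = 1 := by
    rw [hv, norm_smul, heq, Real.norm_eq_abs, abs_of_pos (inv_pos.2 hL), inv_mul_cancel₀ hL.ne']
  have hle : ∀ x ∈ Icc a b, ∀ y ∈ Icc a b, x ≤ y →
      inner ℝ v (focal γ N κ y - focal γ N κ x) ≤ (κ y)⁻¹ - (κ x)⁻¹ := by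
    intro x hx y hy hxy
    have := real_inner_le_norm v (focal γ N κ y - focal γ N κ x)
    rw [hv1, one_mul] at this
    exact this.trans (h.norm_focal_sub_le hanti hx hy hxy)
  have htot : inner ℝ v (focal γ N κ b - focal γ N κ a) = L := by
    have : focal γ N κ b - focal γ N κ a = L • v := by
      rw [hv, smul_smul, mul_inv_cancel₀ hL.ne', one_smul]
    rw [this, inner_smul_right, real_inner_self_eq_norm_sq, hv1]; ring
  -- The three partial increments along `v` are at most the differences of radii and their sum is
  -- extremal, so each of them is extremal.
  have heqs : ∀ x ∈ Icc a b, ∀ y ∈ Icc a b, x ≤ y →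
      inner ℝ v (focal γ N κ y - focal γ N κ x) = (κ y)⁻¹ - (κ x)⁻¹ := by
    intro x hx y hy hxy
    have h1 := hle a ha x hx hx.1
    have h2 := hle y hy b hb hy.2
    have h3 := hle x hx y hy hxy
    have h4 : focal γ N κ b - focal γ N κ a = (focal γ N κ b - focal γ N κ y)
      + (focal γ N κ y - focal γ N κ x) + (focal γ N κ x - focal γ N κ a) := by abel
    rw [h4, inner_add_right, inner_add_right] at htot
    simp only [L] at htot
    linarith
  have hN : ∀ x ∈ Ico a b, N x = v := by
    intro x hx
    have hx' : x ∈ Icc a b := ⟨hx.1, hx.2.le⟩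
    have hb1 : ∀ y ∈ Ioc x b, |1 - inner ℝ v (N x)| ≤ M * κ a * (y - x) := by
      intro y hy
      have hy' : y ∈ Icc a b := ⟨hx.1.trans hy.1.le, hy.2⟩
      have h1 := h.norm_focal_sub_sub_le hanti hM hx' hy' hy.1.le
      have h2 := hρ x hx' y hy' hy.1
      have h3 := abs_real_inner_le_norm v
        (focal γ N κ y - focal γ N κ x - ((κ y)⁻¹ - (κ x)⁻¹) • N x)
      rw [inner_sub_right, heqs x hx' y hy' hy.1.le, inner_smul_right, hv1, one_mul,
        ← mul_one_sub, abs_mul, abs_of_pos h2] at h3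
      have h4 := h3.trans h1
      rw [mul_comm (M * κ a * (y - x))] at h4
      exact le_of_mul_le_mul_left h4 h2
    have lim : Tendsto (fun y : ℝ => M * κ a * (y - x)) (𝓝[>] x) (𝓝 (M * κ a * (x - x))) :=
      (Continuous.tendsto (by fun_prop) x).mono_left nhdsWithin_le_nhds
    have h5 : |1 - inner ℝ v (N x)| ≤ M * κ a * (x - x) :=
      ge_of_tendsto lim (by filter_upwards [Ioc_mem_nhdsGT hx.2] with y hy using hb1 y hy)
    rw [sub_self, mul_zero] at h5
    have h6 : inner ℝ v (N x) = 1 := by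
      have := abs_eq_zero.1 (le_antisymm h5 (abs_nonneg _)); linarith
    exact ((inner_eq_one_iff_of_norm_eq_one hv1 (h.norm_normal x hx')).1 h6).symm
  have hm : (a + b) / 2 ∈ Ioo a b := ⟨by linarith, by linarith⟩
  have hm' := Ioo_subset_Icc_self hm
  have hconst : HasDerivAt N 0 ((a + b) / 2) := by
    refine (hasDerivAt_const _ v).congr_of_eventuallyEq ?_
    filter_upwards [isOpen_Ioo.mem_nhds hm] with x hx using hN x ⟨hx.1.le, hx.2⟩
  have := hconst.unique (h.hasDerivAt_normal _ hm')
  have hk := (h.pos _ hm').ne'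
  have hg := h.ne_zero _ hm'
  exact (smul_ne_zero (neg_ne_zero.2 hk) hg) this.symm

theorem IsFramedOn.norm_focal_sub_lt_of_strictMonoOn (h : IsFramedOn γ γ' N κ a b) (hab : a < b)
    (hκ : StrictMonoOn κ (Icc a b)) :
    ‖focal γ N κ b - focal γ N κ a‖ < (κ a)⁻¹ - (κ b)⁻¹ := by
  have := h.comp_neg.norm_focal_sub_lt (neg_lt_neg hab) (by
    intro x hx y hy hxy
    exact hκ ⟨by linarith [hy.2], by linarith [hy.1]⟩ ⟨by linarith [hx.2], by linarith [hx.1]⟩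
      (neg_lt_neg hxy))
  simpa [focal, norm_sub_rev] using this

theorem IsFramedOn.norm_sub_focal (h : IsFramedOn γ γ' N κ a b) {t : ℝ} (ht : t ∈ Icc a b) :
    ‖γ t - focal γ N κ t‖ = (κ t)⁻¹ := by
  have : γ t - focal γ N κ t = -((κ t)⁻¹ • N t) := by simp [focal]
  rw [this, norm_neg, norm_smul, h.norm_normal t ht, mul_one, Real.norm_eq_abs,
    abs_of_pos (inv_pos.2 (h.pos t ht))]

/-- Nesting of the osculating circles, applied to the point `γ b` of the outer one. The next three
lemmas are the other choices of centre and of monotonicity. -/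
theorem IsFramedOn.inv_lt_norm_sub_left (h : IsFramedOn γ γ' N κ a b) (hab : a < b)
    (hκ : StrictAntiOn κ (Icc a b)) : (κ a)⁻¹ < ‖γ b - focal γ N κ a‖ := by
  have h1 := h.norm_focal_sub_lt hab hκ
  have h2 := h.norm_sub_focal (right_mem_Icc.2 hab.le)
  have h3 := norm_sub_le_norm_sub_add_norm_sub (γ b) (focal γ N κ a) (focal γ N κ b)
  rw [norm_sub_rev (focal γ N κ a)] at h3
  linarith

theorem IsFramedOn.norm_sub_lt_inv_right (h : IsFramedOn γ γ' N κ a b) (hab : a < b)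
    (hκ : StrictAntiOn κ (Icc a b)) : ‖γ a - focal γ N κ b‖ < (κ b)⁻¹ := by
  have h1 := h.norm_focal_sub_lt hab hκ
  have h2 := h.norm_sub_focal (left_mem_Icc.2 hab.le)
  have h3 := norm_sub_le_norm_sub_add_norm_sub (γ a) (focal γ N κ a) (focal γ N κ b)
  rw [norm_sub_rev (focal γ N κ a)] at h3
  linarith

theorem IsFramedOn.norm_sub_lt_inv_left (h : IsFramedOn γ γ' N κ a b) (hab : a < b)
    (hκ : StrictMonoOn κ (Icc a b)) : ‖γ b - focal γ N κ a‖ < (κ a)⁻¹ := by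
  have h1 := h.norm_focal_sub_lt_of_strictMonoOn hab hκ
  have h2 := h.norm_sub_focal (right_mem_Icc.2 hab.le)
  have h3 := norm_sub_le_norm_sub_add_norm_sub (γ b) (focal γ N κ b) (focal γ N κ a)
  linarith

theorem IsFramedOn.inv_lt_norm_sub_right (h : IsFramedOn γ γ' N κ a b) (hab : a < b)
    (hκ : StrictMonoOn κ (Icc a b)) : (κ b)⁻¹ < ‖γ a - focal γ N κ b‖ := by
  have h1 := h.norm_focal_sub_lt_of_strictMonoOn hab hκ
  have h2 := h.norm_sub_focal (left_mem_Icc.2 hab.le)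
  have h3 := norm_sub_le_norm_sub_add_norm_sub (γ a) (focal γ N κ b) (focal γ N κ a)
  linarith

/-- Dividing `norm_focal_sub_sub_le` by the difference of the radii shows that the evolute leaves in
the direction of the normal. On the other side of a maximum the radii also grow away from it, so
both branches leave in the same direction. -/
theorem IsFramedOn.tendsto_direction_right (h : IsFramedOn γ γ' N κ a b) (hab : a < b)
    (hκ : StrictAntiOn κ (Icc a b)) :
    Tendsto (fun s => ‖focal γ N κ s - focal γ N κ a‖⁻¹ • (focal γ N κ s - focal γ N κ a))
      (𝓝[>] a) (𝓝 (N a)) := by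
  obtain ⟨M, hM0, hM⟩ := h.exists_speed_bound
  have ha : a ∈ Icc a b := left_mem_Icc.2 hab.le
  set q : ℝ → V := fun s => ((κ s)⁻¹ - (κ a)⁻¹)⁻¹ • (focal γ N κ s - focal γ N κ a) with hq
  have hpos : ∀ s ∈ Ioc a b, 0 < (κ s)⁻¹ - (κ a)⁻¹ := fun s hs =>
    sub_pos.2 (inv_strictAnti₀ (h.pos s ⟨hs.1.le, hs.2⟩) (hκ ha ⟨hs.1.le, hs.2⟩ hs.1))
  have hqlim : Tendsto q (𝓝[>] a) (𝓝 (N a)) := by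
    rw [tendsto_iff_norm_sub_tendsto_zero]
    have lim : Tendsto (fun y : ℝ => M * κ a * (y - a)) (𝓝[>] a) (𝓝 0) := by
      have : Tendsto (fun y : ℝ => M * κ a * (y - a)) (𝓝[>] a) (𝓝 (M * κ a * (a - a))) :=
        (Continuous.tendsto (by fun_prop) a).mono_left nhdsWithin_le_nhds
      simpa using this
    refine squeeze_zero' (Eventually.of_forall fun _ => norm_nonneg _) ?_ lim
    filter_upwards [Ioc_mem_nhdsGT hab] with s hs
    have h1 := h.norm_focal_sub_sub_le hκ.antitoneOn hM ha ⟨hs.1.le, hs.2⟩ hs.1.le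
    have h2 := hpos s hs
    have e : q s - N a = ((κ s)⁻¹ - (κ a)⁻¹)⁻¹ •
        (focal γ N κ s - focal γ N κ a - ((κ s)⁻¹ - (κ a)⁻¹) • N a) := by
      rw [smul_sub, smul_smul, inv_mul_cancel₀ h2.ne', one_smul]
    rw [e, norm_smul, Real.norm_eq_abs, abs_of_pos (inv_pos.2 h2), inv_mul_le_iff₀ h2]
    linarith
  have hlim : Tendsto (fun s => ‖q s‖⁻¹ • q s) (𝓝[>] a) (𝓝 (N a)) := by
    have hn := h.norm_normal a ha
    have : Tendsto (fun s => ‖q s‖⁻¹ • q s) (𝓝[>] a) (𝓝 (‖N a‖⁻¹ • N a)) :=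
      (hqlim.norm.inv₀ (by rw [hn]; exact one_ne_zero)).smul hqlim
    simpa [hn] using this
  refine hlim.congr' ?_
  filter_upwards [Ioc_mem_nhdsGT hab] with s hs
  have h2 := hpos s hs
  simp only [hq, norm_smul, Real.norm_eq_abs, abs_of_pos (inv_pos.2 h2), smul_smul, mul_inv,
    inv_inv]
  congr 1
  rw [mul_right_comm, mul_inv_cancel₀ h2.ne', one_mul]

theorem IsFramedOn.tendsto_direction_left (h : IsFramedOn γ γ' N κ a b) (hab : a < b)
    (hκ : StrictMonoOn κ (Icc a b)) :
    Tendsto (fun s => ‖focal γ N κ s - focal γ N κ b‖⁻¹ • (focal γ N κ s - focal γ N κ b))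
      (𝓝[<] b) (𝓝 (N b)) := by
  have := h.comp_neg.tendsto_direction_right (neg_lt_neg hab) (by
    intro x hx y hy hxy
    exact hκ ⟨by linarith [hy.2], by linarith [hy.1]⟩ ⟨by linarith [hx.2], by linarith [hx.1]⟩
      (neg_lt_neg hxy))
  have := this.comp tendsto_neg_nhdsLT
  simpa [focal, Function.comp_def] using this

end FramedArc

end DividerSet

/-! ### The normal frame of a plane arc -/

namespace DividerSet

theorem inner_eq_coord (v w : Plane) : inner ℝ v w = v 0 * w 0 + v 1 * w 1 := by
  simp [PiLp.inner_apply, Fin.sum_univ_two, mul_comm]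

@[simp] theorem rot_zero_apply (v : Plane) : rot v 0 = -(v 1) := by simp [rot]

@[simp] theorem rot_one_apply (v : Plane) : rot v 1 = v 0 := by simp [rot]

theorem plane_ext {v w : Plane} (h0 : v 0 = w 0) (h1 : v 1 = w 1) : v = w := by
  ext i; fin_cases i
  · exact h0
  · exact h1

theorem norm_sq_eq_coord (v : Plane) : ‖v‖ ^ 2 = v 0 ^ 2 + v 1 ^ 2 := by
  rw [← real_inner_self_eq_norm_sq, inner_eq_coord]; ring

theorem norm_rot (v : Plane) : ‖rot v‖ = ‖v‖ := by
  rw [← sq_eq_sq₀ (norm_nonneg _) (norm_nonneg _), norm_sq_eq_coord, norm_sq_eq_coord]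
  simp; ring

theorem inner_rot_left (v w : Plane) : inner ℝ (rot v) w = cross v w := by
  rw [inner_eq_coord, cross]; simp; ring

theorem inner_self_rot (v : Plane) : inner ℝ v (rot v) = 0 := by
  rw [inner_eq_coord]; simp; ring

/-- A vector orthogonal to `v` is its component along `rot v`. -/
theorem smul_rot_of_inner_eq_zero {v w : Plane} (h : inner ℝ v w = 0) :
    ‖v‖ ^ 2 • w = cross v w • rot v := by
  rw [inner_eq_coord] at h
  apply plane_ext <;> simp [norm_sq_eq_coord, cross]
  · linear_combination v 0 * h
  · linear_combination v 1 * h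

/-- Stated on a given interval, not as a germ at `x`, so that the size of the interval can be kept
while the centre of the distance function moves. -/
theorem strict_min_of_second_deriv_pos {g g' g'' : ℝ → ℝ} {a b x : ℝ}
    (h1 : ∀ t ∈ Icc a b, HasDerivAt g (g' t) t) (h2 : ∀ t ∈ Icc a b, HasDerivAt g' (g'' t) t)
    (h3 : ∀ t ∈ Icc a b, 0 < g'' t) (hx : x ∈ Icc a b) (h0 : g' x = 0) :
    ∀ t ∈ Icc a b, t ≠ x → g x < g t := by
  have hmono : StrictMonoOn g' (Icc a b) := by
    refine strictMonoOn_of_deriv_pos (convex_Icc a b)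
      (fun t ht => (h2 t ht).continuousAt.continuousWithinAt) fun t ht => ?_
    have ht' := interior_subset ht
    rw [(h2 t ht').deriv]; exact h3 t ht'
  intro t ht htx
  rcases lt_or_gt_of_ne htx with hlt | hlt
  · have hs : Icc t x ⊆ Icc a b := Icc_subset_Icc ht.1 hx.2
    refine strictAntiOn_of_deriv_neg (convex_Icc t x)
      (fun s hs' => (h1 s (hs hs')).continuousAt.continuousWithinAt) (fun s hs' => ?_)
      (left_mem_Icc.2 hlt.le) (right_mem_Icc.2 hlt.le) hlt
    rw [interior_Icc] at hs'
    have := hs (Ioo_subset_Icc_self hs')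
    rw [(h1 s this).deriv, ← h0]
    exact hmono this hx hs'.2
  · have hs : Icc x t ⊆ Icc a b := Icc_subset_Icc hx.1 ht.2
    refine strictMonoOn_of_deriv_pos (convex_Icc x t)
      (fun s hs' => (h1 s (hs hs')).continuousAt.continuousWithinAt) (fun s hs' => ?_)
      (left_mem_Icc.2 hlt.le) (right_mem_Icc.2 hlt.le) hlt
    rw [interior_Icc] at hs'
    have := hs (Ioo_subset_Icc_self hs')
    rw [(h1 s this).deriv, ← h0]
    exact hmono hx this hs'.1

section Arc

variable {γ : ℝ → Plane}

theorem IsC2OpenArc.hasDerivAt (hγ : IsC2OpenArc γ) {t : ℝ} (ht : t ∈ Ioo (0 : ℝ) 1) :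
    HasDerivAt γ (deriv γ t) t :=
  ((hγ.contDiffOn.contDiffAt (isOpen_Ioo.mem_nhds ht)).differentiableAt two_ne_zero).hasDerivAt

theorem IsC2OpenArc.contDiffOn_deriv (hγ : IsC2OpenArc γ) :
    ContDiffOn ℝ 1 (deriv γ) (Ioo 0 1) :=
  hγ.contDiffOn.deriv_of_isOpen isOpen_Ioo (by norm_num)

theorem IsC2OpenArc.hasDerivAt_deriv (hγ : IsC2OpenArc γ) {t : ℝ} (ht : t ∈ Ioo (0 : ℝ) 1) :
    HasDerivAt (deriv γ) (deriv (deriv γ) t) t :=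
  ((hγ.contDiffOn_deriv.contDiffAt (isOpen_Ioo.mem_nhds ht)).differentiableAt
    one_ne_zero).hasDerivAt

theorem IsC2OpenArc.continuousAt_deriv2 (hγ : IsC2OpenArc γ) {t : ℝ} (ht : t ∈ Ioo (0 : ℝ) 1) :
    ContinuousAt (deriv (deriv γ)) t :=
  (hγ.contDiffOn_deriv.continuousOn_deriv_of_isOpen isOpen_Ioo le_rfl).continuousAt
    (isOpen_Ioo.mem_nhds ht)

theorem continuous_cross : Continuous fun p : Plane × Plane => cross p.1 p.2 := by
  unfold cross; fun_prop

theorem IsC2OpenArc.continuousAt_cross (hγ : IsC2OpenArc γ) {t : ℝ} (ht : t ∈ Ioo (0 : ℝ) 1) :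
    ContinuousAt (fun t => cross (deriv γ t) (deriv (deriv γ) t)) t :=
  continuous_cross.continuousAt.comp
    ((hγ.hasDerivAt_deriv ht).continuousAt.prodMk (hγ.continuousAt_deriv2 ht))

theorem IsC2OpenArc.norm_deriv_pos (hγ : IsC2OpenArc γ) {t : ℝ} (ht : t ∈ Ioo (0 : ℝ) 1) :
    0 < ‖deriv γ t‖ := norm_pos_iff.2 (hγ.deriv_ne_zero t ht)

theorem IsC2OpenArc.continuousAt_curvature (hγ : IsC2OpenArc γ) {t : ℝ}
    (ht : t ∈ Ioo (0 : ℝ) 1) : ContinuousAt (curvature γ) t := by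
  have h := (hγ.norm_deriv_pos ht).ne'
  exact (hγ.continuousAt_cross ht).abs.div ((hγ.hasDerivAt_deriv ht).continuousAt.norm.pow 3)
    (pow_ne_zero 3 h)

theorem curvature_nonneg (γ : ℝ → Plane) (t : ℝ) : 0 ≤ curvature γ t :=
  div_nonneg (abs_nonneg _) (pow_nonneg (norm_nonneg _) 3)

theorem cross_ne_zero_of_curvature_ne_zero {t : ℝ} (h : curvature γ t ≠ 0) :
    cross (deriv γ t) (deriv (deriv γ) t) ≠ 0 := by
  intro h0; apply h; simp [curvature, h0]

/-- The unit normal of the curve that points to the centre of the osculating circle. -/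
noncomputable def unitNormal (γ : ℝ → Plane) (t : ℝ) : Plane :=
  (Real.sign (cross (deriv γ t) (deriv (deriv γ) t)) * ‖deriv γ t‖⁻¹) • rot (deriv γ t)

theorem sign_mul_self_eq {x : ℝ} (h : x ≠ 0) : Real.sign x * Real.sign x = 1 := by
  rcases Real.sign_apply_eq_of_ne_zero x h with h | h <;> rw [h] <;> norm_num

theorem sign_mul_eq_abs (x : ℝ) : Real.sign x * x = |x| := by
  rcases lt_trichotomy x 0 with h | h | h
  · rw [Real.sign_of_neg h, abs_of_neg h]; ring
  · simp [h]
  · rw [Real.sign_of_pos h, abs_of_pos h]; ring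

theorem IsC2OpenArc.norm_unitNormal (hγ : IsC2OpenArc γ) {t : ℝ} (ht : t ∈ Ioo (0 : ℝ) 1)
    (hk : curvature γ t ≠ 0) : ‖unitNormal γ t‖ = 1 := by
  have hc := cross_ne_zero_of_curvature_ne_zero hk
  have hv := (hγ.norm_deriv_pos ht).ne'
  rw [unitNormal, norm_smul, norm_rot, norm_mul, norm_inv, norm_norm, mul_assoc,
    inv_mul_cancel₀ hv, mul_one]
  rcases Real.sign_apply_eq_of_ne_zero _ hc with h | h <;> rw [h] <;> norm_num

theorem inner_deriv_unitNormal (γ : ℝ → Plane) (t : ℝ) :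
    inner ℝ (deriv γ t) (unitNormal γ t) = 0 := by
  rw [unitNormal, inner_smul_right, inner_self_rot, mul_zero]

theorem IsC2OpenArc.inner_unitNormal_deriv2 (hγ : IsC2OpenArc γ) {t : ℝ}
    (ht : t ∈ Ioo (0 : ℝ) 1) :
    inner ℝ (unitNormal γ t) (deriv (deriv γ) t) = curvature γ t * ‖deriv γ t‖ ^ 2 := by
  have hv := (hγ.norm_deriv_pos ht).ne'
  rw [unitNormal, real_inner_smul_left, inner_rot_left, mul_right_comm, sign_mul_eq_abs, curvature]
  field_simp

theorem IsC2OpenArc.evolute_eq (hγ : IsC2OpenArc γ) {t : ℝ} (ht : t ∈ Ioo (0 : ℝ) 1)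
    (hk : curvature γ t ≠ 0) :
    evolute γ t = γ t + (curvature γ t)⁻¹ • unitNormal γ t := by
  have hc := cross_ne_zero_of_curvature_ne_zero hk
  have hv := (hγ.norm_deriv_pos ht).ne'
  rw [evolute, unitNormal, smul_smul, curvature]
  congr 2
  rw [← sign_mul_eq_abs]
  have hs := sign_mul_self_eq hc
  have hs0 : Real.sign (cross (deriv γ t) (deriv (deriv γ) t)) ≠ 0 := by
    intro h; rw [h] at hs; norm_num at hs
  field_simp

theorem IsC2OpenArc.hasDerivAt_unitNormal (hγ : IsC2OpenArc γ) {t : ℝ} (ht : t ∈ Ioo (0 : ℝ) 1)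
    (hk : curvature γ t ≠ 0) :
    HasDerivAt (unitNormal γ) (-(curvature γ t) • deriv γ t) t := by
  have hc := cross_ne_zero_of_curvature_ne_zero hk
  have hv := hγ.norm_deriv_pos ht
  have hs := sign_mul_eq_abs (cross (deriv γ t) (deriv (deriv γ) t))
  set σ := Real.sign (cross (deriv γ t) (deriv (deriv γ) t)) with hσ
  -- The sign of the determinant is locally constant where it does not vanish, so it may be frozen
  -- before differentiating.
  have hloc : unitNormal γ =ᶠ[𝓝 t] fun s => (σ * ‖deriv γ s‖⁻¹) • rot (deriv γ s) := by
    have : ∀ᶠ s in 𝓝 t, Real.sign (cross (deriv γ s) (deriv (deriv γ) s)) = σ := by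
      rcases lt_or_gt_of_ne hc with h | h
      · filter_upwards [(hγ.continuousAt_cross ht).eventually (Iio_mem_nhds h)] with s hs
        rw [hσ, Real.sign_of_neg h, Real.sign_of_neg hs]
      · filter_upwards [(hγ.continuousAt_cross ht).eventually (Ioi_mem_nhds h)] with s hs
        rw [hσ, Real.sign_of_pos h, Real.sign_of_pos hs]
    filter_upwards [this] with s hs
    rw [unitNormal, hs]
  refine HasDerivAt.congr_of_eventuallyEq ?_ hloc
  have hd := hγ.hasDerivAt_deriv ht
  set w := deriv (deriv γ) t
  have hn : HasDerivAt (fun s => ‖deriv γ s‖) (inner ℝ (deriv γ t) w / ‖deriv γ t‖) t := by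
    have h2 := hd.norm_sq.sqrt (pow_ne_zero 2 hv.ne')
    simp only [Real.sqrt_sq (norm_nonneg _)] at h2
    convert h2 using 1
    field_simp
  have hrot : HasDerivAt (fun s => rot (deriv γ s)) (rot w) t := by
    let R : Plane →L[ℝ] Plane := LinearMap.toContinuousLinearMap
      { toFun := rot
        map_add' := fun x y => by apply plane_ext <;> simp; ring
        map_smul' := fun c x => by apply plane_ext <;> simp }
    exact R.hasFDerivAt.comp_hasDerivAt t hd
  have := ((hn.inv hv.ne').const_mul σ).smul hrot
  refine this.congr_deriv ?_
  have hkk : curvature γ t = σ * cross (deriv γ t) w / ‖deriv γ t‖ ^ 3 := by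
    rw [hs, curvature]
  rw [hkk]
  simp only [Pi.inv_apply]
  have hsq := norm_sq_eq_coord (deriv γ t)
  set n := ‖deriv γ t‖
  have hn0 : n ≠ 0 := hv.ne'
  apply plane_ext
  · simp [inner_eq_coord, cross]
    field_simp
    rw [hsq]; ring
  · simp [inner_eq_coord, cross]
    field_simp
    rw [hsq]; ring

theorem IsC2OpenArc.isFramedOn (hγ : IsC2OpenArc γ) {a b : ℝ} (ha : 0 < a) (hb : b < 1)
    (hk : ∀ t ∈ Icc a b, curvature γ t ≠ 0) :
    IsFramedOn γ (deriv γ) (unitNormal γ) (curvature γ) a b := by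
  have hs : ∀ t ∈ Icc a b, t ∈ Ioo (0 : ℝ) 1 := fun t ht =>
    ⟨ha.trans_le ht.1, ht.2.trans_lt hb⟩
  exact ⟨fun t ht => hγ.hasDerivAt (hs t ht),
    fun t ht => hγ.hasDerivAt_unitNormal (hs t ht) (hk t ht),
    fun t ht => hγ.norm_unitNormal (hs t ht) (hk t ht),
    fun t ht => lt_of_le_of_ne (curvature_nonneg γ t) (hk t ht).symm,
    fun t ht => hγ.deriv_ne_zero t (hs t ht),
    fun t ht => (hγ.hasDerivAt_deriv (hs t ht)).continuousAt.continuousWithinAt⟩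

theorem IsC2OpenArc.focal_eq_evolute (hγ : IsC2OpenArc γ) {t : ℝ} (ht : t ∈ Ioo (0 : ℝ) 1)
    (hk : curvature γ t ≠ 0) :
    focal γ (unitNormal γ) (curvature γ) t = evolute γ t := (hγ.evolute_eq ht hk).symm

theorem IsC2OpenArc.dist_evolute (hγ : IsC2OpenArc γ) {t : ℝ} (ht : t ∈ Ioo (0 : ℝ) 1)
    (hk : curvature γ t ≠ 0) : dist (evolute γ t) (γ t) = (curvature γ t)⁻¹ := by
  rw [hγ.evolute_eq ht hk, dist_eq_norm, add_sub_cancel_left, norm_smul, hγ.norm_unitNormal ht hk,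
    mul_one, Real.norm_eq_abs, abs_of_nonneg (inv_nonneg.2 (curvature_nonneg γ t))]

end Arc

end DividerSet

/-! ### First and second order conditions for the distance to a point -/

namespace DividerSet

variable {γ : ℝ → Plane}

/-- Half of the second derivative of the squared distance of `γ t` to `z`. -/
noncomputable def secondForm (γ : ℝ → Plane) (z : Plane) (t : ℝ) : ℝ :=
  ‖deriv γ t‖ ^ 2 + inner ℝ (γ t - z) (deriv (deriv γ) t)

theorem IsC2OpenArc.hasDerivAt_sqDist (hγ : IsC2OpenArc γ) (z : Plane) {t : ℝ}
    (ht : t ∈ Ioo (0 : ℝ) 1) :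
    HasDerivAt (fun t => ‖γ t - z‖ ^ 2) (2 * inner ℝ (γ t - z) (deriv γ t)) t :=
  ((hγ.hasDerivAt ht).sub_const z).norm_sq

theorem IsC2OpenArc.hasDerivAt_deriv_sqDist (hγ : IsC2OpenArc γ) (z : Plane) {t : ℝ}
    (ht : t ∈ Ioo (0 : ℝ) 1) :
    HasDerivAt (fun t => 2 * inner ℝ (γ t - z) (deriv γ t)) (2 * secondForm γ z t) t := by
  have := (((hγ.hasDerivAt ht).sub_const z).inner ℝ (hγ.hasDerivAt_deriv ht)).const_mul 2
  refine this.congr_deriv ?_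
  rw [secondForm, real_inner_self_eq_norm_sq]; ring

theorem IsC2OpenArc.continuousAt_secondForm (hγ : IsC2OpenArc γ) (z : Plane) {t : ℝ}
    (ht : t ∈ Ioo (0 : ℝ) 1) :
    ContinuousAt (fun p : Plane × ℝ => secondForm γ p.1 p.2) (z, t) := by
  have h1 : ContinuousAt (fun p : Plane × ℝ => γ p.2) (z, t) :=
    ContinuousAt.comp (f := Prod.snd) (hγ.hasDerivAt ht).continuousAt continuousAt_snd
  have h2 : ContinuousAt (fun p : Plane × ℝ => deriv γ p.2) (z, t) :=
    ContinuousAt.comp (f := Prod.snd) (g := deriv γ) (hγ.hasDerivAt_deriv ht).continuousAt continuousAt_snd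
  have h3 : ContinuousAt (fun p : Plane × ℝ => deriv (deriv γ) p.2) (z, t) :=
    ContinuousAt.comp (f := Prod.snd) (g := deriv (deriv γ)) (hγ.continuousAt_deriv2 ht) continuousAt_snd
  exact (h2.norm.pow 2).add ((h1.sub continuousAt_fst).inner h3)

theorem exists_Icc_subset_of_eventually {P : ℝ → Prop} {t : ℝ} (h : ∀ᶠ s in 𝓝 t, P s) :
    ∃ η > 0, ∀ s ∈ Icc (t - η) (t + η), P s := by
  obtain ⟨η, hη, hs⟩ := Metric.nhds_basis_closedBall.eventually_iff.1 h
  exact ⟨η, hη, fun s hs' => hs (by rwa [Real.closedBall_eq_Icc])⟩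

theorem dist_lt_dist_iff_sq (z x y : Plane) : dist z x < dist z y ↔ ‖x - z‖ ^ 2 < ‖y - z‖ ^ 2 := by
  rw [dist_comm z x, dist_comm z y, dist_eq_norm, dist_eq_norm,
    sq_lt_sq₀ (norm_nonneg _) (norm_nonneg _)]

/-- Where the second derivative of the squared distance is positive, a critical point of the
distance is a strict local minimum, on a parameter interval uniform in the centre. -/
theorem IsC2OpenArc.exists_strict_min (hγ : IsC2OpenArc γ) {c : Plane} {t : ℝ}
    (ht : t ∈ Ioo (0 : ℝ) 1) (h : 0 < secondForm γ c t) :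
    ∃ η > 0, Icc (t - η) (t + η) ⊆ Ioo 0 1 ∧ ∀ᶠ z in 𝓝 c, inner ℝ (γ t - z) (deriv γ t) = 0 →
      ∀ s ∈ Icc (t - η) (t + η), s ≠ t → dist z (γ t) < dist z (γ s) := by
  have hc := (hγ.continuousAt_secondForm c ht).eventually (Ioi_mem_nhds h)
  rw [nhds_prod_eq, eventually_prod_iff] at hc
  obtain ⟨P, hP, Q, hQ, hPQ⟩ := hc
  obtain ⟨η, hη, hs⟩ := exists_Icc_subset_of_eventually (hQ.and (isOpen_Ioo.mem_nhds ht))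
  refine ⟨η, hη, fun s hs' => (hs s hs').2, ?_⟩
  filter_upwards [hP] with z hz hcrit s hs' hst
  rw [dist_lt_dist_iff_sq]
  refine strict_min_of_second_deriv_pos
    (fun s hs' => hγ.hasDerivAt_sqDist z (hs s hs').2)
    (fun s hs' => hγ.hasDerivAt_deriv_sqDist z (hs s hs').2)
    (fun s hs' => ?_) ⟨by linarith, by linarith⟩ (by rw [hcrit, mul_zero]) s hs' hst
  have := hPQ hz (hs s hs').1
  simp only at this
  linarith

theorem IsC2OpenArc.eventually_dist_lt (hγ : IsC2OpenArc γ) {z : Plane} {t : ℝ}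
    (ht : t ∈ Ioo (0 : ℝ) 1) (h : secondForm γ z t < 0)
    (hcrit : inner ℝ (γ t - z) (deriv γ t) = 0) :
    ∀ᶠ s in 𝓝 t, s ≠ t → dist z (γ s) < dist z (γ t) := by
  have hc : ∀ᶠ s in 𝓝 t, secondForm γ z s < 0 :=
    (ContinuousAt.comp (f := fun s : ℝ => (z, s)) (hγ.continuousAt_secondForm z ht)
      (by fun_prop)).eventually (Iio_mem_nhds h)
  obtain ⟨η, hη, hs⟩ := exists_Icc_subset_of_eventually (hc.and (isOpen_Ioo.mem_nhds ht))
  filter_upwards [Icc_mem_nhds (show t - η < t by linarith) (show t < t + η by linarith)]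
    with s hs' hst
  rw [dist_lt_dist_iff_sq, ← neg_lt_neg_iff]
  refine strict_min_of_second_deriv_pos
    (fun s hs' => (hγ.hasDerivAt_sqDist z (hs s hs').2).neg)
    (fun s hs' => (hγ.hasDerivAt_deriv_sqDist z (hs s hs').2).neg)
    (fun s hs' => ?_) ⟨by linarith, by linarith⟩ ?_ s hs' hst
  · have := (hs s hs').1
    linarith
  · simp [hcrit]

theorem IsC2OpenArc.inner_eq_zero_of_isLocalExtr (hγ : IsC2OpenArc γ) {z : Plane} {t : ℝ}
    (ht : t ∈ Ioo (0 : ℝ) 1) (h : IsLocalExtr (fun s => dist z (γ s)) t) :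
    inner ℝ (γ t - z) (deriv γ t) = 0 := by
  have h2 : IsLocalExtr (fun t => ‖γ t - z‖ ^ 2) t := by
    refine h.imp (fun h => ?_) fun h => ?_
    · filter_upwards [h] with s hs
      have : ‖γ t - z‖ ≤ ‖γ s - z‖ := by simpa only [dist_comm z, dist_eq_norm] using hs
      gcongr
    · filter_upwards [h] with s hs
      have : ‖γ s - z‖ ≤ ‖γ t - z‖ := by simpa only [dist_comm z, dist_eq_norm] using hs
      gcongr
  have := h2.hasDerivAt_eq_zero (hγ.hasDerivAt_sqDist z ht)
  linarith

theorem IsC2OpenArc.secondForm_nonpos_of_isLocalMax (hγ : IsC2OpenArc γ) {z : Plane} {t : ℝ}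
    (ht : t ∈ Ioo (0 : ℝ) 1) (h : IsLocalMax (fun s => dist z (γ s)) t) :
    secondForm γ z t ≤ 0 := by
  by_contra! hpos
  have hcrit := hγ.inner_eq_zero_of_isLocalExtr ht (Or.inr h)
  obtain ⟨η, hη, -, hev⟩ := hγ.exists_strict_min ht hpos
  have h1 := hev.self_of_nhds hcrit
  have h2 : ∀ᶠ s in 𝓝[≠] t, False := by
    filter_upwards [nhdsWithin_le_nhds h, self_mem_nhdsWithin, nhdsWithin_le_nhds
      (Icc_mem_nhds (show t - η < t by linarith) (show t < t + η by linarith))] with s hs hst hs'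
    exact absurd (h1 s hs' hst) (not_lt.2 hs)
  exact h2.exists.elim fun _ h => h

theorem IsC2OpenArc.secondForm_nonneg_of_isLocalMin (hγ : IsC2OpenArc γ) {z : Plane} {t : ℝ}
    (ht : t ∈ Ioo (0 : ℝ) 1) (h : IsLocalMin (fun s => dist z (γ s)) t) :
    0 ≤ secondForm γ z t := by
  by_contra! hneg
  have hcrit := hγ.inner_eq_zero_of_isLocalExtr ht (Or.inl h)
  have h1 := hγ.eventually_dist_lt ht hneg hcrit
  have h2 : ∀ᶠ s in 𝓝[≠] t, False := by
    filter_upwards [nhdsWithin_le_nhds h, self_mem_nhdsWithin, nhdsWithin_le_nhds h1]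
      with s hs hst hs'
    exact absurd (hs' hst) (not_lt.2 hs)
  exact h2.exists.elim fun _ h => h

theorem IsC2OpenArc.smul_unitNormal_of_inner_eq_zero (hγ : IsC2OpenArc γ) {z : Plane} {t : ℝ}
    (ht : t ∈ Ioo (0 : ℝ) 1) (hk : curvature γ t ≠ 0)
    (hcrit : inner ℝ (γ t - z) (deriv γ t) = 0) :
    z = γ t + inner ℝ (z - γ t) (unitNormal γ t) • unitNormal γ t := by
  have hv := (hγ.norm_deriv_pos ht).ne'
  have h1 : inner ℝ (deriv γ t) (z - γ t) = 0 := by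
    rw [real_inner_comm, ← neg_sub, inner_neg_left, hcrit, neg_zero]
  have h2 := smul_rot_of_inner_eq_zero h1
  have hs := sign_mul_self_eq (cross_ne_zero_of_curvature_ne_zero hk)
  have h3 : inner ℝ (z - γ t) (unitNormal γ t) • unitNormal γ t = z - γ t := by
    have : z - γ t = (‖deriv γ t‖ ^ 2)⁻¹ • (cross (deriv γ t) (z - γ t) • rot (deriv γ t)) := by
      rw [← h2, smul_smul, inv_mul_cancel₀ (pow_ne_zero 2 hv), one_smul]
    conv_rhs => rw [this]
    rw [unitNormal, inner_smul_right, real_inner_comm, inner_rot_left, smul_smul, smul_smul]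
    congr 1
    field_simp
    linear_combination cross (deriv γ t) (z - γ t) * hs
  rw [h3, add_sub_cancel]

theorem IsC2OpenArc.secondForm_normal (hγ : IsC2OpenArc γ) {t : ℝ}
    (ht : t ∈ Ioo (0 : ℝ) 1) (d : ℝ) :
    secondForm γ (γ t + d • unitNormal γ t) t = ‖deriv γ t‖ ^ 2 * (1 - d * curvature γ t) := by
  rw [secondForm, sub_add_cancel_left, inner_neg_left, real_inner_smul_left,
    hγ.inner_unitNormal_deriv2 ht]
  ring

theorem inner_normal_sub_deriv (γ : ℝ → Plane) (t d : ℝ) :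
    inner ℝ (γ t - (γ t + d • unitNormal γ t)) (deriv γ t) = 0 := by
  rw [sub_add_cancel_left, inner_neg_left, real_inner_smul_left, real_inner_comm,
    inner_deriv_unitNormal]
  simp

/-- At zero curvature the acceleration is tangential, so at a critical point the second form reduces
to the squared speed, which is positive. -/
theorem IsC2OpenArc.curvature_ne_zero_of_secondForm_nonpos (hγ : IsC2OpenArc γ) {z : Plane}
    {t : ℝ} (ht : t ∈ Ioo (0 : ℝ) 1) (hcrit : inner ℝ (γ t - z) (deriv γ t) = 0)
    (h : secondForm γ z t ≤ 0) : curvature γ t ≠ 0 := by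
  intro hk
  have hv := hγ.norm_deriv_pos ht
  have hc : cross (deriv γ t) (deriv (deriv γ) t) = 0 := by
    rw [curvature, div_eq_zero_iff, abs_eq_zero] at hk
    exact hk.resolve_right (pow_pos hv 3).ne'
  have h1 : inner ℝ (deriv γ t) (γ t - z) = 0 := by rw [real_inner_comm, hcrit]
  have h2 := congrArg (fun w => inner ℝ w (deriv (deriv γ) t)) (smul_rot_of_inner_eq_zero h1)
  simp only [real_inner_smul_left, inner_rot_left, hc, mul_zero] at h2
  have h3 := (mul_eq_zero.1 h2).resolve_left (pow_pos hv 2).ne'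
  rw [secondForm, h3, add_zero] at h
  exact absurd h (not_le.2 (pow_pos hv 2))

theorem IsC2OpenArc.exists_normal_of_isLocalMax (hγ : IsC2OpenArc γ) {z : Plane} {t : ℝ}
    (ht : t ∈ Ioo (0 : ℝ) 1) (h : IsLocalMax (fun s => dist z (γ s)) t) :
    curvature γ t ≠ 0 ∧ ∃ d, (curvature γ t)⁻¹ ≤ d ∧ z = γ t + d • unitNormal γ t := by
  have hcrit := hγ.inner_eq_zero_of_isLocalExtr ht (Or.inr h)
  have h2 := hγ.secondForm_nonpos_of_isLocalMax ht h
  have hk := hγ.curvature_ne_zero_of_secondForm_nonpos ht hcrit h2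
  refine ⟨hk, _, ?_, hγ.smul_unitNormal_of_inner_eq_zero ht hk hcrit⟩
  rw [hγ.smul_unitNormal_of_inner_eq_zero ht hk hcrit, hγ.secondForm_normal ht] at h2
  have hk' := lt_of_le_of_ne (curvature_nonneg γ t) hk.symm
  have h3 := nonpos_of_mul_nonpos_right h2 (pow_pos (hγ.norm_deriv_pos ht) 2)
  rw [inv_le_iff_one_le_mul₀ hk']
  linarith

theorem IsC2OpenArc.eq_evolute_of_secondForm_eq_zero (hγ : IsC2OpenArc γ) {z : Plane} {t : ℝ}
    (ht : t ∈ Ioo (0 : ℝ) 1) (hcrit : inner ℝ (γ t - z) (deriv γ t) = 0)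
    (h : secondForm γ z t = 0) : curvature γ t ≠ 0 ∧ z = evolute γ t := by
  have hk := hγ.curvature_ne_zero_of_secondForm_nonpos ht hcrit h.le
  refine ⟨hk, ?_⟩
  have hz := hγ.smul_unitNormal_of_inner_eq_zero ht hk hcrit
  rw [hz, hγ.secondForm_normal ht] at h
  have h3 := (mul_eq_zero.1 h).resolve_left (pow_pos (hγ.norm_deriv_pos ht) 2).ne'
  rw [hz, hγ.evolute_eq ht hk]
  congr 2
  exact eq_inv_of_mul_eq_one_left (by linarith)

theorem IsC2OpenArc.dist_normal (hγ : IsC2OpenArc γ) {t : ℝ} (ht : t ∈ Ioo (0 : ℝ) 1)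
    (hk : curvature γ t ≠ 0) (d : ℝ) : dist (γ t + d • unitNormal γ t) (γ t) = |d| := by
  rw [dist_eq_norm, add_sub_cancel_left, norm_smul, hγ.norm_unitNormal ht hk, mul_one,
    Real.norm_eq_abs]

theorem IsC2OpenArc.sbtw_iff (hγ : IsC2OpenArc γ) {t : ℝ} (ht : t ∈ Ioo (0 : ℝ) 1)
    (hk : curvature γ t ≠ 0) {z : Plane} :
    Sbtw ℝ (γ t) (evolute γ t) z ↔
      ∃ d, (curvature γ t)⁻¹ < d ∧ z = γ t + d • unitNormal γ t := by
  have hk' : 0 < (curvature γ t)⁻¹ :=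
    inv_pos.2 (lt_of_le_of_ne (curvature_nonneg γ t) hk.symm)
  have hN := hγ.norm_unitNormal ht hk
  have hN0 : unitNormal γ t ≠ 0 := by intro h; rw [h, norm_zero] at hN; norm_num at hN
  rw [hγ.evolute_eq ht hk]
  set k := curvature γ t
  constructor
  · rintro ⟨⟨r, hr, hr'⟩, h1, h2⟩
    have hr0 : r ≠ 0 := by
      rintro rfl
      apply h1; rw [← hr']; simp
    have hr1 : r ≠ 1 := by
      rintro rfl
      apply h2; rw [← hr']; simp
    have hrp : 0 < r := lt_of_le_of_ne hr.1 hr0.symm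
    have hrl : r < 1 := lt_of_le_of_ne hr.2 hr1
    refine ⟨r⁻¹ * k⁻¹, ?_, ?_⟩
    · have : 1 < r⁻¹ := (one_lt_inv₀ hrp).2 hrl
      nlinarith
    · rw [AffineMap.lineMap_apply, vsub_eq_sub, vadd_eq_add, add_comm, add_right_inj] at hr'
      rw [mul_smul, ← hr', smul_smul, inv_mul_cancel₀ hr0, one_smul, add_sub_cancel]
  · rintro ⟨d, hd, rfl⟩
    have hd0 : 0 < d := hk'.trans hd
    refine ⟨⟨k⁻¹ / d, ⟨by positivity, (div_le_one hd0).2 hd.le⟩, ?_⟩, ?_, ?_⟩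
    · rw [AffineMap.lineMap_apply, vsub_eq_sub, vadd_eq_add, add_sub_cancel_left, smul_smul,
        div_mul_cancel₀ _ hd0.ne', add_comm]
    · simpa using ⟨hk, hN0⟩
    · intro h
      exact hd.ne (smul_left_injective ℝ hN0 (add_left_cancel h))

/-- If the distance were constant, every parameter would be both a local minimum and a local
maximum; the second form then vanishes, `c` is always the centre of curvature, and the curvature is
constantly `R⁻¹`. -/
theorem IsC2OpenArc.exists_dist_ne (hγ : IsC2OpenArc γ) (hconst : NoConstantCurvatureArc γ)
    {a b : ℝ} (ha : 0 ≤ a) (hab : a < b) (hb : b ≤ 1) (c : Plane) (R : ℝ) :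
    ∃ t ∈ Ioo a b, dist c (γ t) ≠ R := by
  by_contra! hall
  -- The middle third is a closed subinterval that stays away from the end parameters `0` and `1`.
  refine hconst (a + (b - a) / 3) (a + 2 * (b - a) / 3) (by linarith) (by linarith) (by linarith)
    ⟨R⁻¹, fun t ht => ?_⟩
  have ht1 : t ∈ Ioo a b := ⟨by linarith [ht.1], by linarith [ht.2]⟩
  have ht' : t ∈ Ioo (0 : ℝ) 1 := ⟨ha.trans_lt ht1.1, ht1.2.trans_le hb⟩
  have heq : (fun s => dist c (γ s)) =ᶠ[𝓝 t] fun _ => dist c (γ t) := by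
    filter_upwards [isOpen_Ioo.mem_nhds ht1] with s hs
    rw [hall s hs, hall t ht1]
  have hmax : IsLocalMax (fun s => dist c (γ s)) t := by
    filter_upwards [heq] with s hs using hs.le
  have hmin : IsLocalMin (fun s => dist c (γ s)) t := by
    filter_upwards [heq] with s hs using hs.ge
  obtain ⟨hk, hc⟩ := hγ.eq_evolute_of_secondForm_eq_zero ht'
    (hγ.inner_eq_zero_of_isLocalExtr ht' (Or.inr hmax))
    (le_antisymm (hγ.secondForm_nonpos_of_isLocalMax ht' hmax)
      (hγ.secondForm_nonneg_of_isLocalMin ht' hmin))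
  have h1 := hall t ht1
  rw [hc, hγ.dist_evolute ht' hk] at h1
  rw [← h1, inv_inv]

end DividerSet

/-! ### Functions without interior local maxima -/

namespace DividerSet

section RealFunction

variable {k : ℝ → ℝ}

/-- Absence of local maxima amounts to strict quasiconvexity: otherwise the maximum over the compact
interval would be attained at an interior point, possibly at `y` itself. The monotonicity lemmas
below use only this inequality, together with continuity where an extremum must exist. -/
theorem lt_max_of_forall_not_isLocalMax {x y z : ℝ} (hc : ContinuousOn k (Icc x z))
    (hxy : x < y) (hyz : y < z) (h : ∀ t ∈ Ioo x z, ¬ IsLocalMax k t) :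
    k y < max (k x) (k z) := by
  by_contra! hle
  obtain ⟨m, hm, hmax⟩ := isCompact_Icc.exists_isMaxOn ⟨x, left_mem_Icc.2 (hxy.trans hyz).le⟩ hc
  have key : ∀ p ∈ Ioo x z, ¬ ∀ t ∈ Icc x z, k t ≤ k p := fun p hp hall => by
    apply h p hp
    filter_upwards [Icc_mem_nhds hp.1 hp.2] with t ht using hall t ht
  have hmo : ¬ m ∈ Ioo x z := fun hm' => key m hm' hmax
  have hmk : k m ≤ k y := by
    rcases eq_or_lt_of_le hm.1 with h1 | h1
    · rw [← h1]; exact (le_max_left _ _).trans hle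
    · rcases eq_or_lt_of_le hm.2 with h2 | h2
      · rw [h2]; exact (le_max_right _ _).trans hle
      · exact absurd ⟨h1, h2⟩ hmo
  exact key y ⟨hxy, hyz⟩ fun t ht => (hmax ht).trans hmk

/-- A strictly quasiconvex function decreases strictly up to a minimum point `m`, and `m = a` is
impossible because `a` is also a maximum. -/
theorem exists_strictAntiOn_right {a b : ℝ} (hab : a < b) (hc : ContinuousOn k (Icc a b))
    (hq : ∀ x ∈ Icc a b, ∀ y, ∀ z ∈ Icc a b, x < y → y < z → k y < max (k x) (k z))
    (hle : ∀ z ∈ Icc a b, k z ≤ k a) : ∃ m ∈ Ioc a b, StrictAntiOn k (Icc a m) := by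
  have ha : a ∈ Icc a b := left_mem_Icc.2 hab.le
  have hb : b ∈ Icc a b := right_mem_Icc.2 hab.le
  obtain ⟨m, hm, hmin⟩ := isCompact_Icc.exists_isMinOn ⟨a, ha⟩ hc
  have ham : a ≠ m := by
    rintro rfl
    have h1 := hq a ha ((a + b) / 2) b hb (by linarith) (by linarith)
    have h2 : k a ≤ k ((a + b) / 2) := hmin ⟨by linarith, by linarith⟩
    have h3 := hle b hb
    rw [max_eq_left h3] at h1
    linarith
  refine ⟨m, ⟨lt_of_le_of_ne hm.1 ham, hm.2⟩, fun y hy z hz hyz => ?_⟩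
  have hs : Icc a m ⊆ Icc a b := Icc_subset_Icc le_rfl hm.2
  have aux : ∀ y ∈ Icc a m, ∀ z ∈ Icc a m, y < z → z < m → k z < k y := by
    intro y hy z hz hyz hzm
    have h1 := hq y (hs hy) z m hm hyz hzm
    have h2 : k m ≤ k z := hmin (hs hz)
    rcases max_choice (k y) (k m) with h | h <;> rw [h] at h1
    · exact h1
    · linarith
  rcases eq_or_lt_of_le hz.2 with h | h
  · have h1 := aux y hy ((y + z) / 2) ⟨by linarith [hy.1], by linarith [hz.2]⟩ (by linarith)
      (by linarith)
    have h2 : k m ≤ k ((y + z) / 2) := hmin (hs ⟨by linarith [hy.1], by linarith [hz.2]⟩)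
    rw [h]; linarith
  · exact aux y hy z hz hyz h

theorem exists_strictMonoOn_left {a b : ℝ} (hab : a < b) (hc : ContinuousOn k (Icc a b))
    (hq : ∀ x ∈ Icc a b, ∀ y, ∀ z ∈ Icc a b, x < y → y < z → k y < max (k x) (k z))
    (hle : ∀ z ∈ Icc a b, k z ≤ k b) : ∃ m ∈ Ico a b, StrictMonoOn k (Icc m b) := by
  have hs : ∀ t ∈ Icc (-b) (-a), -t ∈ Icc a b := fun t ht =>
    ⟨by linarith [ht.2], by linarith [ht.1]⟩
  obtain ⟨m, hm, hanti⟩ := exists_strictAntiOn_right (k := fun t => k (-t)) (neg_lt_neg hab)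
    (hc.comp continuous_neg.continuousOn hs)
    (fun x hx y z hz hxy hyz => by
      rw [max_comm]
      exact hq _ (hs z hz) _ _ (hs x hx) (neg_lt_neg hyz) (neg_lt_neg hxy))
    (fun z hz => by simpa using hle _ (hs z hz))
  refine ⟨-m, ⟨by linarith [hm.2], by linarith [hm.1]⟩, fun x hx y hy hxy => ?_⟩
  have := hanti (a := -y) (b := -x) ⟨by linarith [hy.2], by linarith [hy.1]⟩
    ⟨by linarith [hx.2], by linarith [hx.1]⟩ (neg_lt_neg hxy)
  simpa using this

/-- Once a strictly quasiconvex function fails to decrease, from `y` to `z` say, it increases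
strictly from `z` on. -/
theorem strictAntiOn_or_exists_strictMonoOn {a b : ℝ}
    (hq : ∀ x ∈ Ico a b, ∀ y, ∀ z ∈ Ico a b, x < y → y < z → k y < max (k x) (k z)) :
    StrictAntiOn k (Ico a b) ∨ ∃ z ∈ Ioo a b, StrictMonoOn k (Ico z b) := by
  by_contra! hcon
  obtain ⟨h1, h2⟩ := hcon
  apply h1
  intro y hy z hz hyz
  by_contra! hle
  refine h2 z ⟨hy.1.trans_lt hyz, hz.2⟩ fun u hu v hv huv => ?_
  have hz' : ∀ w ∈ Ioo z b, k z < k w := fun w hw => by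
    have := hq y hy z w ⟨hz.1.trans hw.1.le, hw.2⟩ hyz hw.1
    rcases lt_max_iff.1 this with h | h
    · linarith
    · exact h
  rcases eq_or_lt_of_le hu.1 with h | h
  · rw [← h]; exact hz' v ⟨h.trans_lt huv, hv.2⟩
  · have := hq z hz u v ⟨hz.1.trans hv.1, hv.2⟩ h huv
    rcases lt_max_iff.1 this with h' | h'
    · linarith [hz' u ⟨h, hu.2⟩]
    · exact h'

theorem strictMonoOn_or_exists_strictAntiOn {a b : ℝ}
    (hq : ∀ x ∈ Ioc a b, ∀ y, ∀ z ∈ Ioc a b, x < y → y < z → k y < max (k x) (k z)) :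
    StrictMonoOn k (Ioc a b) ∨ ∃ z ∈ Ioo a b, StrictAntiOn k (Ioc a z) := by
  have hs : ∀ t ∈ Ico (-b) (-a), -t ∈ Ioc a b := fun t ht =>
    ⟨by linarith [ht.2], by linarith [ht.1]⟩
  rcases strictAntiOn_or_exists_strictMonoOn (k := fun t => k (-t)) (a := -b) (b := -a)
    (fun x hx y z hz hxy hyz => by
      rw [max_comm]
      exact hq _ (hs z hz) _ _ (hs x hx) (neg_lt_neg hyz) (neg_lt_neg hxy)) with h | ⟨z, hz, h⟩
  · left
    intro x hx y hy hxy
    have := h (a := -y) (b := -x) ⟨by linarith [hy.2], by linarith [hy.1]⟩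
      ⟨by linarith [hx.2], by linarith [hx.1]⟩ (neg_lt_neg hxy)
    simpa using this
  · right
    refine ⟨-z, ⟨by linarith [hz.2], by linarith [hz.1]⟩, fun x hx y hy hxy => ?_⟩
    have := h (a := -y) (b := -x) ⟨by linarith [hy.2], by linarith [hy.1]⟩
      ⟨by linarith [hx.2], by linarith [hx.1]⟩ (neg_lt_neg hxy)
    simpa using this

theorem strictMonoOn_of_frequently_gt {t b : ℝ} (htb : t < b)
    (hq : ∀ x ∈ Ico t b, ∀ y, ∀ z ∈ Ico t b, x < y → y < z → k y < max (k x) (k z))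
    (hf : ∃ᶠ s in 𝓝[>] t, k t < k s) : StrictMonoOn k (Ico t b) := by
  have hgt : ∀ s ∈ Ioo t b, k t < k s := by
    intro s hs
    obtain ⟨r, hr, hr'⟩ := (hf.and_eventually (Ioo_mem_nhdsGT hs.1)).exists
    rcases lt_max_iff.1 (hq t ⟨le_rfl, htb⟩ r s ⟨hs.1.le, hs.2⟩ hr'.1 hr'.2) with h | h
    · linarith
    · linarith
  intro x hx y hy hxy
  rcases eq_or_lt_of_le hx.1 with h | h
  · rw [← h]; exact hgt y ⟨h.trans_lt hxy, hy.2⟩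
  · rcases lt_max_iff.1 (hq t ⟨le_rfl, htb⟩ x y hy h hxy) with h' | h'
    · linarith [hgt x ⟨h, hx.2⟩]
    · exact h'

theorem strictAntiOn_of_frequently_gt {t a : ℝ} (hat : a < t)
    (hq : ∀ x ∈ Ioc a t, ∀ y, ∀ z ∈ Ioc a t, x < y → y < z → k y < max (k x) (k z))
    (hf : ∃ᶠ s in 𝓝[<] t, k t < k s) : StrictAntiOn k (Ioc a t) := by
  have hs : ∀ s ∈ Ico (-t) (-a), -s ∈ Ioc a t := fun t ht =>
    ⟨by linarith [ht.2], by linarith [ht.1]⟩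
  have := strictMonoOn_of_frequently_gt (k := fun t => k (-t)) (neg_lt_neg hat)
    (fun x hx y z hz hxy hyz => by
      rw [max_comm]
      exact hq _ (hs z hz) _ _ (hs x hx) (neg_lt_neg hyz) (neg_lt_neg hxy))
    (by
      have h := tendsto_neg_nhdsLT (a := t)
      refine h.frequently (hf.mono fun s hs => ?_)
      simpa using hs)
  intro x hx y hy hxy
  have := this (a := -y) (b := -x) ⟨by linarith [hy.2], by linarith [hy.1]⟩
    ⟨by linarith [hx.2], by linarith [hx.1]⟩ (neg_lt_neg hxy)
  simpa using this

end RealFunction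

/-! ### Monotonicity of the curvature, the cusp, and unbounded ends -/

section Curve

variable {γ : ℝ → Plane}

theorem IsC2OpenArc.dist_evolute_of_strictAntiOn (hγ : IsC2OpenArc γ) {a b : ℝ} (ha : 0 < a)
    (hab : a < b) (hb : b < 1) (h : StrictAntiOn (curvature γ) (Icc a b))
    (hk : curvature γ b ≠ 0) :
    (curvature γ a)⁻¹ < dist (evolute γ a) (γ b) ∧ dist (evolute γ b) (γ a) < (curvature γ b)⁻¹ ∧
    dist (evolute γ a) (evolute γ b) < (curvature γ b)⁻¹ - (curvature γ a)⁻¹ := by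
  have hb' := right_mem_Icc.2 hab.le
  have ha' := left_mem_Icc.2 hab.le
  have hne : ∀ t ∈ Icc a b, curvature γ t ≠ 0 := fun t ht =>
    ((lt_of_le_of_ne (curvature_nonneg γ b) hk.symm).trans_le (h.antitoneOn ht hb' ht.2)).ne'
  have hF := hγ.isFramedOn ha hb hne
  have e1 := hγ.focal_eq_evolute ⟨ha, hab.trans hb⟩ (hne a ha')
  have e2 := hγ.focal_eq_evolute ⟨ha.trans hab, hb⟩ hk
  have h1 := hF.inv_lt_norm_sub_left hab h
  have h2 := hF.norm_sub_lt_inv_right hab h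
  have h3 := hF.norm_focal_sub_lt hab h
  rw [e1] at h1 h3
  rw [e2] at h2 h3
  rw [dist_comm, dist_comm (evolute γ b), dist_comm (evolute γ a)]
  simp only [dist_eq_norm]
  exact ⟨h1, h2, h3⟩

theorem IsC2OpenArc.dist_evolute_of_strictMonoOn (hγ : IsC2OpenArc γ) {a b : ℝ} (ha : 0 < a)
    (hab : a < b) (hb : b < 1) (h : StrictMonoOn (curvature γ) (Icc a b))
    (hk : curvature γ a ≠ 0) :
    dist (evolute γ a) (γ b) < (curvature γ a)⁻¹ ∧ (curvature γ b)⁻¹ < dist (evolute γ b) (γ a) ∧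
    dist (evolute γ a) (evolute γ b) < (curvature γ a)⁻¹ - (curvature γ b)⁻¹ := by
  have hb' := right_mem_Icc.2 hab.le
  have ha' := left_mem_Icc.2 hab.le
  have hne : ∀ t ∈ Icc a b, curvature γ t ≠ 0 := fun t ht =>
    ((lt_of_le_of_ne (curvature_nonneg γ a) hk.symm).trans_le (h.monotoneOn ha' ht ht.1)).ne'
  have hF := hγ.isFramedOn ha hb hne
  have e1 := hγ.focal_eq_evolute ⟨ha, hab.trans hb⟩ hk
  have e2 := hγ.focal_eq_evolute ⟨ha.trans hab, hb⟩ (hne b hb')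
  have h1 := hF.norm_sub_lt_inv_left hab h
  have h2 := hF.inv_lt_norm_sub_right hab h
  have h3 := hF.norm_focal_sub_lt_of_strictMonoOn hab h
  rw [e1] at h1 h3
  rw [e2] at h2 h3
  rw [dist_comm, dist_comm (evolute γ b), dist_comm (evolute γ a)]
  simp only [dist_eq_norm]
  exact ⟨h1, h2, h3⟩

theorem IsC2OpenArc.curvature_lt_max (hγ : IsC2OpenArc γ) {x y z : ℝ} (hx : 0 < x) (hz : z < 1)
    (hxy : x < y) (hyz : y < z) (h : ∀ t ∈ Ioo x z, ¬ IsLocalMax (curvature γ) t) :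
    curvature γ y < max (curvature γ x) (curvature γ z) :=
  lt_max_of_forall_not_isLocalMax (fun _ ht => (hγ.continuousAt_curvature
    ⟨hx.trans_le ht.1, ht.2.trans_lt hz⟩).continuousWithinAt) hxy hyz h

/-- With no other local maximum nearby, the curvature is strictly monotone on either side of `t₀`,
so both branches of the evolute leave in the direction `unitNormal γ t₀`. -/
theorem IsC2OpenArc.isEvoluteCusp (hγ : IsC2OpenArc γ) {t₀ : ℝ} (ht₀ : t₀ ∈ Ioo (0 : ℝ) 1)
    (hloc : IsLocalMax (curvature γ) t₀)
    (huniq : ∀ t ∈ Ioo (0 : ℝ) 1, IsLocalMax (curvature γ) t → t = t₀) :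
    IsEvoluteCusp γ t₀ := by
  obtain ⟨η, hη, hs⟩ := exists_Icc_subset_of_eventually (hloc.and (isOpen_Ioo.mem_nhds ht₀))
  have hcont : ∀ t ∈ Icc (t₀ - η) (t₀ + η), ContinuousWithinAt (curvature γ)
      (Icc (t₀ - η) (t₀ + η)) t := fun t ht =>
    (hγ.continuousAt_curvature (hs t ht).2).continuousWithinAt
  have hsr : Icc t₀ (t₀ + η) ⊆ Icc (t₀ - η) (t₀ + η) := Icc_subset_Icc (by linarith) le_rfl
  have hsl : Icc (t₀ - η) t₀ ⊆ Icc (t₀ - η) (t₀ + η) := Icc_subset_Icc le_rfl (by linarith)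
  obtain ⟨m, hm, hanti⟩ := exists_strictAntiOn_right (k := curvature γ) (a := t₀) (b := t₀ + η)
    (by linarith) (ContinuousOn.mono hcont hsr)
    (fun x hx y z hz hxy hyz => hγ.curvature_lt_max (hs x (hsr hx)).2.1 (hs z (hsr hz)).2.2 hxy hyz
      fun t ht hl => by
        have := huniq t (hs t (hsr ⟨hx.1.trans ht.1.le, ht.2.le.trans hz.2⟩)).2 hl
        linarith [ht.1, hx.1])
    (fun z hz => (hs z (hsr hz)).1)
  obtain ⟨l, hl, hmono⟩ := exists_strictMonoOn_left (k := curvature γ) (a := t₀ - η) (b := t₀)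
    (by linarith) (ContinuousOn.mono hcont hsl)
    (fun x hx y z hz hxy hyz => hγ.curvature_lt_max (hs x (hsl hx)).2.1 (hs z (hsl hz)).2.2 hxy hyz
      fun t ht hl => by
        have := huniq t (hs t (hsl ⟨hx.1.trans ht.1.le, ht.2.le.trans hz.2⟩)).2 hl
        linarith [ht.2, hz.2])
    (fun z hz => (hs z (hsl hz)).1)
  have hk0 : 0 < curvature γ t₀ := (curvature_nonneg γ m).trans_lt
    (hanti ⟨le_rfl, hm.1.le⟩ ⟨hm.1.le, le_rfl⟩ hm.1)
  have hne := hk0.ne'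
  refine ⟨hne, unitNormal γ t₀, hγ.norm_unitNormal ht₀ hne, ?_⟩
  have hdom : ∀ᶠ s in 𝓝 t₀, s ∈ Ioo (0 : ℝ) 1 ∧ curvature γ s ≠ 0 :=
    (isOpen_Ioo.eventually_mem ht₀).and
      ((hγ.continuousAt_curvature ht₀).eventually_ne hne)
  have hcongr : ∀ᶠ s in 𝓝 t₀, ‖focal γ (unitNormal γ) (curvature γ) s
        - focal γ (unitNormal γ) (curvature γ) t₀‖⁻¹ • (focal γ (unitNormal γ) (curvature γ) s
        - focal γ (unitNormal γ) (curvature γ) t₀)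
      = ‖evolute γ s - evolute γ t₀‖⁻¹ • (evolute γ s - evolute γ t₀) := by
    filter_upwards [hdom] with s hs
    rw [hγ.focal_eq_evolute hs.1 hs.2, hγ.focal_eq_evolute ht₀ hne]
  rw [← Iio_union_Ioi, nhdsWithin_union]
  refine Tendsto.sup ?_ ?_
  -- The curvature may vanish at the far end `l` of the monotone arc; halving the arc makes it
  -- positive throughout.
  · have hl' : (l + t₀) / 2 < t₀ := by linarith [hl.2]
    have hll : l < (l + t₀) / 2 := by linarith [hl.2]
    have hF := hγ.isFramedOn (a := (l + t₀) / 2) (b := t₀) (by linarith [ht₀.1,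
        (hs l (hsl ⟨hl.1, hl.2.le⟩)).2.1]) ht₀.2 fun t ht =>
      ((curvature_nonneg γ l).trans_lt (hmono ⟨le_rfl, hl.2.le⟩ ⟨by linarith [ht.1], ht.2⟩
        (hll.trans_le ht.1))).ne'
    exact (hF.tendsto_direction_left hl' (hmono.mono (Icc_subset_Icc hll.le le_rfl))).congr'
      (nhdsWithin_le_nhds hcongr)
  · have hl' : t₀ < (m + t₀) / 2 := by linarith [hm.1]
    have hll : (m + t₀) / 2 < m := by linarith [hm.1]
    have hF := hγ.isFramedOn (a := t₀) (b := (m + t₀) / 2) ht₀.1 (by linarith [ht₀.2,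
        (hs m (hsr ⟨hm.1.le, hm.2⟩)).2.2]) fun t ht =>
      ((curvature_nonneg γ m).trans_lt (hanti ⟨ht.1, by linarith [ht.2]⟩ ⟨hm.1.le, le_rfl⟩
        (ht.2.trans_lt hll))).ne'
    exact (hF.tendsto_direction_right hl' (hanti.mono (Icc_subset_Icc le_rfl hll.le))).congr'
      (nhdsWithin_le_nhds hcongr)

/-- Where the curvature has no local maximum, the curve enters the osculating disk. -/
theorem IsC2OpenArc.exists_dist_evolute_lt (hγ : IsC2OpenArc γ) {t₀ t : ℝ}
    (huniq : ∀ t ∈ Ioo (0 : ℝ) 1, IsLocalMax (curvature γ) t → t = t₀)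
    (ht : t ∈ Ioo (0 : ℝ) 1) (htt : t ≠ t₀) (hk : curvature γ t ≠ 0) :
    ∃ s ∈ Ioo (0 : ℝ) 1, dist (evolute γ t) (γ s) < dist (evolute γ t) (γ t) := by
  obtain ⟨η, hη, hs⟩ := exists_Icc_subset_of_eventually
    ((isOpen_Ioo.eventually_mem ht).and (eventually_ne_nhds htt))
  have hq : ∀ x ∈ Icc (t - η) (t + η), ∀ y, ∀ z ∈ Icc (t - η) (t + η), x < y → y < z →
      curvature γ y < max (curvature γ x) (curvature γ z) := fun x hx y z hz hxy hyz =>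
    hγ.curvature_lt_max (hs x hx).1.1 (hs z hz).1.2 hxy hyz fun r hr hl => by
      have hr' := hs r ⟨hx.1.trans hr.1.le, hr.2.le.trans hz.2⟩
      exact hr'.2 (huniq r hr'.1 hl)
  -- As `t` is no local maximum, larger values of the curvature accumulate at `t` from at least one
  -- side. By quasiconvexity the curvature then grows strictly away from `t` on that side, and
  -- nesting puts the arc inside the osculating disk.
  have hnot : ∃ᶠ s in 𝓝 t, curvature γ t < curvature γ s := by
    intro h
    exact htt (huniq t ht (h.mono fun s hs => not_lt.1 hs))
  have hnot' : ∃ᶠ s in 𝓝[<] t ⊔ 𝓝[>] t, curvature γ t < curvature γ s := by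
    rw [← nhdsWithin_union, Iio_union_Ioi]
    rw [frequently_nhdsWithin_iff]
    refine hnot.mono fun s hs => ⟨hs, ?_⟩
    rintro rfl
    exact lt_irrefl _ hs
  rw [hγ.dist_evolute ht hk]
  rcases frequently_sup.1 hnot' with hf | hf
  · have hanti := strictAntiOn_of_frequently_gt (show t - η < t by linarith)
      (fun x hx y z hz => hq x ⟨hx.1.le, by linarith [hx.2]⟩ y z ⟨hz.1.le, by linarith [hz.2]⟩) hf
    refine ⟨t - η / 2, (hs _ ⟨by linarith, by linarith⟩).1, ?_⟩
    exact (hγ.dist_evolute_of_strictAntiOn (hs _ ⟨by linarith, by linarith⟩).1.1 (by linarith) ht.2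
      (hanti.mono fun x hx => ⟨by linarith [hx.1], hx.2⟩) hk).2.1
  · have hmono := strictMonoOn_of_frequently_gt (show t < t + η by linarith)
      (fun x hx y z hz => hq x ⟨by linarith [hx.1], hx.2.le⟩ y z ⟨by linarith [hz.1], hz.2.le⟩) hf
    refine ⟨t + η / 2, (hs _ ⟨by linarith, by linarith⟩).1, ?_⟩
    exact (hγ.dist_evolute_of_strictMonoOn ht.1 (by linarith) (hs _ ⟨by linarith, by linarith⟩).1.2
      (hmono.mono fun x hx => ⟨hx.1, by linarith [hx.2]⟩) hk).1

/-- If the curvature did not decrease all the way, it would eventually increase strictly, and by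
nesting the rest of the curve would stay in a single osculating disk. -/
theorem IsC2OpenArc.strictAntiOn_curvature (hγ : IsC2OpenArc γ) {t₀ : ℝ}
    (ht₀ : t₀ ∈ Ioo (0 : ℝ) 1)
    (huniq : ∀ t ∈ Ioo (0 : ℝ) 1, IsLocalMax (curvature γ) t → t = t₀)
    (hunb : ∀ t ∈ Ioo (0 : ℝ) 1, ¬ Bornology.IsBounded (γ '' Ioo t 1)) :
    StrictAntiOn (curvature γ) (Ico t₀ 1) := by
  have hq : ∀ x ∈ Ico t₀ 1, ∀ y, ∀ z ∈ Ico t₀ 1, x < y → y < z →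
      curvature γ y < max (curvature γ x) (curvature γ z) := fun x hx y z hz hxy hyz =>
    hγ.curvature_lt_max (ht₀.1.trans_le hx.1) hz.2 hxy hyz fun r hr hl => by
      have := huniq r ⟨by linarith [ht₀.1, hx.1, hr.1], hr.2.trans hz.2⟩ hl
      linarith [hx.1, hr.1]
  rcases strictAntiOn_or_exists_strictMonoOn hq with h | ⟨z, hz, hmono⟩
  · exact h
  exfalso
  -- The curvature may vanish at `z`; at a later parameter `w` it is positive and the osculating
  -- disk exists.
  obtain ⟨w, hzw, hw⟩ := exists_between hz.2
  have hw0 : 0 < w := by linarith [ht₀.1, hz.1]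
  have hkw : curvature γ w ≠ 0 := ((curvature_nonneg γ z).trans_lt
    (hmono ⟨le_rfl, hz.2⟩ ⟨hzw.le, hw⟩ hzw)).ne'
  refine hunb w ⟨hw0, hw⟩ (Metric.isBounded_closedBall (x := evolute γ w)
    (r := (curvature γ w)⁻¹) |>.subset ?_)
  rintro _ ⟨s, hs, rfl⟩
  rw [Metric.mem_closedBall, dist_comm]
  exact (hγ.dist_evolute_of_strictMonoOn hw0 hs.1 hs.2
    (hmono.mono fun x hx => ⟨hzw.le.trans hx.1, hx.2.trans_lt hs.2⟩) hkw).1.le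

theorem IsC2OpenArc.strictMonoOn_curvature (hγ : IsC2OpenArc γ) {t₀ : ℝ}
    (ht₀ : t₀ ∈ Ioo (0 : ℝ) 1)
    (huniq : ∀ t ∈ Ioo (0 : ℝ) 1, IsLocalMax (curvature γ) t → t = t₀)
    (hunb : ∀ t ∈ Ioo (0 : ℝ) 1, ¬ Bornology.IsBounded (γ '' Ioo 0 t)) :
    StrictMonoOn (curvature γ) (Ioc 0 t₀) := by
  have hq : ∀ x ∈ Ioc 0 t₀, ∀ y, ∀ z ∈ Ioc 0 t₀, x < y → y < z →
      curvature γ y < max (curvature γ x) (curvature γ z) := fun x hx y z hz hxy hyz =>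
    hγ.curvature_lt_max hx.1 (hz.2.trans_lt ht₀.2) hxy hyz fun r hr hl => by
      have := huniq r ⟨hx.1.trans hr.1, by linarith [ht₀.2, hz.2, hr.2]⟩ hl
      linarith [hz.2, hr.2]
  rcases strictMonoOn_or_exists_strictAntiOn hq with h | ⟨z, hz, hanti⟩
  · exact h
  exfalso
  obtain ⟨w, hw, hzw⟩ := exists_between hz.1
  have hw0 : w < 1 := by linarith [ht₀.2, hz.2]
  have hkw : curvature γ w ≠ 0 := ((curvature_nonneg γ z).trans_lt
    (hanti ⟨hw, hzw.le⟩ ⟨hz.1, le_rfl⟩ hzw)).ne'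
  refine hunb w ⟨hw, hw0⟩ (Metric.isBounded_closedBall (x := evolute γ w)
    (r := (curvature γ w)⁻¹) |>.subset ?_)
  rintro _ ⟨s, hs, rfl⟩
  rw [Metric.mem_closedBall, dist_comm]
  exact (hγ.dist_evolute_of_strictAntiOn hs.1 hs.2 hw0
    (hanti.mono fun x hx => ⟨hs.1.trans_le hx.1, hx.2.trans hzw.le⟩) hkw).2.1.le

end Curve

end DividerSet

/-! ### Contact disks, feet and the Divider of an arbitrary set -/

namespace DividerSet

open Metric

section Disks

variable {S : Set Plane}

/-- Of two tangent disks the smaller one lies, apart from the point of contact, in the interior of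
the larger one. -/
theorem norm_sub_lt_of_tangent {p u q : Plane} {d r : ℝ} (hu : ‖u‖ = 1) (hd : 0 < d) (hdr : d < r)
    (hq : ‖q - (p + d • u)‖ ≤ d) (hqp : q ≠ p) : ‖q - (p + r • u)‖ < r := by
  have hw : 0 < ‖q - p‖ := norm_pos_iff.2 (sub_ne_zero.2 hqp)
  have e : ∀ x : ℝ, ‖q - (p + x • u)‖ ^ 2 = ‖q - p‖ ^ 2 - 2 * x * inner ℝ (q - p) u + x ^ 2 := by
    intro x
    rw [← sub_sub, norm_sub_sq_real, inner_smul_right, norm_smul, hu, mul_one, Real.norm_eq_abs,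
      sq_abs]
    ring
  have h1 : ‖q - (p + d • u)‖ ^ 2 ≤ d ^ 2 := by gcongr
  rw [e] at h1
  have hw2 := pow_pos hw 2
  have h2 : 0 < inner ℝ (q - p) u := by
    by_contra! hneg
    nlinarith
  rw [← sq_lt_sq₀ (norm_nonneg _) (hd.trans hdr).le, e]
  nlinarith

theorem mem_contactRadii_of_lt {p u : Plane} {d r : ℝ} (hp : p ∈ S) (hu : ‖u‖ = 1)
    (hr : 0 < r) (hrd : r < d) (hS : ∀ y ∈ S, d ≤ ‖y - (p + d • u)‖) :
    r ∈ contactRadii S p u := by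
  refine ⟨hr, Subset.antisymm ?_ ?_⟩
  · rintro y ⟨hy, hyS⟩
    rw [mem_closedBall, dist_eq_norm] at hy
    by_contra hyp
    exact absurd (norm_sub_lt_of_tangent hu hr hrd hy hyp) (not_lt.2 (hS y hyS))
  · rintro y rfl
    refine ⟨?_, hp⟩
    rw [mem_closedBall, dist_eq_norm, sub_add_cancel_left, norm_neg, norm_smul, hu, mul_one,
      Real.norm_eq_abs, abs_of_pos hr]

theorem isLUB_contactRadii {p u : Plane} {d : ℝ} (hp : p ∈ S) (hu : ‖u‖ = 1)
    (hd : 0 < d) (hS : ∀ y ∈ S, d ≤ ‖y - (p + d • u)‖) (hub : ∀ r ∈ contactRadii S p u, r ≤ d) :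
    IsLUB (contactRadii S p u) d := by
  refine ⟨hub, fun b hb => ?_⟩
  by_contra! hlt
  obtain ⟨r, hr1, hr2⟩ := exists_between (max_lt hlt hd)
  have := hb (mem_contactRadii_of_lt hp hu ((le_max_right _ _).trans_lt hr1) hr2 hS)
  linarith [le_max_left b 0]

theorem exists_unit_of_dist_pos {z p : Plane} (h : 0 < dist z p) :
    ∃ u : Plane, ‖u‖ = 1 ∧ z = p + dist z p • u := by
  refine ⟨(dist z p)⁻¹ • (z - p), ?_, ?_⟩
  · rw [norm_smul, norm_inv, ← dist_eq_norm z p, Real.norm_eq_abs, abs_of_pos h,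
      inv_mul_cancel₀ h.ne']
  · rw [smul_smul, mul_inv_cancel₀ h.ne', one_smul, add_sub_cancel]

theorem infDist_le_norm_sub {z y : Plane} (hy : y ∈ S) : infDist z S ≤ ‖y - z‖ := by
  rw [← dist_eq_norm, dist_comm]; exact infDist_le_dist_of_mem hy

/-- A larger disk tangent at `p` has `q` in its interior and therefore contains points of `S` other
than `p`. It suffices that the second foot lies in the closure, which matters because the ends of
the curve may accumulate at points outside of it. -/
theorem mem_divider_of_two_feet {z p q : Plane} (hp : p ∈ S) (hq : q ∈ closure S) (hpq : q ≠ p)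
    (hz : 0 < infDist z S) (hzp : dist z p = infDist z S) (hzq : dist z q = infDist z S) :
    z ∈ divider S := by
  obtain ⟨u, hu, hzu⟩ := exists_unit_of_dist_pos (hzp ▸ hz : 0 < dist z p)
  rw [hzp] at hzu
  set d := infDist z S with hd
  refine ⟨p, hp, u, hu, d, isLUB_contactRadii hp hu hz (fun y hy => ?_) (fun r hr => ?_), hzu⟩
  · rw [← hzu]; exact infDist_le_norm_sub hy
  · by_contra! hdr
    have h1 : ‖q - (p + r • u)‖ < r := norm_sub_lt_of_tangent hu hz hdr
      (by rw [← hzu, ← dist_eq_norm, dist_comm, hzq]) hpq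
    have hopen : IsOpen (ball (p + r • u) r ∩ {p}ᶜ) := isOpen_ball.inter isOpen_compl_singleton
    obtain ⟨y, ⟨hy1, hy2⟩, hyS⟩ := mem_closure_iff.1 hq _ hopen
      ⟨by rwa [mem_ball, dist_eq_norm], hpq⟩
    have : y ∈ closedBall (p + r • u) r ∩ S := ⟨ball_subset_closedBall hy1, hyS⟩
    rw [hr.2] at this
    exact hy2 this

/-- The supremum radius is the distance of `c` to `S`: a point of `S` strictly inside the limiting
disk would already lie in a slightly smaller contact disk. All later arguments can therefore speak
of feet. -/
theorem exists_contact_of_mem_divider {c : Plane} (hc : c ∈ divider S) :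
    ∃ p ∈ S, ∃ u : Plane, ‖u‖ = 1 ∧ 0 < infDist c S ∧ IsLUB (contactRadii S p u) (infDist c S) ∧
      c = p + infDist c S • u ∧ dist c p = infDist c S := by
  obtain ⟨p, hp, u, hu, R, hR, rfl⟩ := hc
  have hR0 : 0 < R := by
    obtain ⟨r, hr⟩ := hR.nonempty
    exact hr.1.trans_le (hR.1 hr)
  have hdist : dist (p + R • u) p = R := by
    rw [dist_eq_norm, add_sub_cancel_left, norm_smul, hu, mul_one, Real.norm_eq_abs,
      abs_of_pos hR0]
  have hinf : infDist (p + R • u) S = R := by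
    refine le_antisymm ((infDist_le_dist_of_mem hp).trans_eq hdist) ?_
    rw [le_infDist ⟨p, hp⟩]
    intro y hy
    by_contra! hlt
    -- The radius is so close to `R` that the shift `R - r` of the centre plus the distance of `y`
    -- is at most `r`.
    obtain ⟨r, hr, hr1, hr2⟩ := hR.exists_between
      (show R - (R - dist (p + R • u) y) / 2 < R by linarith)
    have : y ∈ closedBall (p + r • u) r ∩ S := by
      refine ⟨?_, hy⟩
      rw [mem_closedBall, dist_comm]
      have h1 : dist (p + r • u) (p + R • u) = R - r := by
        rw [dist_comm, dist_eq_norm, add_sub_add_left_eq_sub, ← sub_smul, norm_smul, hu, mul_one,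
          Real.norm_eq_abs, abs_of_nonneg (by linarith)]
      have := dist_triangle (p + r • u) (p + R • u) y
      linarith
    rw [hr.2] at this
    rw [mem_singleton_iff.1 this, hdist] at hlt
    exact lt_irrefl _ hlt
  rw [hinf]
  exact ⟨p, hp, u, hu, hR0, hR, rfl, hdist⟩

/-- No interior point of a segment from a point to one of its feet lies on the Divider. -/
theorem ray_notMem_divider {c u : Plane} {r : ℝ} (hu : ‖u‖ = 1) (hr : 0 < r)
    (hrR : r < infDist c S) (hq : c + infDist c S • u ∈ closure S) : c + r • u ∉ divider S := by
  intro hz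
  obtain ⟨p, hp, v, hv, hpos, hlub, hzp, hd⟩ := exists_contact_of_mem_divider hz
  set R := infDist c S with hR
  set q := c + R • u with hqdef
  set R' := infDist (c + r • u) S with hR'
  have hzq : c + r • u = q + (R - r) • (-u) := by rw [hqdef, smul_neg, sub_smul]; abel
  have hcq : c = q + R • (-u) := by rw [hqdef, smul_neg]; abel
  have h1 : R' ≤ R - r := by
    rw [hR', ← infDist_closure]
    refine (infDist_le_dist_of_mem hq).trans_eq ?_
    rw [hzq, dist_eq_norm, add_sub_cancel_left, norm_smul, norm_neg, hu, mul_one, Real.norm_eq_abs,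
      abs_of_pos (by linarith)]
  have hu' : ‖-u‖ = 1 := by rw [norm_neg, hu]
  have hpq : p = q := by
    by_contra hne
    have h2 : ‖p - (q + R • (-u))‖ < R :=
      norm_sub_lt_of_tangent hu' (sub_pos.2 hrR) (by linarith)
        (by rw [← hzq, ← dist_eq_norm, dist_comm, hd]; exact h1) hne
    rw [← hcq] at h2
    exact absurd (infDist_le_norm_sub hp) (not_le.2 h2)
  subst hpq
  have hR'eq : R' = R - r := by
    rw [← hd, hzq, dist_eq_norm, add_sub_cancel_left, norm_smul, hu', mul_one, Real.norm_eq_abs,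
      abs_of_pos (by linarith)]
  have hvu : v = -u := by
    rw [hzq, hR'eq] at hzp
    exact (smul_right_injective _ (sub_pos.2 hrR).ne' (add_left_cancel hzp)).symm
  rw [hvu] at hlub
  -- The only foot of the intermediate centre is `q`, and the contact disk there can be enlarged
  -- towards `c` beyond the radius `R - r`; `R - r / 2` is one such radius.
  have := hlub.1 (mem_contactRadii_of_lt (r := R - r / 2) (d := R) hp hu' (by linarith)
    (by linarith) fun y hy => by rw [← hcq]; exact infDist_le_norm_sub hy)
  linarith

theorem isClosed_infDist_le (F : Set Plane) : IsClosed {z | infDist z F ≤ infDist z S} :=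
  isClosed_le (continuous_infDist_pt F) (continuous_infDist_pt S)

end Disks

/-! ### The two sectors cut out by a pair of rays -/

section Sectors

theorem rot_rot (v : Plane) : rot (rot v) = -v := by
  apply plane_ext <;> simp

theorem cross_add_right (d v w : Plane) : cross d (v + w) = cross d v + cross d w := by
  simp [cross]; ring

theorem cross_sub_right (d v w : Plane) : cross d (v - w) = cross d v - cross d w := by
  simp [cross]; ring

theorem cross_smul_right (d : Plane) (a : ℝ) (v : Plane) : cross d (a • v) = a * cross d v := by
  simp [cross]; ring

theorem cross_sub_left_swap (u v w : Plane) : cross (u - v) w = -cross (v - u) w := by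
  simp [cross]; ring

theorem cross_sub_self (u v : Plane) : cross (v - u) v = cross (v - u) u := by
  simp [cross]; ring

theorem two_inner_sub_of_norm_eq_one {u v : Plane} (hu : ‖u‖ = 1) (hv : ‖v‖ = 1) :
    2 * inner ℝ (v - u) u = -‖v - u‖ ^ 2 := by
  have h := norm_add_sq_real (v - u) u
  rw [sub_add_cancel, hu, hv] at h
  linarith

/-- The function that is affine on the unit circle and vanishes there at `u` and `v`, extended
homogeneously. Its sign separates the two sectors bounded by the rays through `u` and `v`. -/
noncomputable def sectorSide (u v w : Plane) : ℝ := cross (v - u) w - ‖w‖ * cross (v - u) u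

theorem continuous_sectorSide (u v : Plane) : Continuous (sectorSide u v) := by
  unfold sectorSide cross; fun_prop

theorem sectorSide_swap (u v w : Plane) : sectorSide v u w = -sectorSide u v w := by
  rw [sectorSide, sectorSide, cross_sub_left_swap v u, cross_sub_left_swap v u, cross_sub_self]
  ring

theorem sectorSide_smul (u v : Plane) {a : ℝ} (ha : 0 ≤ a) (w : Plane) :
    sectorSide u v (a • w) = a * sectorSide u v w := by
  rw [sectorSide, sectorSide, cross_smul_right, norm_smul, Real.norm_eq_abs, abs_of_nonneg ha]
  ring

/-- The equation places `w` on the line through `‖w‖ • u` and `‖w‖ • v`, which meets the circle of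
radius `‖w‖` only in these two points. -/
theorem mem_rays_of_sectorSide_eq_zero {u v w : Plane} (hu : ‖u‖ = 1) (hv : ‖v‖ = 1) (huv : u ≠ v)
    (h : sectorSide u v w = 0) : w = ‖w‖ • u ∨ w = ‖w‖ • v := by
  set d := v - u with hd
  have hd0 : 0 < ‖d‖ ^ 2 := pow_pos (norm_pos_iff.2 (sub_ne_zero.2 huv.symm)) 2
  have h1 : inner ℝ (rot d) (w - ‖w‖ • u) = 0 := by
    rw [inner_rot_left, cross_sub_right, cross_smul_right]; exact h
  have h2 := smul_rot_of_inner_eq_zero h1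
  rw [norm_rot, rot_rot] at h2
  set s : ℝ := -(cross (rot d) (w - ‖w‖ • u)) / ‖d‖ ^ 2 with hs
  have h3 : w = ‖w‖ • u + s • d := by
    have : w - ‖w‖ • u = s • d := by
      rw [← one_smul ℝ (w - ‖w‖ • u), ← inv_mul_cancel₀ hd0.ne', mul_smul, h2, smul_smul, hs,
        smul_neg, ← neg_smul]
      congr 1; ring
    rw [← this, add_sub_cancel]
  have h4 := norm_add_sq_real (‖w‖ • u) (s • d)
  rw [← h3, norm_smul, norm_norm, hu, mul_one, norm_smul, Real.norm_eq_abs, mul_pow, sq_abs,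
    real_inner_smul_left, inner_smul_right, real_inner_comm] at h4
  have h5 := two_inner_sub_of_norm_eq_one hu hv
  rw [← hd] at h5
  have h6 : ‖d‖ ^ 2 * (s * (s - ‖w‖)) = 0 := by
    linear_combination (-1 : ℝ) * h4 - ‖w‖ * s * h5
  rcases mul_eq_zero.1 ((mul_eq_zero.1 h6).resolve_left hd0.ne') with h7 | h7
  · left; rw [h7, zero_smul, add_zero] at h3; exact h3
  · right
    have h8 : s = ‖w‖ := by linarith
    rw [h8, hd, ← smul_add, add_sub_cancel] at h3
    exact h3

/-- Here `m` is the unit vector at which `cross d` is largest. Going through `m` keeps the path in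
one sector and away from the origin even if `u` and `v` are opposite. The sign of `μ` decides which
bound on the norm is needed, `‖w‖ ≤ 1` or `‖w‖ ≥ α - β`. -/
theorem segment_sectorSide {d m x : Plane} {μ : ℝ} (hx : ‖x‖ = 1) (hm : ‖m‖ = 1)
    (hxμ : cross d x = μ) (hmd : cross d m = ‖d‖) (hμ : |μ| ≤ ‖d‖) (hdx : inner ℝ d x ≠ 0)
    (hdm : inner ℝ d m = 0) :
    ∀ w ∈ segment ℝ x m, w ≠ 0 ∧ ‖w‖ ≤ 1 ∧ 0 ≤ cross d w - ‖w‖ * μ := by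
  rintro w ⟨α, β, hα, hβ, hαβ, rfl⟩
  have nα : ‖α • x‖ = α := by rw [norm_smul, hx, mul_one, Real.norm_eq_abs, abs_of_nonneg hα]
  have nβ : ‖β • m‖ = β := by rw [norm_smul, hm, mul_one, Real.norm_eq_abs, abs_of_nonneg hβ]
  have hle : ‖α • x + β • m‖ ≤ 1 := (norm_add_le _ _).trans (by rw [nα, nβ, hαβ])
  have hge : α - β ≤ ‖α • x + β • m‖ := by
    have := norm_sub_norm_le (α • x) (-(β • m))
    rw [norm_neg, nα, nβ, sub_neg_eq_add] at this
    exact this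
  refine ⟨fun h0 => ?_, hle, ?_⟩
  · have h1 := congrArg (inner ℝ d) h0
    rw [inner_add_right, inner_smul_right, inner_smul_right, hdm, inner_zero_right, mul_zero,
      add_zero] at h1
    have hα0 := (mul_eq_zero.1 h1).resolve_right hdx
    have hβ1 : β = 1 := by linarith
    rw [hα0, hβ1, zero_smul, zero_add, one_smul] at h0
    rw [h0, norm_zero] at hm
    norm_num at hm
  · rw [cross_add_right, cross_smul_right, cross_smul_right, hxμ, hmd]
    obtain ⟨h1, h2⟩ := abs_le.1 hμ
    rcases le_total 0 μ with h | h
    · nlinarith [mul_nonneg hβ (sub_nonneg.2 h2), mul_nonneg h (sub_nonneg.2 hle)]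
    · nlinarith [mul_nonneg hβ (show 0 ≤ ‖d‖ + μ by linarith),
        mul_nonneg (neg_nonneg.2 h) (sub_nonneg.2 hge)]

theorem exists_path_sectorSide {u v : Plane} (hu : ‖u‖ = 1) (hv : ‖v‖ = 1) (huv : u ≠ v) :
    ∃ A : Set Plane, IsPreconnected A ∧ u ∈ A ∧ v ∈ A ∧
      ∀ w ∈ A, w ≠ 0 ∧ ‖w‖ ≤ 1 ∧ 0 ≤ sectorSide u v w := by
  set d := v - u with hd
  have hd0 : 0 < ‖d‖ := norm_pos_iff.2 (sub_ne_zero.2 huv.symm)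
  set m := ‖d‖⁻¹ • rot d with hm
  have hm1 : ‖m‖ = 1 := by
    rw [hm, norm_smul, norm_rot, norm_inv, norm_norm, inv_mul_cancel₀ hd0.ne']
  have hdm : inner ℝ d m = 0 := by rw [hm, inner_smul_right, inner_self_rot, mul_zero]
  have hmd : cross d m = ‖d‖ := by
    rw [hm, cross_smul_right, ← inner_rot_left, real_inner_self_eq_norm_sq, norm_rot]
    field_simp
  have hμ : |cross d u| ≤ ‖d‖ := by
    rw [← inner_rot_left]
    have := abs_real_inner_le_norm (rot d) u
    rwa [norm_rot, hu, mul_one] at this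
  have h1 := two_inner_sub_of_norm_eq_one hu hv
  have hdu : inner ℝ d u ≠ 0 := by
    intro h; rw [← hd, h] at h1; nlinarith
  have hdv : inner ℝ d v ≠ 0 := by
    intro h
    have h2 : inner ℝ d v = inner ℝ d u + ‖d‖ ^ 2 := by
      rw [← real_inner_self_eq_norm_sq, ← inner_add_right, hd, add_sub_cancel]
    rw [← hd] at h1; nlinarith
  refine ⟨segment ℝ u m ∪ segment ℝ v m, ?_, Or.inl (left_mem_segment _ _ _),
    Or.inr (left_mem_segment _ _ _), ?_⟩
  · exact (convex_segment u m).isPreconnected.union m (right_mem_segment _ _ _)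
      (right_mem_segment _ _ _) (convex_segment v m).isPreconnected
  · rintro w (hw | hw)
    · exact segment_sectorSide hu hm1 rfl hmd hμ hdu hdm w hw
    · exact segment_sectorSide hv hm1 (cross_sub_self u v) hmd hμ hdv hdm w hw

end Sectors

end DividerSet

/-! ### Π(S), the convex side, and centres with two feet -/

namespace DividerSet

open Metric

theorem mem_piSet_iff_exists {S : Set Plane} {p : Plane} :
    p ∈ piSet S ↔ ∃ r : ℝ, 0 < r ∧ ¬ IsPreconnected (closedBall p r ∩ S) := by
  rw [piSet, mem_ofPred_eq, lctCurvature, ENNReal.inv_pos, lctRadius, Ne, sInf_eq_top]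
  push Not
  constructor
  · rintro ⟨_, ⟨r, hr, h, rfl⟩, -⟩
    exact ⟨r, hr, h⟩
  · rintro ⟨r, hr, h⟩
    exact ⟨_, ⟨r, hr, h, rfl⟩, ENNReal.ofReal_ne_top⟩

theorem infDist_le_dist_of_mem_closure {S : Set Plane} {z y : Plane} (hy : y ∈ closure S) :
    infDist z S ≤ dist z y := by
  rw [← infDist_closure]; exact infDist_le_dist_of_mem hy

variable {γ : ℝ → Plane}

theorem IsC2OpenArc.continuousOn (hγ : IsC2OpenArc γ) : ContinuousOn γ (Ioo 0 1) :=
  hγ.contDiffOn.continuousOn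

theorem IsC2OpenArc.eq_of_apply_eq (hγ : IsC2OpenArc γ) {s t : ℝ} (hs : s ∈ Ioo (0 : ℝ) 1)
    (ht : t ∈ Ioo (0 : ℝ) 1) (h : γ s = γ t) : s = t :=
  congrArg Subtype.val (hγ.isEmbedding.injective (a₁ := ⟨s, hs⟩) (a₂ := ⟨t, ht⟩) h)

theorem domRestrict_image_preimage {A : Set ℝ} (hA : A ⊆ Ioo 0 1) :
    (Ioo (0 : ℝ) 1).domRestrict γ '' (Subtype.val ⁻¹' A) = γ '' A := by
  ext x
  constructor
  · rintro ⟨t, ht, rfl⟩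
    exact ⟨t, ht, rfl⟩
  · rintro ⟨t, ht, rfl⟩
    exact ⟨⟨t, hA ht⟩, ht, rfl⟩

/-- The place where the embedding hypothesis excludes that an end of the curve returns to one of its
points. -/
theorem IsC2OpenArc.mem_closure_of_apply_mem_closure (hγ : IsC2OpenArc γ) {A : Set ℝ}
    (hA : A ⊆ Ioo 0 1) {t : ℝ} (ht : t ∈ Ioo (0 : ℝ) 1) (h : γ t ∈ closure (γ '' A)) :
    t ∈ closure A := by
  have h1 : (⟨t, ht⟩ : Ioo (0 : ℝ) 1) ∈ closure (Subtype.val ⁻¹' A) := by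
    rw [hγ.isEmbedding.isInducing.closure_eq_preimage_closure_image, mem_preimage,
      domRestrict_image_preimage hA]
    exact h
  rw [closure_subtype] at h1
  exact closure_mono (image_preimage_subset _ _) h1

theorem mem_trace {t : ℝ} (ht : t ∈ Ioo (0 : ℝ) 1) : γ t ∈ trace γ := ⟨t, ht, rfl⟩

/-- Since the curve is embedded, connectedness of its part in a disk is order-connectedness of the
parameter set. The separating disk has the larger of the two end distances as radius, positive
because `γ` is injective. -/
theorem IsC2OpenArc.mem_piSet_iff (hγ : IsC2OpenArc γ) {p : Plane} :
    p ∈ piSet (trace γ) ↔ ∃ s ∈ Ioo (0 : ℝ) 1, ∃ t, ∃ u ∈ Ioo (0 : ℝ) 1, s < t ∧ t < u ∧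
      dist p (γ s) < dist p (γ t) ∧ dist p (γ u) < dist p (γ t) := by
  have hset : ∀ r : ℝ, closedBall p r ∩ trace γ
      = γ '' {t | t ∈ Ioo (0 : ℝ) 1 ∧ dist p (γ t) ≤ r} := by
    intro r
    ext x
    constructor
    · rintro ⟨h, t, ht, rfl⟩
      exact ⟨t, ⟨ht, by rwa [mem_closedBall, dist_comm] at h⟩, rfl⟩
    · rintro ⟨t, ⟨ht, h⟩, rfl⟩
      exact ⟨by rwa [mem_closedBall, dist_comm], t, ht, rfl⟩
  rw [mem_piSet_iff_exists]
  constructor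
  · rintro ⟨r, -, hr⟩
    rw [hset] at hr
    have hno : ¬ OrdConnected {t | t ∈ Ioo (0 : ℝ) 1 ∧ dist p (γ t) ≤ r} := fun h =>
      hr (h.isPreconnected.image γ (hγ.continuousOn.mono fun t ht => ht.1))
    rw [ordConnected_def] at hno
    push Not at hno
    obtain ⟨s, hs, u, hu, hnot⟩ := hno
    obtain ⟨t, ht, htB⟩ := not_subset.1 hnot
    have ht' : t ∈ Ioo (0 : ℝ) 1 := ⟨hs.1.1.trans_le ht.1, ht.2.trans_lt hu.1.2⟩
    have hrt : r < dist p (γ t) := by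
      by_contra! h
      exact htB ⟨ht', h⟩
    refine ⟨s, hs.1, t, u, hu.1, lt_of_le_of_ne ht.1 ?_, lt_of_le_of_ne ht.2 ?_,
      hs.2.trans_lt hrt, hu.2.trans_lt hrt⟩
    · rintro rfl; exact htB hs
    · rintro rfl; exact htB hu
  · rintro ⟨s, hs, t, u, hu, hst, htu, h1, h2⟩
    have hr : 0 < max (dist p (γ s)) (dist p (γ u)) := by
      by_contra! h
      have hs0 : dist p (γ s) = 0 := le_antisymm ((le_max_left _ _).trans h) dist_nonneg
      have hu0 : dist p (γ u) = 0 := le_antisymm ((le_max_right _ _).trans h) dist_nonneg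
      have := hγ.eq_of_apply_eq hs hu ((dist_eq_zero.1 hs0).symm.trans (dist_eq_zero.1 hu0))
      linarith
    refine ⟨_, hr, fun hpre => ?_⟩
    rw [hset, ← domRestrict_image_preimage (fun t ht => ht.1),
      hγ.isEmbedding.isInducing.isPreconnected_image] at hpre
    have hord := (hpre.image Subtype.val continuous_subtype_val.continuousOn).ordConnected
    have hmem : ∀ x ∈ Ioo (0 : ℝ) 1, dist p (γ x) ≤ max (dist p (γ s)) (dist p (γ u)) →
        x ∈ (Subtype.val '' ((Subtype.val : Ioo (0 : ℝ) 1 → ℝ) ⁻¹'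
          {t | t ∈ Ioo (0 : ℝ) 1 ∧ dist p (γ t) ≤ max (dist p (γ s)) (dist p (γ u))})) :=
      fun x hx h => ⟨⟨x, hx⟩, ⟨hx, h⟩, rfl⟩
    obtain ⟨x, hx, rfl⟩ := hord.out (hmem s hs (le_max_left _ _)) (hmem u hu (le_max_right _ _))
      ⟨hst.le, htu.le⟩
    rcases le_max_iff.1 hx.2 with h | h
    · linarith
    · linarith

theorem IsC2OpenArc.normal_mem_convexSide (hγ : IsC2OpenArc γ) {t d : ℝ} (ht : t ∈ Ioo (0 : ℝ) 1)
    (hk : curvature γ t ≠ 0) (hd : (curvature γ t)⁻¹ < d) :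
    γ t + d • unitNormal γ t ∈ convexSide γ :=
  ⟨t, ht, hk, (hγ.sbtw_iff ht hk).2 ⟨d, hd, rfl⟩⟩

theorem IsC2OpenArc.normal_mem_closure_convexSide (hγ : IsC2OpenArc γ) {t d : ℝ}
    (ht : t ∈ Ioo (0 : ℝ) 1) (hk : curvature γ t ≠ 0) (hd : (curvature γ t)⁻¹ ≤ d) :
    γ t + d • unitNormal γ t ∈ closure (convexSide γ) := by
  have lim : Tendsto (fun x : ℝ => γ t + x • unitNormal γ t) (𝓝[>] d)
      (𝓝 (γ t + d • unitNormal γ t)) :=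
    (Continuous.tendsto (by fun_prop) d).mono_left nhdsWithin_le_nhds
  refine mem_closure_of_tendsto lim ?_
  filter_upwards [self_mem_nhdsWithin] with x hx
  exact hγ.normal_mem_convexSide ht hk (hd.trans_lt hx)

theorem IsC2OpenArc.eventually_dist_lt_of_inv_lt (hγ : IsC2OpenArc γ) {t d : ℝ}
    (ht : t ∈ Ioo (0 : ℝ) 1) (hk : curvature γ t ≠ 0) (hd : (curvature γ t)⁻¹ < d) :
    ∀ᶠ s in 𝓝 t, s ≠ t →
      dist (γ t + d • unitNormal γ t) (γ s) < dist (γ t + d • unitNormal γ t) (γ t) := by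
  refine hγ.eventually_dist_lt ht ?_ (inner_normal_sub_deriv γ t d)
  rw [hγ.secondForm_normal ht]
  have hk' := lt_of_le_of_ne (curvature_nonneg γ t) hk.symm
  refine mul_neg_of_pos_of_neg (pow_pos (hγ.norm_deriv_pos ht) 2) ?_
  rw [inv_lt_iff_one_lt_mul₀ hk'] at hd
  linarith

theorem IsC2OpenArc.convexSide_subset_piSet (hγ : IsC2OpenArc γ) :
    convexSide γ ⊆ piSet (trace γ) := by
  rintro z ⟨t, ht, hk, hb⟩
  obtain ⟨d, hd, rfl⟩ := (hγ.sbtw_iff ht hk).1 hb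
  obtain ⟨η, hη, hs⟩ := exists_Icc_subset_of_eventually
    ((hγ.eventually_dist_lt_of_inv_lt ht hk hd).and (isOpen_Ioo.eventually_mem ht))
  have hl := hs (t - η) ⟨le_rfl, by linarith⟩
  have hr := hs (t + η) ⟨by linarith, le_rfl⟩
  exact hγ.mem_piSet_iff.2 ⟨t - η, hl.2, t, t + η, hr.2, by linarith, by linarith,
    hl.1 (by linarith), hr.1 (by linarith)⟩

theorem IsC2OpenArc.exists_isLocalMax_of_mem_piSet (hγ : IsC2OpenArc γ) {p : Plane}
    (hp : p ∈ piSet (trace γ)) :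
    ∃ m ∈ Ioo (0 : ℝ) 1, IsLocalMax (fun t => dist p (γ t)) m := by
  obtain ⟨s, hs, t, u, hu, hst, htu, h1, h2⟩ := hγ.mem_piSet_iff.1 hp
  have hsub : Icc s u ⊆ Ioo 0 1 := fun x hx => ⟨hs.1.trans_le hx.1, hx.2.trans_lt hu.2⟩
  obtain ⟨m, hm, hmax⟩ := isCompact_Icc.exists_isMaxOn ⟨t, hst.le, htu.le⟩
    ((continuous_const.dist continuous_id).comp_continuousOn (g := fun x => dist p x)
      (hγ.continuousOn.mono hsub))
  have htm : dist p (γ t) ≤ dist p (γ m) := hmax ⟨hst.le, htu.le⟩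
  have hsm : s < m := lt_of_le_of_ne hm.1 (by rintro rfl; linarith)
  have hmu : m < u := lt_of_le_of_ne hm.2 (by rintro rfl; linarith)
  refine ⟨m, hsub hm, ?_⟩
  filter_upwards [Icc_mem_nhds hsm hmu] with x hx using hmax hx

/-- Only the closure is reached: at a degenerate local maximum of the distance the point is the
centre of curvature itself. -/
theorem IsC2OpenArc.piSet_subset_closure_convexSide (hγ : IsC2OpenArc γ) :
    piSet (trace γ) ⊆ closure (convexSide γ) := by
  intro p hp
  obtain ⟨m, hm, hmax⟩ := hγ.exists_isLocalMax_of_mem_piSet hp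
  obtain ⟨hk, d, hd, rfl⟩ := hγ.exists_normal_of_isLocalMax hm hmax
  exact hγ.normal_mem_closure_convexSide hm hk hd

/-- Near the parameter of one foot there are parameters on both sides of it that are farther from
the centre and that separate it from a given other foot. -/
theorem IsC2OpenArc.exists_far_parameters (hγ : IsC2OpenArc γ) (hconst : NoConstantCurvatureArc γ)
    {c q : Plane} {t : ℝ} (ht : t ∈ Ioo (0 : ℝ) 1) (hqt : q ≠ γ t) (hq : q ∈ closure (trace γ)) :
    ∃ a b, 0 < a ∧ a < t ∧ t < b ∧ b < 1 ∧ infDist c (trace γ) < dist c (γ a) ∧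
      infDist c (trace γ) < dist c (γ b) ∧ q ∈ closure (γ '' (Ioc 0 a ∪ Ico b 1)) := by
  have hne : ∀ᶠ s in 𝓝 t, γ s ≠ q := (hγ.hasDerivAt ht).continuousAt.eventually_ne hqt.symm
  obtain ⟨η, hη, hs⟩ := exists_Icc_subset_of_eventually (hne.and (isOpen_Ioo.eventually_mem ht))
  have hl := (hs (t - η) ⟨le_rfl, by linarith⟩).2
  have hr := (hs (t + η) ⟨by linarith, le_rfl⟩).2
  obtain ⟨a, ha, ha'⟩ := hγ.exists_dist_ne hconst hl.1.le (show t - η < t by linarith) ht.2.le c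
    (infDist c (trace γ))
  obtain ⟨b, hb, hb'⟩ := hγ.exists_dist_ne hconst ht.1.le (show t < t + η by linarith) hr.2.le c
    (infDist c (trace γ))
  have ha1 := (hs a ⟨ha.1.le, by linarith [ha.2]⟩).2
  have hb1 := (hs b ⟨by linarith [hb.1], hb.2.le⟩).2
  refine ⟨a, b, ha1.1, ha.2, hb.1, hb1.2,
    lt_of_le_of_ne (infDist_le_dist_of_mem (mem_trace ha1)) ha'.symm,
    lt_of_le_of_ne (infDist_le_dist_of_mem (mem_trace hb1)) hb'.symm, ?_⟩
  have hsub : Icc a b ⊆ Ioo 0 1 := fun x hx => ⟨ha1.1.trans_le hx.1, hx.2.trans_lt hb1.2⟩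
  have hK : IsCompact (γ '' Icc a b) := isCompact_Icc.image_of_continuousOn
    (hγ.continuousOn.mono hsub)
  have hcov : trace γ ⊆ γ '' Icc a b ∪ γ '' (Ioc 0 a ∪ Ico b 1) := by
    rintro _ ⟨s, hs, rfl⟩
    rcases le_total s a with h | h
    · exact Or.inr ⟨s, Or.inl ⟨hs.1, h⟩, rfl⟩
    · rcases le_total b s with h' | h'
      · exact Or.inr ⟨s, Or.inr ⟨h', hs.2⟩, rfl⟩
      · exact Or.inl ⟨s, ⟨h, h'⟩, rfl⟩
  have := closure_mono hcov hq
  rw [closure_union, hK.isClosed.closure_eq] at this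
  refine this.resolve_left ?_
  rintro ⟨s, hs', rfl⟩
  exact (hs s ⟨ha.1.le.trans hs'.1, hs'.2.trans hb.2.le⟩).1 rfl

/-- The second foot `q` need not lie on the curve; it is replaced by a curve point that is still
nearer than the separating points `γ a` and `γ b`. -/
theorem IsC2OpenArc.mem_piSet_of_two_feet (hγ : IsC2OpenArc γ) (hconst : NoConstantCurvatureArc γ)
    {c q : Plane} {t : ℝ} (ht : t ∈ Ioo (0 : ℝ) 1) (hqt : q ≠ γ t) (hq : q ∈ closure (trace γ))
    (hct : dist c (γ t) = infDist c (trace γ)) (hcq : dist c q = infDist c (trace γ)) :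
    c ∈ piSet (trace γ) := by
  obtain ⟨a, b, ha, hat, htb, hb, hfa, hfb, hcl⟩ := hγ.exists_far_parameters hconst ht hqt hq
    (c := c)
  have hopen : IsOpen {x | dist c x < min (dist c (γ a)) (dist c (γ b))} :=
    isOpen_lt (by fun_prop) continuous_const
  obtain ⟨_, hlt, s, hs, rfl⟩ := mem_closure_iff.1 hcl _ hopen
    (show dist c q < _ from hcq ▸ lt_min hfa hfb)
  rw [mem_ofPred_eq, lt_min_iff] at hlt
  rw [hγ.mem_piSet_iff]
  rcases hs with hs | hs
  · have hsa : s < a := lt_of_le_of_ne hs.2 (by rintro rfl; exact lt_irrefl _ hlt.1)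
    exact ⟨s, ⟨hs.1, by linarith [ht.2]⟩, a, t, ht, hsa, hat, hlt.1, hct.trans_lt hfa⟩
  · have hbs : b < s := lt_of_le_of_ne hs.1 (by rintro rfl; exact lt_irrefl _ hlt.2)
    exact ⟨t, ht, b, s, ⟨by linarith [ht.1], hs.2⟩, htb, hbs, hct.trans_lt hfb, hlt.2⟩

/-- A centre on the Divider has two feet in the closure of the curve, or else it is the centre of
the osculating circle at its only foot. -/
theorem IsC2OpenArc.two_feet_or_eq_evolute (hγ : IsC2OpenArc γ) {c : Plane}
    (hc : c ∈ divider (trace γ)) :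
    0 < infDist c (trace γ) ∧ ∃ t ∈ Ioo (0 : ℝ) 1, dist c (γ t) = infDist c (trace γ) ∧
      ((∃ q ∈ closure (trace γ), q ≠ γ t ∧ dist c q = infDist c (trace γ)) ∨
        (curvature γ t ≠ 0 ∧ c = evolute γ t)) := by
  obtain ⟨_, ⟨t, ht, rfl⟩, u, hu, hpos, hlub, hcu, hd⟩ := exists_contact_of_mem_divider hc
  refine ⟨hpos, t, ht, hd, ?_⟩
  by_contra! hcon
  obtain ⟨hone, hev⟩ := hcon
  have hmin : IsLocalMin (fun s => dist c (γ s)) t := by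
    filter_upwards [isOpen_Ioo.mem_nhds ht] with s hs
    rw [hd]; exact infDist_le_dist_of_mem (mem_trace hs)
  have hcrit := hγ.inner_eq_zero_of_isLocalExtr ht (Or.inl hmin)
  rcases eq_or_lt_of_le (hγ.secondForm_nonneg_of_isLocalMin ht hmin) with h0 | h0
  · obtain ⟨hk, he⟩ := hγ.eq_evolute_of_secondForm_eq_zero ht hcrit h0.symm
    exact hev hk he
  set R := infDist c (trace γ)
  obtain ⟨η, hη, hsub, hstr⟩ := hγ.exists_strict_min ht h0
  have huγ : inner ℝ u (deriv γ t) = 0 := by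
    rw [hcu, sub_add_cancel_left, inner_neg_left, real_inner_smul_left, neg_eq_zero] at hcrit
    exact (mul_eq_zero.1 hcrit).resolve_left hpos.ne'
  -- On the small arc about `t` the distance has a strict minimum at `t` for all nearby centres on
  -- the normal; the closure of the rest of the curve has a distance larger than `R`. So some radius
  -- above `R` still gives a contact disk.
  set O : Set ℝ := Ioo 0 1 \ Ioo (t - η) (t + η)
  have hO : O ⊆ Ioo 0 1 := sdiff_subset
  have htO : t ∉ closure O := by
    intro h
    obtain ⟨s, hs, hs'⟩ := mem_closure_iff.1 h _ isOpen_Ioo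
      (show t ∈ Ioo (t - η) (t + η) from ⟨by linarith, by linarith⟩)
    exact hs'.2 hs
  have hline : Tendsto (fun r : ℝ => γ t + r • u) (𝓝 R) (𝓝 c) := by
    have : Tendsto (fun r : ℝ => γ t + r • u) (𝓝 R) (𝓝 (γ t + R • u)) :=
      Continuous.tendsto (by fun_prop) R
    rwa [← hcu] at this
  have hfar : ∀ᶠ r in 𝓝 R, ∀ y ∈ closure (γ '' O), r < dist (γ t + r • u) y := by
    rcases (closure (γ '' O)).eq_empty_or_nonempty with he | hne
    · rw [he]; exact Eventually.of_forall fun _ y hy => absurd hy (notMem_empty y)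
    · obtain ⟨y, hy, hy'⟩ := isClosed_closure.exists_infDist_eq_dist hne c
      have hyS : y ∈ closure (trace γ) := closure_mono (image_mono hO) hy
      have hyt : y ≠ γ t := by
        rintro rfl
        exact htO (hγ.mem_closure_of_apply_mem_closure hO ht hy)
      have hRy : R < infDist c (closure (γ '' O)) := by
        rw [hy']
        refine lt_of_le_of_ne ?_ (hone y hyS hyt).symm
        exact infDist_le_dist_of_mem_closure hyS
      have h1 : Tendsto (fun r : ℝ => infDist (γ t + r • u) (closure (γ '' O))) (𝓝 R)
          (𝓝 (infDist c (closure (γ '' O)))) :=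
        ((continuous_infDist_pt _).tendsto c).comp hline
      filter_upwards [tendsto_id.eventually_lt h1 hRy] with r hr x hx
      exact hr.trans_le (infDist_le_dist_of_mem hx)
  obtain ⟨r, ⟨h1, h2⟩, hr⟩ := (((hfar.and (hline.eventually hstr)).filter_mono
    (nhdsWithin_le_nhds (s := Ioi R))).and self_mem_nhdsWithin).exists
  have hr : R < r := hr
  have hr0 : 0 < r := hpos.trans hr
  have hdr : dist (γ t + r • u) (γ t) = r := by
    rw [dist_eq_norm, add_sub_cancel_left, norm_smul, hu, mul_one, Real.norm_eq_abs, abs_of_pos hr0]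
  have hcontact : r ∈ contactRadii (trace γ) (γ t) u := by
    refine ⟨hr0, Subset.antisymm ?_ ?_⟩
    · rintro _ ⟨hy, s, hs, rfl⟩
      rw [mem_closedBall, dist_comm] at hy
      by_cases hsO : s ∈ O
      · exact absurd (h1 _ (subset_closure ⟨s, hsO, rfl⟩)) (not_lt.2 hy)
      · have hs' : s ∈ Ioo (t - η) (t + η) := by
          by_contra h; exact hsO ⟨hs, h⟩
        by_contra hst
        have hst' : s ≠ t := by rintro rfl; exact hst rfl
        have := h2 (by rw [sub_add_cancel_left, inner_neg_left, real_inner_smul_left, huγ]; simp)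
          s (Ioo_subset_Icc_self hs') hst'
        rw [hdr] at this
        exact absurd this (not_lt.2 hy)
    · rintro _ rfl
      exact ⟨by rw [mem_closedBall, dist_comm, hdr], mem_trace ht⟩
  exact absurd (hlub.1 hcontact) (not_le.2 hr)

theorem IsC2OpenArc.divider_subset_closure_piSet (hγ : IsC2OpenArc γ)
    (hconst : NoConstantCurvatureArc γ) : divider (trace γ) ⊆ closure (piSet (trace γ)) := by
  intro c hc
  obtain ⟨-, t, ht, hct, ⟨q, hq, hqt, hcq⟩ | ⟨hk, he⟩⟩ := hγ.two_feet_or_eq_evolute hc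
  · exact subset_closure (hγ.mem_piSet_of_two_feet hconst ht hqt hq hct hcq)
  · refine closure_mono hγ.convexSide_subset_piSet ?_
    rw [he, hγ.evolute_eq ht hk]
    exact hγ.normal_mem_closure_convexSide ht hk le_rfl

/-- A connected set of centres near `c` that joins a centre with a foot on the inner arc to a
centre with a foot in the closure of the remaining arcs meets the Divider. -/
theorem IsC2OpenArc.inter_divider_nonempty (hγ : IsC2OpenArc γ) {A : Set Plane}
    (hA : IsPreconnected A) {a b : ℝ} (ha : 0 < a) (hab : a < b) (hb : b < 1)
    (hfa : ∀ z ∈ A, infDist z (trace γ) < dist z (γ a))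
    (hfb : ∀ z ∈ A, infDist z (trace γ) < dist z (γ b))
    (hpos : ∀ z ∈ A, 0 < infDist z (trace γ)) {z₁ z₂ p q : Plane} (hz₁ : z₁ ∈ A) (hz₂ : z₂ ∈ A)
    (hp : p ∈ γ '' Icc a b) (hp' : dist z₁ p = infDist z₁ (trace γ))
    (hq : q ∈ closure (γ '' (Ioc 0 a ∪ Ico b 1))) (hq' : dist z₂ q = infDist z₂ (trace γ)) :
    (A ∩ divider (trace γ)).Nonempty := by
  have hsub : Icc a b ⊆ Ioo 0 1 := fun x hx => ⟨ha.trans_le hx.1, hx.2.trans_lt hb⟩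
  have hsub' : Ioc 0 a ∪ Ico b 1 ⊆ Ioo 0 1 := by
    rintro x (hx | hx)
    · exact ⟨hx.1, by linarith [hx.2]⟩
    · exact ⟨by linarith [hx.1], hx.2⟩
  set K := γ '' Icc a b
  set F := closure (γ '' (Ioc 0 a ∪ Ico b 1))
  have hK : IsCompact K := isCompact_Icc.image_of_continuousOn (hγ.continuousOn.mono hsub)
  have hFS : F ⊆ closure (trace γ) := closure_mono (image_mono hsub')
  have hcov : closure (trace γ) ⊆ K ∪ F := by
    have : trace γ ⊆ K ∪ γ '' (Ioc 0 a ∪ Ico b 1) := by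
      rintro _ ⟨s, hs, rfl⟩
      rcases le_total s a with h | h
      · exact Or.inr ⟨s, Or.inl ⟨hs.1, h⟩, rfl⟩
      · rcases le_total b s with h' | h'
        · exact Or.inr ⟨s, Or.inr ⟨h', hs.2⟩, rfl⟩
        · exact Or.inl ⟨s, ⟨h, h'⟩, rfl⟩
    have := closure_mono this
    rwa [closure_union, hK.isClosed.closure_eq] at this
  -- The centres with a foot in `K` and those with a foot in `F` form two closed sets that cover
  -- `A`, so some centre has a foot in each.
  obtain ⟨z, hzA, hzK, hzF⟩ := isPreconnected_closed_iff.1 hA _ _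
    (isClosed_infDist_le (S := trace γ) K) (isClosed_infDist_le (S := trace γ) F)
    (fun z _ => by
      obtain ⟨y, hy, hy'⟩ := isClosed_closure.exists_infDist_eq_dist
        (show (closure (trace γ)).Nonempty from ⟨q, hFS hq⟩) z
      rw [infDist_closure] at hy'
      rcases hcov hy with h | h
      · exact Or.inl ((infDist_le_dist_of_mem h).trans_eq hy'.symm)
      · exact Or.inr ((infDist_le_dist_of_mem h).trans_eq hy'.symm))
    ⟨z₁, hz₁, (infDist_le_dist_of_mem hp).trans_eq hp'⟩
    ⟨z₂, hz₂, (infDist_le_dist_of_mem hq).trans_eq hq'⟩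
  obtain ⟨x, hx, hx'⟩ := hK.isClosed.exists_infDist_eq_dist ⟨p, hp⟩ z
  obtain ⟨y, hy, hy'⟩ := isClosed_closure.exists_infDist_eq_dist (show F.Nonempty from ⟨q, hq⟩) z
  rw [mem_ofPred_eq, hx'] at hzK
  rw [mem_ofPred_eq, hy'] at hzF
  obtain ⟨s, hs, rfl⟩ := hx
  have hle : infDist z (trace γ) ≤ dist z y :=
    infDist_le_dist_of_mem_closure (hFS hy)
  have hne : y ≠ γ s := by
    -- A common foot would have to be `γ a` or `γ b`, and these are too far away from all centres in
    -- `A`.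
    rintro rfl
    have hcl := hγ.mem_closure_of_apply_mem_closure hsub' (hsub hs) hy
    have hs2 : s ∈ Iic a ∪ Ici b := by
      refine closure_minimal ?_ (isClosed_Iic.union isClosed_Ici) hcl
      exact union_subset_union (fun x hx => hx.2) fun x hx => hx.1
    rcases hs2 with h | h
    · have := le_antisymm h hs.1
      subst this
      exact absurd (hfa z hzA) (not_lt.2 hzK)
    · have := le_antisymm hs.2 h
      subst this
      exact absurd (hfb z hzA) (not_lt.2 hzK)
  exact ⟨z, hzA, mem_divider_of_two_feet (mem_trace (hsub hs)) (hFS hy) hne (hpos z hzA)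
    (le_antisymm hzK (infDist_le_dist_of_mem (mem_trace (hsub hs)))) (le_antisymm hzF hle)⟩

/-- A point at which `X` accumulates from both sides of the zero set of `G`, which it does not meet
elsewhere nearby, is not an end point of `X`. -/
theorem not_isEndPoint_of_two_sides {X : Set Plane} {c : Plane} {G : Plane → ℝ}
    (hG : Continuous G) {R : ℝ} (hpos : 0 < R) (hside : ∀ z ∈ X, z ≠ c → dist z c < R → G z ≠ 0)
    (hgt : ∀ δ > 0, ∃ z ∈ X, z ≠ c ∧ dist z c ≤ δ ∧ 0 ≤ G z)
    (hlt : ∀ δ > 0, ∃ z ∈ X, z ≠ c ∧ dist z c ≤ δ ∧ G z ≤ 0) : ¬ IsEndPoint X c := by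
  rintro ⟨U, hcU, hU, φ, hφ⟩
  have hopen : IsOpen (Subtype.val ⁻¹' ball c R : Set ↥(X ∩ U)) :=
    isOpen_ball.preimage continuous_subtype_val
  have hopen' : IsOpen (φ '' (Subtype.val ⁻¹' ball c R : Set ↥(X ∩ U))) := φ.isOpen_image.2 hopen
  have h0mem : φ ⟨c, hcU⟩ ∈ φ '' (Subtype.val ⁻¹' ball c R : Set ↥(X ∩ U)) :=
    mem_image_of_mem φ (show c ∈ ball c R from mem_ball_self hpos)
  obtain ⟨ε, hε, hεsub⟩ := Metric.isOpen_iff.1 hopen' _ h0mem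
  set J : Set (Ico (0 : ℝ) 1) := {x | 0 < (x : ℝ) ∧ (x : ℝ) < ε} with hJ
  -- A short half-open arc stays connected after removal of its end `c`, whereas `G` takes both
  -- signs on the remainder without vanishing.
  have hJpre : IsPreconnected J := by
    have : Subtype.val '' J = Ioo 0 (min ε 1) := by
      ext x
      constructor
      · rintro ⟨y, hy, rfl⟩
        exact ⟨hy.1, lt_min hy.2 y.2.2⟩
      · intro hx
        exact ⟨⟨x, hx.1.le, hx.2.trans_le (min_le_right _ _)⟩,
          ⟨hx.1, hx.2.trans_le (min_le_left _ _)⟩, rfl⟩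
    rw [← IsInducing.subtypeVal.isPreconnected_image, this]
    exact isPreconnected_Ioo
  set C : Set Plane := (fun x => (φ.symm x : Plane)) '' J with hC
  have hCpre : IsPreconnected C := hJpre.image _ (by fun_prop)
  have hCX : ∀ z ∈ C, z ∈ X ∧ z ≠ c ∧ dist z c < R := by
    rintro _ ⟨x, hx, rfl⟩
    refine ⟨(φ.symm x).2.1, fun h => ?_, ?_⟩
    · have h1 : φ.symm x = ⟨c, hcU⟩ := Subtype.ext h
      have h2 : x = φ ⟨c, hcU⟩ := by rw [← h1, φ.apply_symm_apply]
      have h3 := hx.1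
      rw [h2, hφ] at h3
      exact lt_irrefl _ h3
    · have h1 : x ∈ φ '' (Subtype.val ⁻¹' ball c R : Set ↥(X ∩ U)) := by
        apply hεsub
        rw [mem_ball, Subtype.dist_eq, Real.dist_eq, hφ, sub_zero, abs_of_pos hx.1]
        exact hx.2
      obtain ⟨y, hy, hyx⟩ := h1
      rw [← hyx]
      simp only [φ.symm_apply_apply]
      exact hy
  have hnear : ∃ δ > 0, ∀ z ∈ X, z ≠ c → dist z c ≤ δ → z ∈ C := by
    have hcont : ContinuousAt (fun y => (φ y : ℝ)) ⟨c, hcU⟩ := by fun_prop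
    have h1 : ∀ᶠ y in 𝓝 (⟨c, hcU⟩ : ↥(X ∩ U)), (φ y : ℝ) < ε := by
      refine hcont.eventually (Iio_mem_nhds ?_)
      simp only [hφ]; exact hε
    obtain ⟨δ₁, hδ₁, hb1⟩ := Metric.eventually_nhds_iff.1 h1
    obtain ⟨δ₂, hδ₂, hb2⟩ := Metric.isOpen_iff.1 hU c hcU.2
    refine ⟨min (δ₁ / 2) (δ₂ / 2), lt_min (by linarith) (by linarith), fun z hz hzc hzδ => ?_⟩
    have hz1 : dist z c < δ₁ := by
      have := hzδ.trans (min_le_left _ _); linarith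
    have hz2 : dist z c < δ₂ := by
      have := hzδ.trans (min_le_right _ _); linarith
    have hzU : z ∈ X ∩ U := ⟨hz, hb2 hz2⟩
    refine ⟨φ ⟨z, hzU⟩, ⟨?_, hb1 hz1⟩, by simp⟩
    refine lt_of_le_of_ne (φ ⟨z, hzU⟩).2.1 fun h => hzc ?_
    have : φ ⟨z, hzU⟩ = φ ⟨c, hcU⟩ := Subtype.ext (by rw [hφ, ← h])
    exact congrArg Subtype.val (φ.injective this)
  obtain ⟨δ, hδ, hnear⟩ := hnear
  obtain ⟨z₁, hz₁, hz₁c, hz₁δ, hs₁⟩ := hgt δ hδ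
  obtain ⟨z₂, hz₂, hz₂c, hz₂δ, hs₂⟩ := hlt δ hδ
  obtain ⟨z, hzC, hz0⟩ := hCpre.intermediate_value (hnear z₂ hz₂ hz₂c hz₂δ)
    (hnear z₁ hz₁ hz₁c hz₁δ) hG.continuousOn ⟨hs₂, hs₁⟩
  obtain ⟨h1, h2, h3⟩ := hCX z hzC
  exact hside z h1 h2 h3 hz0

/-- A centre with two feet is not an end point of the Divider: the Divider leaves it on both sides
of the pair of radii to the feet. -/
theorem IsC2OpenArc.not_isEndPoint_of_two_feet (hγ : IsC2OpenArc γ)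
    (hconst : NoConstantCurvatureArc γ) {c q : Plane} {t : ℝ} (ht : t ∈ Ioo (0 : ℝ) 1)
    (hqt : q ≠ γ t) (hq : q ∈ closure (trace γ)) (hpos : 0 < infDist c (trace γ))
    (hct : dist c (γ t) = infDist c (trace γ)) (hcq : dist c q = infDist c (trace γ)) :
    ¬ IsEndPoint (divider (trace γ)) c := by
  obtain ⟨a, b, ha, hat, htb, hb, hfa, hfb, hcl⟩ := hγ.exists_far_parameters hconst ht hqt hq
    (c := c)
  set X := divider (trace γ)
  set R := infDist c (trace γ) with hR
  obtain ⟨u, hu, hcu⟩ := exists_unit_of_dist_pos (z := γ t) (p := c)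
    (by rw [dist_comm, hct]; exact hpos)
  obtain ⟨v, hv, hcv⟩ := exists_unit_of_dist_pos (z := q) (p := c)
    (by rw [dist_comm, hcq]; exact hpos)
  rw [dist_comm, hct] at hcu
  rw [dist_comm, hcq] at hcv
  have huv : u ≠ v := by
    rintro rfl; exact hqt (hcv.trans hcu.symm)
  -- Moving the centre by at most `δ₀` changes both the distance to the curve and the distance to `γ
  -- a` by at most `δ₀`; the margin `2 * δ₀` keeps `γ a` and `γ b` from becoming feet.
  obtain ⟨δ₀, hδ₀, hδ₀R, hδa, hδb⟩ : ∃ δ₀ > 0, δ₀ < R ∧ R + 2 * δ₀ < dist c (γ a) ∧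
      R + 2 * δ₀ < dist c (γ b) := by
    refine ⟨min R (min (dist c (γ a) - R) (dist c (γ b) - R)) / 3, ?_, ?_, ?_, ?_⟩
    · have := lt_min hpos (lt_min (sub_pos.2 hfa) (sub_pos.2 hfb))
      linarith
    · have := min_le_left R (min (dist c (γ a) - R) (dist c (γ b) - R))
      linarith
    · have h1 := min_le_right R (min (dist c (γ a) - R) (dist c (γ b) - R))
      have h2 := min_le_left (dist c (γ a) - R) (dist c (γ b) - R)
      linarith
    · have h1 := min_le_right R (min (dist c (γ a) - R) (dist c (γ b) - R))
      have h2 := min_le_right (dist c (γ a) - R) (dist c (γ b) - R)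
      linarith
  have hfoot : ∀ w : Plane, ‖w‖ = 1 → c + R • w ∈ closure (trace γ) → ∀ δ, 0 < δ → δ < R →
      dist (c + δ • w) (c + R • w) = infDist (c + δ • w) (trace γ) := by
    intro w hw hwS δ hδ hδR
    have h1 : dist (c + δ • w) (c + R • w) = R - δ := by
      rw [dist_comm, dist_eq_norm, add_sub_add_left_eq_sub, ← sub_smul, norm_smul, hw, mul_one,
        Real.norm_eq_abs, abs_of_pos (by linarith)]
    refine le_antisymm ?_ ?_
    · have h2 := infDist_le_infDist_add_dist (s := trace γ) (x := c) (y := c + δ • w)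
      rw [dist_self_add_right, norm_smul, hw, mul_one, Real.norm_eq_abs, abs_of_pos hδ] at h2
      rw [h1]; linarith
    · exact infDist_le_dist_of_mem_closure hwS
  have hγS : c + R • u ∈ closure (trace γ) := hcu ▸ subset_closure (mem_trace ht)
  have hqS : c + R • v ∈ closure (trace γ) := hcv ▸ hq
  have hmeet : ∀ A : Set Plane, IsPreconnected A → u ∈ A → v ∈ A → (∀ w ∈ A, ‖w‖ ≤ 1) →
      ∀ δ, 0 < δ → δ ≤ δ₀ → ∃ w ∈ A, c + δ • w ∈ X := by
    intro A hA huA hvA hAn δ hδ hδδ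
    have hdist : ∀ w ∈ A, dist c (c + δ • w) ≤ δ := fun w hw => by
      rw [dist_self_add_right, norm_smul, Real.norm_eq_abs, abs_of_pos hδ]
      exact mul_le_of_le_one_right hδ.le (hAn w hw)
    have hinf : ∀ w ∈ A, infDist (c + δ • w) (trace γ) ≤ R + δ := fun w hw => by
      have h2 := infDist_le_infDist_add_dist (s := trace γ) (x := c + δ • w) (y := c)
      rw [dist_comm] at h2
      linarith [hdist w hw]
    have hfar : ∀ s, R + 2 * δ₀ < dist c (γ s) → ∀ z ∈ (fun w => c + δ • w) '' A,
        infDist z (trace γ) < dist z (γ s) := by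
      rintro s hs _ ⟨w, hw, rfl⟩
      have := dist_triangle c (c + δ • w) (γ s)
      linarith [hdist w hw, hinf w hw]
    obtain ⟨_, ⟨w, hw, rfl⟩, hwX⟩ := hγ.inter_divider_nonempty
      (hA.image (fun w => c + δ • w) (by fun_prop)) ha (hat.trans htb) hb (hfar a hδa) (hfar b hδb)
      (by
        rintro _ ⟨w, hw, rfl⟩
        have h2 := infDist_le_infDist_add_dist (s := trace γ) (x := c) (y := c + δ • w)
        linarith [hdist w hw])
      (mem_image_of_mem _ huA) (mem_image_of_mem _ hvA) (mem_image_of_mem γ ⟨hat.le, htb.le⟩)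
      (by
        have := hfoot u hu hγS δ hδ (by linarith)
        rwa [← hcu] at this)
      hcl
      (by
        have := hfoot v hv hqS δ hδ (by linarith)
        rwa [← hcv] at this)
    exact ⟨w, hw, hwX⟩
  have hside : ∀ z ∈ X, z ≠ c → dist z c < R → sectorSide u v (z - c) ≠ 0 := by
    intro z hz hzc hzR h0
    have hn : 0 < ‖z - c‖ := norm_pos_iff.2 (sub_ne_zero.2 hzc)
    rw [dist_eq_norm] at hzR
    rcases mem_rays_of_sectorSide_eq_zero hu hv huv h0 with h | h
    · refine ray_notMem_divider hu hn hzR hγS ?_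
      rw [← h, add_sub_cancel]; exact hz
    · refine ray_notMem_divider hv hn hzR hqS ?_
      rw [← h, add_sub_cancel]; exact hz
  have hgt : ∀ δ > 0, ∃ z ∈ X, z ≠ c ∧ dist z c ≤ δ ∧ 0 ≤ sectorSide u v (z - c) := by
    intro δ' hδ'
    obtain ⟨δ, hδ, hδδ, hδδ'⟩ : ∃ δ > 0, δ ≤ δ₀ ∧ δ ≤ δ' :=
      ⟨min δ₀ δ', lt_min hδ₀ hδ', min_le_left _ _, min_le_right _ _⟩
    obtain ⟨A, hA, huA, hvA, hAw⟩ := exists_path_sectorSide hu hv huv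
    obtain ⟨w, hw, hwX⟩ := hmeet A hA huA hvA (fun w hw => (hAw w hw).2.1) δ hδ hδδ
    refine ⟨_, hwX, ?_, ?_, ?_⟩
    · simpa using ⟨hδ.ne', (hAw w hw).1⟩
    · rw [dist_self_add_left, norm_smul, Real.norm_eq_abs, abs_of_pos hδ]
      exact (mul_le_of_le_one_right hδ.le (hAw w hw).2.1).trans hδδ'
    · rw [add_sub_cancel_left, sectorSide_smul _ _ hδ.le]
      exact mul_nonneg hδ.le (hAw w hw).2.2
  have hlt : ∀ δ > 0, ∃ z ∈ X, z ≠ c ∧ dist z c ≤ δ ∧ sectorSide u v (z - c) ≤ 0 := by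
    intro δ' hδ'
    obtain ⟨δ, hδ, hδδ, hδδ'⟩ : ∃ δ > 0, δ ≤ δ₀ ∧ δ ≤ δ' :=
      ⟨min δ₀ δ', lt_min hδ₀ hδ', min_le_left _ _, min_le_right _ _⟩
    obtain ⟨A, hA, hvA, huA, hAw⟩ := exists_path_sectorSide hv hu huv.symm
    obtain ⟨w, hw, hwX⟩ := hmeet A hA huA hvA (fun w hw => (hAw w hw).2.1) δ hδ hδδ
    refine ⟨_, hwX, ?_, ?_, ?_⟩
    · simpa using ⟨hδ.ne', (hAw w hw).1⟩
    · rw [dist_self_add_left, norm_smul, Real.norm_eq_abs, abs_of_pos hδ]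
      exact (mul_le_of_le_one_right hδ.le (hAw w hw).2.1).trans hδδ'
    · have h1 := (hAw w hw).2.2
      rw [sectorSide_swap] at h1
      rw [add_sub_cancel_left, sectorSide_smul _ _ hδ.le]
      exact mul_nonpos_of_nonneg_of_nonpos hδ.le (by linarith)
  exact not_isEndPoint_of_two_sides ((continuous_sectorSide u v).comp
    (continuous_id.sub continuous_const)) hpos hside hgt hlt

end DividerSet

/-! ### The osculating disk at the vertex and the feet near it -/

namespace DividerSet

open Metric

variable {γ : ℝ → Plane}

/-- The curvature increases strictly up to the parameter `t₀` and decreases strictly from there. -/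
structure HasVertex (γ : ℝ → Plane) (t₀ : ℝ) : Prop where
  mem : t₀ ∈ Ioo (0 : ℝ) 1
  strictMonoOn : StrictMonoOn (curvature γ) (Ioc 0 t₀)
  strictAntiOn : StrictAntiOn (curvature γ) (Ico t₀ 1)

variable {t₀ : ℝ}

theorem HasVertex.curvature_ne_zero (h : HasVertex γ t₀) {t : ℝ} (ht : t ∈ Ioo (0 : ℝ) 1) :
    curvature γ t ≠ 0 := by
  rcases le_total t t₀ with hle | hle
  · exact ((curvature_nonneg γ (t / 2)).trans_lt
      (h.strictMonoOn ⟨by linarith [ht.1], by linarith [ht.1]⟩ ⟨ht.1, hle⟩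
        (by linarith [ht.1]))).ne'
  · exact ((curvature_nonneg γ ((t + 1) / 2)).trans_lt
      (h.strictAntiOn ⟨hle, ht.2⟩ ⟨by linarith [ht.2], by linarith [ht.2]⟩
        (by linarith [ht.2]))).ne'

/-- Beyond the vertex the curve stays outside of its osculating disks. -/
theorem HasVertex.inv_lt_dist_right (h : HasVertex γ t₀) (hγ : IsC2OpenArc γ) {a b : ℝ}
    (ha : t₀ ≤ a) (hab : a < b) (hb : b < 1) : (curvature γ a)⁻¹ < dist (evolute γ a) (γ b) :=
  (hγ.dist_evolute_of_strictAntiOn (h.mem.1.trans_le ha) hab hb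
    (h.strictAntiOn.mono fun _ hx => ⟨ha.trans hx.1, hx.2.trans_lt hb⟩)
    (h.curvature_ne_zero ⟨(h.mem.1.trans_le ha).trans hab, hb⟩)).1

theorem HasVertex.inv_lt_dist_left (h : HasVertex γ t₀) (hγ : IsC2OpenArc γ) {a b : ℝ}
    (ha : a ≤ t₀) (hba : b < a) (hb : 0 < b) : (curvature γ a)⁻¹ < dist (evolute γ a) (γ b) :=
  (hγ.dist_evolute_of_strictMonoOn hb hba (ha.trans_lt h.mem.2)
    (h.strictMonoOn.mono fun _ hx => ⟨hb.trans_le hx.1, hx.2.trans ha⟩)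
    (h.curvature_ne_zero ⟨hb, hba.trans (ha.trans_lt h.mem.2)⟩)).2.1

theorem HasVertex.inv_lt_dist (h : HasVertex γ t₀) (hγ : IsC2OpenArc γ) {s : ℝ}
    (hs : s ∈ Ioo (0 : ℝ) 1) (hst : s ≠ t₀) :
    (curvature γ t₀)⁻¹ < dist (evolute γ t₀) (γ s) := by
  rcases lt_or_gt_of_ne hst with hlt | hlt
  · exact h.inv_lt_dist_left hγ le_rfl hlt hs.1
  · exact h.inv_lt_dist_right hγ le_rfl hlt hs.2

theorem HasVertex.inv_le_dist (h : HasVertex γ t₀) (hγ : IsC2OpenArc γ) {s : ℝ}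
    (hs : s ∈ Ioo (0 : ℝ) 1) : (curvature γ t₀)⁻¹ ≤ dist (evolute γ t₀) (γ s) := by
  by_cases hst : s = t₀
  · rw [hst, hγ.dist_evolute h.mem (h.curvature_ne_zero h.mem)]
  · exact (h.inv_lt_dist hγ hs hst).le

theorem HasVertex.infDist_evolute (h : HasVertex γ t₀) (hγ : IsC2OpenArc γ) :
    infDist (evolute γ t₀) (trace γ) = (curvature γ t₀)⁻¹ := by
  refine le_antisymm ?_ ?_
  · rw [← hγ.dist_evolute h.mem (h.curvature_ne_zero h.mem)]
    exact infDist_le_dist_of_mem (mem_trace h.mem)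
  · rw [le_infDist ⟨_, mem_trace h.mem⟩]
    rintro _ ⟨s, hs, rfl⟩
    exact h.inv_le_dist hγ hs

theorem HasVertex.piSet_subset_convexSide (h : HasVertex γ t₀) (hγ : IsC2OpenArc γ) :
    piSet (trace γ) ⊆ convexSide γ := by
  intro p hp
  obtain ⟨m, hm, hmax⟩ := hγ.exists_isLocalMax_of_mem_piSet hp
  obtain ⟨hk, d, hd, hpd⟩ := hγ.exists_normal_of_isLocalMax hm hmax
  rcases eq_or_lt_of_le hd with heq | hlt
  -- In the degenerate case the point is the centre of curvature at `m`. On the side leading away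
  -- from the vertex the curve lies strictly outside that osculating disk, so the distance has no
  -- local maximum at `m`.
  · exfalso
    have hpe : p = evolute γ m := by rw [hpd, hγ.evolute_eq hm hk, heq]
    have hle : ∀ᶠ s in 𝓝 m, s ∈ Ioo (0 : ℝ) 1 ∧ dist (evolute γ m) (γ s) ≤ (curvature γ m)⁻¹ := by
      filter_upwards [hmax, isOpen_Ioo.mem_nhds hm] with s hs hs'
      rw [hpe] at hs
      exact ⟨hs', hs.trans_eq (hγ.dist_evolute hm hk)⟩
    obtain ⟨η, hη, hs⟩ := exists_Icc_subset_of_eventually hle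
    rcases le_total t₀ m with h1 | h1
    · have hr := hs (m + η) ⟨by linarith, le_rfl⟩
      exact absurd hr.2 (not_le.2 (h.inv_lt_dist_right hγ h1 (by linarith) hr.1.2))
    · have hl := hs (m - η) ⟨le_rfl, by linarith⟩
      exact absurd hl.2 (not_le.2 (h.inv_lt_dist_left hγ h1 (by linarith) hl.1.1))
  · rw [hpd]; exact hγ.normal_mem_convexSide hm hk hlt

/-- The osculating disk at the vertex has no curve point in its interior, while any larger tangent
disk has radius above `(curvature γ t₀)⁻¹` and swallows a neighbouring arc. -/
theorem HasVertex.evolute_mem_divider (h : HasVertex γ t₀) (hγ : IsC2OpenArc γ) :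
    evolute γ t₀ ∈ divider (trace γ) := by
  have hk := h.curvature_ne_zero h.mem
  have hk0 : 0 < (curvature γ t₀)⁻¹ :=
    inv_pos.2 (lt_of_le_of_ne (curvature_nonneg γ t₀) hk.symm)
  have hN := hγ.norm_unitNormal h.mem hk
  refine ⟨γ t₀, mem_trace h.mem, unitNormal γ t₀, hN, (curvature γ t₀)⁻¹,
    isLUB_contactRadii (mem_trace h.mem) hN hk0 ?_ ?_, hγ.evolute_eq h.mem hk⟩
  · rintro _ ⟨s, hs, rfl⟩
    rw [← hγ.evolute_eq h.mem hk, ← dist_eq_norm, dist_comm]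
    exact h.inv_le_dist hγ hs
  · intro r hr
    by_contra! hlt
    obtain ⟨η, hη, hs⟩ := exists_Icc_subset_of_eventually
      ((hγ.eventually_dist_lt_of_inv_lt h.mem hk hlt).and (isOpen_Ioo.eventually_mem h.mem))
    obtain ⟨h1, h2⟩ := hs (t₀ + η) ⟨by linarith, le_rfl⟩
    have h3 := h1 (by linarith)
    rw [hγ.dist_normal h.mem hk, abs_of_pos (hk0.trans hlt)] at h3
    have h4 : γ (t₀ + η) ∈ closedBall (γ t₀ + r • unitNormal γ t₀) r ∩ trace γ :=
      ⟨by rw [mem_closedBall, dist_comm]; exact h3.le, mem_trace h2⟩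
    rw [hr.2] at h4
    have := hγ.eq_of_apply_eq h2 h.mem h4
    linarith

/-- Outside of a neighbourhood of the vertex the curve has a definite distance from the osculating
disk at the vertex. -/
theorem HasVertex.exists_gap (h : HasVertex γ t₀) (hγ : IsC2OpenArc γ) {η : ℝ} (hη : 0 < η)
    (hl : t₀ - η ∈ Ioo (0 : ℝ) 1) (hr : t₀ + η ∈ Ioo (0 : ℝ) 1) :
    ∃ ρ > (curvature γ t₀)⁻¹, ∀ s ∈ Ioo (0 : ℝ) 1 \ Ioo (t₀ - η) (t₀ + η),
      ρ ≤ dist (evolute γ t₀) (γ s) := by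
  have hR := (hγ.dist_evolute_of_strictAntiOn h.mem.1 (show t₀ < t₀ + η by linarith) hr.2
    (h.strictAntiOn.mono fun _ hx => ⟨hx.1, hx.2.trans_lt hr.2⟩) (h.curvature_ne_zero hr)).2.2
  have hL := (hγ.dist_evolute_of_strictMonoOn hl.1 (show t₀ - η < t₀ by linarith) h.mem.2
    (h.strictMonoOn.mono fun _ hx => ⟨hl.1.trans_le hx.1, hx.2⟩) (h.curvature_ne_zero hl)).2.2
  -- Compactness is not available at the open ends. Instead the whole tail avoids the interior of
  -- the osculating disk at `t₀ ± η`, which contains a concentric enlargement of the osculating disk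
  -- at `t₀` by the strict nesting estimate.
  refine ⟨min ((curvature γ (t₀ + η))⁻¹ - dist (evolute γ t₀) (evolute γ (t₀ + η)))
    ((curvature γ (t₀ - η))⁻¹ - dist (evolute γ (t₀ - η)) (evolute γ t₀)),
    lt_min (by linarith) (by linarith), ?_⟩
  rintro s ⟨hs, hs'⟩
  rcases lt_or_ge (t₀ - η) s with h1 | h1
  · have h2 : t₀ + η ≤ s := by
      by_contra! h2; exact hs' ⟨h1, h2⟩
    refine (min_le_left _ _).trans ?_
    have h3 : (curvature γ (t₀ + η))⁻¹ ≤ dist (evolute γ (t₀ + η)) (γ s) := by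
      rcases eq_or_lt_of_le h2 with h4 | h4
      · rw [← h4, hγ.dist_evolute hr (h.curvature_ne_zero hr)]
      · exact (h.inv_lt_dist_right hγ (by linarith) h4 hs.2).le
    have := dist_triangle_left (evolute γ (t₀ + η)) (γ s) (evolute γ t₀)
    linarith
  · refine (min_le_right _ _).trans ?_
    have h3 : (curvature γ (t₀ - η))⁻¹ ≤ dist (evolute γ (t₀ - η)) (γ s) := by
      rcases eq_or_lt_of_le h1 with h4 | h4
      · rw [h4, hγ.dist_evolute hl (h.curvature_ne_zero hl)]
      · exact (h.inv_lt_dist_left hγ (by linarith) h4 hs.1).le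
    have := dist_triangle (evolute γ (t₀ - η)) (evolute γ t₀) (γ s)
    linarith

/-- Near the vertex the curve moves along its tangent and bends to the side of its normal. -/
theorem IsC2OpenArc.exists_local_graph (hγ : IsC2OpenArc γ) (ht₀ : t₀ ∈ Ioo (0 : ℝ) 1)
    (hk : curvature γ t₀ ≠ 0) : ∀ᶠ s in 𝓝 t₀,
      (s < t₀ → inner ℝ (γ s - γ t₀) (deriv γ t₀) < 0) ∧
      (t₀ < s → 0 < inner ℝ (γ s - γ t₀) (deriv γ t₀)) ∧
      (s ≠ t₀ → 0 < inner ℝ (γ s - γ t₀) (unitNormal γ t₀)) := by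
  have hv := hγ.norm_deriv_pos ht₀
  have e1 : ∀ᶠ s in 𝓝 t₀, 0 < inner ℝ (deriv γ s) (deriv γ t₀) :=
    (((hγ.hasDerivAt_deriv ht₀).continuousAt).inner continuousAt_const).eventually
      (Ioi_mem_nhds (by beta_reduce; rw [real_inner_self_eq_norm_sq]; exact pow_pos hv 2))
  have e2 : ∀ᶠ s in 𝓝 t₀, 0 < inner ℝ (deriv (deriv γ) s) (unitNormal γ t₀) := by
    refine ((hγ.continuousAt_deriv2 ht₀).inner continuousAt_const).eventually (Ioi_mem_nhds ?_)
    beta_reduce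
    rw [real_inner_comm, hγ.inner_unitNormal_deriv2 ht₀]
    exact mul_pos (lt_of_le_of_ne (curvature_nonneg γ t₀) hk.symm) (pow_pos hv 2)
  obtain ⟨η, hη, hs⟩ := exists_Icc_subset_of_eventually
    (e1.and (e2.and (isOpen_Ioo.eventually_mem ht₀)))
  have hd : ∀ w : Plane, ∀ s ∈ Icc (t₀ - η) (t₀ + η),
      HasDerivAt (fun s => inner ℝ (γ s - γ t₀) w) (inner ℝ (deriv γ s) w) s := fun w s hs' => by
    have := ((hγ.hasDerivAt (hs s hs').2.2).sub_const (γ t₀)).inner ℝ (hasDerivAt_const s w)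
    simpa using this
  have hmono : StrictMonoOn (fun s => inner ℝ (γ s - γ t₀) (deriv γ t₀))
      (Icc (t₀ - η) (t₀ + η)) := by
    refine strictMonoOn_of_deriv_pos (convex_Icc _ _)
      (fun s hs' => (hd _ s hs').continuousAt.continuousWithinAt) fun s hs' => ?_
    rw [(hd _ s (interior_subset hs')).deriv]
    exact (hs s (interior_subset hs')).1
  have hmin := strict_min_of_second_deriv_pos (x := t₀) (hd (unitNormal γ t₀))
    (g'' := fun s => inner ℝ (deriv (deriv γ) s) (unitNormal γ t₀))
    (fun s hs' => by
      have := (hγ.hasDerivAt_deriv (hs s hs').2.2).inner ℝ (hasDerivAt_const s (unitNormal γ t₀))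
      simpa using this)
    (fun s hs' => (hs s hs').2.1) ⟨by linarith, by linarith⟩ (inner_deriv_unitNormal γ t₀)
  have ht : t₀ ∈ Icc (t₀ - η) (t₀ + η) := ⟨by linarith, by linarith⟩
  filter_upwards [Icc_mem_nhds (show t₀ - η < t₀ by linarith) (show t₀ < t₀ + η by linarith)]
    with s hs'
  refine ⟨fun hlt => ?_, fun hlt => ?_, fun hne => ?_⟩
  · simpa using hmono hs' ht hlt
  · simpa using hmono ht hs' hlt
  · simpa using hmin s hs' hne

/-- For the centres in the disk of radius `ε` about the centre of curvature at `t₀`, every foot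
lies on a small arc about `γ t₀`, which is described in the frame at `γ t₀`. -/
def IsVertexChart (γ : ℝ → Plane) (t₀ ε : ℝ) : Prop :=
  ∀ z ∈ ball (evolute γ t₀) ε, ∀ x ∈ closure (trace γ), dist z x = infDist z (trace γ) →
    ∃ s ∈ Ioo (0 : ℝ) 1, x = γ s ∧ 0 < infDist z (trace γ) ∧
      infDist z (trace γ) ≤ (curvature γ s)⁻¹ ∧ z = γ s + infDist z (trace γ) • unitNormal γ s ∧
      (s < t₀ → inner ℝ (γ s - γ t₀) (deriv γ t₀) < 0) ∧
      (t₀ < s → 0 < inner ℝ (γ s - γ t₀) (deriv γ t₀)) ∧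
      (s ≠ t₀ → 0 < inner ℝ (γ s - γ t₀) (unitNormal γ t₀))

theorem HasVertex.exists_chart (h : HasVertex γ t₀) (hγ : IsC2OpenArc γ) :
    ∃ ε > 0, IsVertexChart γ t₀ ε := by
  have hk := h.curvature_ne_zero h.mem
  have hk0 : 0 < (curvature γ t₀)⁻¹ :=
    inv_pos.2 (lt_of_le_of_ne (curvature_nonneg γ t₀) hk.symm)
  have hN := hγ.norm_unitNormal h.mem hk
  have hcont : ContinuousAt (fun p : Plane × ℝ => inner ℝ (p.1 - γ p.2) (unitNormal γ p.2))
      (evolute γ t₀, t₀) := by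
    have h1 : ContinuousAt (fun p : Plane × ℝ => γ p.2) (evolute γ t₀, t₀) :=
      ContinuousAt.comp (f := Prod.snd) (hγ.hasDerivAt h.mem).continuousAt continuousAt_snd
    have h2 : ContinuousAt (fun p : Plane × ℝ => unitNormal γ p.2) (evolute γ t₀, t₀) :=
      ContinuousAt.comp (f := Prod.snd) (g := unitNormal γ) (hγ.hasDerivAt_unitNormal h.mem hk).continuousAt
        continuousAt_snd
    exact (continuousAt_fst.sub h1).inner h2
  have hev : ∀ᶠ p in 𝓝 (evolute γ t₀, t₀), 0 < inner ℝ (p.1 - γ p.2) (unitNormal γ p.2) := by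
    refine hcont.eventually (Ioi_mem_nhds ?_)
    beta_reduce
    rw [hγ.evolute_eq h.mem hk, add_sub_cancel_left, real_inner_smul_left,
      real_inner_self_eq_norm_sq, hN]
    simpa using hk0
  rw [nhds_prod_eq, eventually_prod_iff] at hev
  obtain ⟨P, hP, Q, hQ, hPQ⟩ := hev
  obtain ⟨η, hη, hs⟩ := exists_Icc_subset_of_eventually
    (hQ.and ((hγ.exists_local_graph h.mem hk).and (isOpen_Ioo.eventually_mem h.mem)))
  obtain ⟨ε₁, hε₁, hP⟩ := Metric.eventually_nhds_iff.1 hP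
  obtain ⟨ρ, hρ, hgap⟩ := h.exists_gap hγ hη (hs _ ⟨le_rfl, by linarith⟩).2.2
    (hs _ ⟨by linarith, le_rfl⟩).2.2
  have hρ' : 0 < ρ - (curvature γ t₀)⁻¹ := sub_pos.2 hρ
  refine ⟨min ε₁ ((ρ - (curvature γ t₀)⁻¹) / 2), lt_min hε₁ (by linarith), ?_⟩
  intro z hz x hx hzx
  rw [mem_ball, lt_min_iff] at hz
  obtain ⟨hz1, hz2⟩ := hz
  have hinf := infDist_le_infDist_add_dist (s := trace γ) (x := z) (y := evolute γ t₀)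
  rw [h.infDist_evolute hγ] at hinf
  have hxlt : dist (evolute γ t₀) x < ρ := by
    have := dist_triangle_left (evolute γ t₀) x z
    linarith
  obtain ⟨s, hsη, rfl⟩ : x ∈ γ '' Icc (t₀ - η) (t₀ + η) := by
    have hcov : trace γ ⊆ γ '' Icc (t₀ - η) (t₀ + η)
        ∪ {y | ρ ≤ dist (evolute γ t₀) y} := by
      rintro _ ⟨s, hs, rfl⟩
      by_cases hs' : s ∈ Ioo (t₀ - η) (t₀ + η)
      · exact Or.inl ⟨s, Ioo_subset_Icc_self hs', rfl⟩
      · exact Or.inr (hgap s ⟨hs, hs'⟩)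
    have hcl : IsClosed (γ '' Icc (t₀ - η) (t₀ + η) ∪ {y | ρ ≤ dist (evolute γ t₀) y}) := by
      refine IsClosed.union (isCompact_Icc.image_of_continuousOn
        (hγ.continuousOn.mono fun s hs' => (hs s hs').2.2)).isClosed ?_
      exact isClosed_le continuous_const (by fun_prop)
    rcases closure_minimal hcov hcl hx with h1 | h1
    · exact h1
    · exact absurd hxlt (not_lt.2 h1)
  obtain ⟨hQs, ⟨g1, g2, g3⟩, hs01⟩ := hs s hsη
  have hks := h.curvature_ne_zero hs01
  have hmin : IsLocalMin (fun s => dist z (γ s)) s := by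
    filter_upwards [isOpen_Ioo.mem_nhds hs01] with r hr
    rw [hzx]; exact infDist_le_dist_of_mem (mem_trace hr)
  have hcrit := hγ.inner_eq_zero_of_isLocalExtr hs01 (Or.inl hmin)
  have h2 := hγ.secondForm_nonneg_of_isLocalMin hs01 hmin
  have hzd := hγ.smul_unitNormal_of_inner_eq_zero hs01 hks hcrit
  -- By continuity the centre stays on the side of the normal, so that its signed distance along the
  -- normal is `infDist z (trace γ)`.
  have hd0 : 0 < inner ℝ (z - γ s) (unitNormal γ s) := hPQ (hP hz1) hQs
  set d := inner ℝ (z - γ s) (unitNormal γ s)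
  have hd : d = infDist z (trace γ) := by
    rw [← hzx, hzd, hγ.dist_normal hs01 hks, abs_of_pos hd0]
  rw [hzd, hγ.secondForm_normal hs01] at h2
  have h3 := nonneg_of_mul_nonneg_right h2 (pow_pos (hγ.norm_deriv_pos hs01) 2)
  rw [← hd]
  refine ⟨s, hs01, rfl, hd0, ?_, hzd, g1, g2, g3⟩
  rw [le_inv_comm₀ hd0 (lt_of_le_of_ne (curvature_nonneg γ s) hks.symm), ← one_div,
    le_div_iff₀ hd0]
  linarith

end DividerSet

/-! ### The Divider near the cusp as a graph over the normal -/

namespace DividerSet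

open Metric

variable {γ : ℝ → Plane} {t₀ ε : ℝ}

/-- Feet move in the direction of the motion of the centre. -/
theorem inner_feet_nonneg {z c x y : Plane} (h1 : dist z x ≤ dist z y) (h2 : dist c y ≤ dist c x) :
    0 ≤ inner ℝ (x - y) (z - c) := by
  rw [dist_comm z x, dist_comm z y, dist_eq_norm, dist_eq_norm] at h1
  rw [dist_comm c x, dist_comm c y, dist_eq_norm, dist_eq_norm] at h2
  have h1' : ‖x - z‖ ^ 2 ≤ ‖y - z‖ ^ 2 := by gcongr
  have h2' : ‖y - c‖ ^ 2 ≤ ‖x - c‖ ^ 2 := by gcongr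
  simp only [norm_sub_sq_real] at h1' h2'
  simp only [inner_sub_left, inner_sub_right]
  linarith

/-- The height of a centre above the centre of curvature at `t₀`, along the normal. -/
noncomputable def height (γ : ℝ → Plane) (t₀ : ℝ) (z : Plane) : ℝ :=
  inner ℝ (z - evolute γ t₀) (unitNormal γ t₀)

theorem continuous_height (γ : ℝ → Plane) (t₀ : ℝ) : Continuous (height γ t₀) := by
  unfold height; fun_prop

theorem IsC2OpenArc.frame_decomposition (hγ : IsC2OpenArc γ) (ht₀ : t₀ ∈ Ioo (0 : ℝ) 1)
    (hk : curvature γ t₀ ≠ 0) (v : Plane) :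
    v = (inner ℝ v (deriv γ t₀) / ‖deriv γ t₀‖ ^ 2) • deriv γ t₀
      + inner ℝ v (unitNormal γ t₀) • unitNormal γ t₀ := by
  have hv := pow_ne_zero 2 (hγ.norm_deriv_pos ht₀).ne'
  set x := inner ℝ v (deriv γ t₀) / ‖deriv γ t₀‖ ^ 2 with hx
  have h1 := hγ.smul_unitNormal_of_inner_eq_zero (z := γ t₀ + (v - x • deriv γ t₀)) ht₀ hk (by
    rw [sub_add_cancel_left, inner_neg_left, inner_sub_left, real_inner_smul_left,
      real_inner_self_eq_norm_sq, hx, div_mul_cancel₀ _ hv, sub_self, neg_zero])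
  rw [add_sub_cancel_left, inner_sub_left, real_inner_smul_left, inner_deriv_unitNormal, mul_zero,
    sub_zero, add_right_inj] at h1
  rw [← h1, add_sub_cancel]

/-- The part of the plane whose feet lie on the arc of the curve with parameters in `A`. -/
def feetIn (γ : ℝ → Plane) (A : Set ℝ) : Set Plane :=
  {z | infDist z (closure (γ '' A)) ≤ infDist z (trace γ)}

theorem isClosed_feetIn (γ : ℝ → Plane) (A : Set ℝ) : IsClosed (feetIn γ A) :=
  isClosed_infDist_le _

theorem mem_feetIn {A : Set ℝ} {z : Plane} {s : ℝ} (hs : s ∈ A)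
    (hz : dist z (γ s) = infDist z (trace γ)) : z ∈ feetIn γ A :=
  (infDist_le_dist_of_mem (subset_closure (mem_image_of_mem γ hs))).trans_eq hz

theorem IsVertexChart.exists_foot (hch : IsVertexChart γ t₀ ε) (hγ : IsC2OpenArc γ) {A F : Set ℝ}
    (hA : A ⊆ Ioo 0 1) (hne : A.Nonempty) (hF : IsClosed F) (hAF : A ⊆ F) {z : Plane}
    (hz : z ∈ ball (evolute γ t₀) ε) (hzA : z ∈ feetIn γ A) :
    ∃ s ∈ Ioo (0 : ℝ) 1, s ∈ F ∧ dist z (γ s) = infDist z (trace γ) := by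
  obtain ⟨x, hx, hx'⟩ := isClosed_closure.exists_infDist_eq_dist
    (show (closure (γ '' A)).Nonempty from (hne.image γ).closure) z
  have hxS : x ∈ closure (trace γ) := closure_mono (image_mono hA) hx
  have hzA' : infDist z (closure (γ '' A)) ≤ infDist z (trace γ) := hzA
  rw [hx'] at hzA'
  have heq := le_antisymm hzA' (infDist_le_dist_of_mem_closure hxS)
  obtain ⟨s, hs, rfl, -⟩ := hch z hz x hxS heq
  exact ⟨s, hs, closure_minimal hAF hF (hγ.mem_closure_of_apply_mem_closure hA hs hx), heq⟩

theorem HasVertex.exists_foot_left (h : HasVertex γ t₀) (hγ : IsC2OpenArc γ)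
    (hch : IsVertexChart γ t₀ ε) {z : Plane} (hz : z ∈ ball (evolute γ t₀) ε)
    (hl : z ∈ feetIn γ (Ioc 0 t₀)) :
    ∃ s ∈ Ioo (0 : ℝ) 1, s ≤ t₀ ∧ dist z (γ s) = infDist z (trace γ) :=
  hch.exists_foot hγ (A := Ioc 0 t₀) (F := Iic t₀) (fun _ hx => ⟨hx.1, hx.2.trans_lt h.mem.2⟩)
    ⟨t₀, h.mem.1, le_rfl⟩ isClosed_Iic (fun _ hx => hx.2) hz hl

theorem HasVertex.exists_foot_right (h : HasVertex γ t₀) (hγ : IsC2OpenArc γ)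
    (hch : IsVertexChart γ t₀ ε) {z : Plane} (hz : z ∈ ball (evolute γ t₀) ε)
    (hr : z ∈ feetIn γ (Ico t₀ 1)) :
    ∃ s ∈ Ioo (0 : ℝ) 1, t₀ ≤ s ∧ dist z (γ s) = infDist z (trace γ) :=
  hch.exists_foot hγ (A := Ico t₀ 1) (F := Ici t₀) (fun _ hx => ⟨h.mem.1.trans_le hx.1, hx.2⟩)
    ⟨t₀, le_rfl, h.mem.2⟩ isClosed_Ici (fun _ hx => hx.1) hz hr

theorem IsVertexChart.sign (hch : IsVertexChart γ t₀ ε) (hγ : IsC2OpenArc γ) {z : Plane}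
    (hz : z ∈ ball (evolute γ t₀) ε) {s : ℝ} (hs : s ∈ Ioo (0 : ℝ) 1)
    (hzs : dist z (γ s) = infDist z (trace γ)) :
    0 < infDist z (trace γ) ∧ infDist z (trace γ) ≤ (curvature γ s)⁻¹ ∧
      z = γ s + infDist z (trace γ) • unitNormal γ s ∧
      (s < t₀ → inner ℝ (γ s - γ t₀) (deriv γ t₀) < 0) ∧
      (t₀ < s → 0 < inner ℝ (γ s - γ t₀) (deriv γ t₀)) ∧
      (s ≠ t₀ → 0 < inner ℝ (γ s - γ t₀) (unitNormal γ t₀)) := by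
  obtain ⟨r, hr, hrs, h⟩ := hch z hz _ (subset_closure (mem_trace hs)) hzs
  rw [hγ.eq_of_apply_eq hs hr hrs]
  exact h

theorem HasVertex.normal_foot (h : HasVertex γ t₀) (hγ : IsC2OpenArc γ)
    (hch : IsVertexChart γ t₀ ε) {z : Plane} (hz : z ∈ ball (evolute γ t₀) ε)
    (hzt : dist z (γ t₀) = infDist z (trace γ)) :
    z = evolute γ t₀ + height γ t₀ z • unitNormal γ t₀ ∧ height γ t₀ z ≤ 0 := by
  have hk := h.curvature_ne_zero h.mem
  obtain ⟨-, hle, hzd, -⟩ := hch.sign hγ hz h.mem hzt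
  set d := infDist z (trace γ)
  have e : z - evolute γ t₀ = (d - (curvature γ t₀)⁻¹) • unitNormal γ t₀ := by
    rw [hγ.evolute_eq h.mem hk, hzd, sub_smul]; abel
  have hh : height γ t₀ z = d - (curvature γ t₀)⁻¹ := by
    rw [height, e, real_inner_smul_left, real_inner_self_eq_norm_sq,
      hγ.norm_unitNormal h.mem hk]
    ring
  rw [hh, ← e]
  exact ⟨by rw [add_sub_cancel], by linarith⟩

/-- At a foot `γ a` the disk about `z` lies in the osculating disk at `a`, which would then contain
the other foot. If both feet were on the same side of the vertex, taking for `a` the one nearer to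
it contradicts that the curve beyond `a` stays outside. -/
theorem HasVertex.lt_vertex_lt (h : HasVertex γ t₀) (hγ : IsC2OpenArc γ)
    (hch : IsVertexChart γ t₀ ε) {z : Plane} (hz : z ∈ ball (evolute γ t₀) ε) {s t : ℝ}
    (hs : s ∈ Ioo (0 : ℝ) 1) (ht : t ∈ Ioo (0 : ℝ) 1) (hst : s < t)
    (hzs : dist z (γ s) = infDist z (trace γ)) (hzt : dist z (γ t) = infDist z (trace γ)) :
    s < t₀ ∧ t₀ < t := by
  have key : ∀ {a b : ℝ}, a ∈ Ioo (0 : ℝ) 1 → dist z (γ a) = infDist z (trace γ) →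
      dist z (γ b) = infDist z (trace γ) → dist (evolute γ a) (γ b) ≤ (curvature γ a)⁻¹ := by
    intro a b ha hza hzb
    obtain ⟨h0, hle, hzd, -⟩ := hch.sign hγ hz ha hza
    have h1 : dist (evolute γ a) z = (curvature γ a)⁻¹ - infDist z (trace γ) := by
      nth_rw 1 [hzd]
      rw [hγ.evolute_eq ha (h.curvature_ne_zero ha), dist_add_left, dist_eq_norm, ← sub_smul,
        norm_smul, hγ.norm_unitNormal ha (h.curvature_ne_zero ha), mul_one, Real.norm_eq_abs,
        abs_of_nonneg (by linarith)]
    have := dist_triangle (evolute γ a) z (γ b)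
    linarith
  constructor
  · by_contra! hle
    exact absurd (key hs hzs hzt) (not_le.2 (h.inv_lt_dist_right hγ hle hst ht.2))
  · by_contra! hle
    exact absurd (key ht hzt hzs) (not_le.2 (h.inv_lt_dist_left hγ hle hst hs.1))

theorem HasVertex.dist_evolute_le (h : HasVertex γ t₀) (hγ : IsC2OpenArc γ) {s : ℝ}
    (hs : s ∈ Ioo (0 : ℝ) 1) :
    dist (evolute γ t₀) (γ t₀) ≤ dist (evolute γ t₀) (γ s) := by
  rw [hγ.dist_evolute h.mem (h.curvature_ne_zero h.mem)]
  exact h.inv_le_dist hγ hs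

/-- Monotonicity of feet, applied to `z` and `evolute γ t₀`, gives two inequalities with the same
sign of the normal coefficient and opposite signs of the tangential one. For nonpositive height they
leave only `z = evolute γ t₀`, which has `γ t₀` as its only foot on the curve. -/
theorem HasVertex.height_pos (h : HasVertex γ t₀) (hγ : IsC2OpenArc γ)
    (hch : IsVertexChart γ t₀ ε) {z : Plane} (hz : z ∈ ball (evolute γ t₀) ε) {s t : ℝ}
    (hs : s ∈ Ioo (0 : ℝ) 1) (ht : t ∈ Ioo (0 : ℝ) 1) (hst : s < t₀) (htt : t₀ < t)
    (hzs : dist z (γ s) = infDist z (trace γ)) (hzt : dist z (γ t) = infDist z (trace γ)) :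
    0 < height γ t₀ z := by
  have hk := h.curvature_ne_zero h.mem
  obtain ⟨-, -, -, hs1, -, hs3⟩ := hch.sign hγ hz hs hzs
  obtain ⟨-, -, -, -, ht2, ht3⟩ := hch.sign hγ hz ht hzt
  have hs1 := hs1 hst
  have hs3 := hs3 hst.ne
  have ht2 := ht2 htt
  have ht3 := ht3 htt.ne'
  have hzt₀ : infDist z (trace γ) ≤ dist z (γ t₀) := infDist_le_dist_of_mem (mem_trace h.mem)
  have m1 := inner_feet_nonneg (hzs.trans_le hzt₀) (h.dist_evolute_le hγ hs)
  have m2 := inner_feet_nonneg (hzt.trans_le hzt₀) (h.dist_evolute_le hγ ht)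
  have hdec := hγ.frame_decomposition h.mem hk (z - evolute γ t₀)
  set x := inner ℝ (z - evolute γ t₀) (deriv γ t₀) / ‖deriv γ t₀‖ ^ 2
  have hy : inner ℝ (z - evolute γ t₀) (unitNormal γ t₀) = height γ t₀ z := rfl
  rw [hy] at hdec
  set y := height γ t₀ z
  rw [hdec, inner_add_right, inner_smul_right, inner_smul_right] at m1 m2
  by_contra! hneg
  have hx : x = 0 := by
    rcases lt_trichotomy x 0 with hx | hx | hx
    · nlinarith
    · exact hx
    · nlinarith
  have hy0 : y = 0 := by
    rw [hx] at m1
    nlinarith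
  rw [hx, hy0, zero_smul, zero_smul, add_zero, sub_eq_zero] at hdec
  rw [hdec, h.infDist_evolute hγ] at hzs
  exact absurd hzs (h.inv_lt_dist hγ hs hst.ne).ne'

/-- A closed description, from which compactness near the cusp follows. The height condition
discards the centres on the normal below the cusp whose only foot is `γ t₀`: they count for both
arcs. -/
theorem HasVertex.mem_divider_iff (h : HasVertex γ t₀) (hγ : IsC2OpenArc γ)
    (huniq : ∀ t ∈ Ioo (0 : ℝ) 1, IsLocalMax (curvature γ) t → t = t₀)
    (hch : IsVertexChart γ t₀ ε) {z : Plane} (hz : z ∈ ball (evolute γ t₀) ε) :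
    z ∈ divider (trace γ) ↔
      (z ∈ feetIn γ (Ioc 0 t₀) ∧ z ∈ feetIn γ (Ico t₀ 1)) ∧ 0 ≤ height γ t₀ z := by
  constructor
  · intro hzX
    obtain ⟨-, t, ht, hzt, ⟨q, hq, hqt, hzq⟩ | ⟨hk, he⟩⟩ := hγ.two_feet_or_eq_evolute hzX
    · obtain ⟨s, hs, rfl, -⟩ := hch z hz q hq hzq
      have hne : s ≠ t := by rintro rfl; exact hqt rfl
      have fin : ∀ {s t : ℝ}, s ∈ Ioo (0 : ℝ) 1 → t ∈ Ioo (0 : ℝ) 1 → s < t →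
          dist z (γ s) = infDist z (trace γ) → dist z (γ t) = infDist z (trace γ) →
          (z ∈ feetIn γ (Ioc 0 t₀) ∧ z ∈ feetIn γ (Ico t₀ 1)) ∧ 0 ≤ height γ t₀ z := by
        intro s t hs ht hst hzs hzt
        obtain ⟨h1, h2⟩ := h.lt_vertex_lt hγ hch hz hs ht hst hzs hzt
        exact ⟨⟨mem_feetIn ⟨hs.1, h1.le⟩ hzs, mem_feetIn ⟨h2.le, ht.2⟩ hzt⟩,
          (h.height_pos hγ hch hz hs ht h1 h2 hzs hzt).le⟩
      rcases lt_or_gt_of_ne hne with hlt | hlt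
      · exact fin hs ht hlt hzq hzt
      · exact fin ht hs hlt hzt hzq
    · have htt : t = t₀ := by
        by_contra hne
        obtain ⟨s, hs, hlt⟩ := hγ.exists_dist_evolute_lt huniq ht hne hk
        rw [← he, hzt] at hlt
        exact absurd (infDist_le_dist_of_mem (mem_trace hs)) (not_le.2 hlt)
      subst htt
      refine ⟨⟨mem_feetIn ⟨ht.1, le_rfl⟩ hzt, mem_feetIn ⟨le_rfl, ht.2⟩ hzt⟩, ?_⟩
      rw [he, height, sub_self, inner_zero_left]
  · rintro ⟨⟨hl, hr⟩, hy⟩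
    obtain ⟨s, hs, hst, hzs⟩ := h.exists_foot_left hγ hch hz hl
    obtain ⟨t, ht, htt, hzt⟩ := h.exists_foot_right hγ hch hz hr
    by_cases heq : s = t
    · have hs0 : s = t₀ := le_antisymm hst (heq ▸ htt)
      rw [hs0] at hzs
      obtain ⟨he, hle⟩ := h.normal_foot hγ hch hz hzs
      rw [le_antisymm hle hy, zero_smul, add_zero] at he
      rw [he]
      exact h.evolute_mem_divider hγ
    · refine mem_divider_of_two_feet (mem_trace hs) (subset_closure (mem_trace ht)) ?_
        (hch.sign hγ hz hs hzs).1 hzs hzt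
      intro hγ'
      exact heq (hγ.eq_of_apply_eq hs ht hγ'.symm)

theorem HasVertex.feet_of_height_pos (h : HasVertex γ t₀) (hγ : IsC2OpenArc γ)
    (huniq : ∀ t ∈ Ioo (0 : ℝ) 1, IsLocalMax (curvature γ) t → t = t₀)
    (hch : IsVertexChart γ t₀ ε) {z : Plane} (hz : z ∈ ball (evolute γ t₀) ε)
    (hzX : z ∈ divider (trace γ)) (hy : 0 < height γ t₀ z) :
    (∃ s ∈ Ioo (0 : ℝ) 1, dist z (γ s) = infDist z (trace γ) ∧
      inner ℝ (γ s - γ t₀) (deriv γ t₀) < 0) ∧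
    ∃ t ∈ Ioo (0 : ℝ) 1, dist z (γ t) = infDist z (trace γ) ∧
      0 < inner ℝ (γ t - γ t₀) (deriv γ t₀) := by
  obtain ⟨⟨hl, hr⟩, -⟩ := (h.mem_divider_iff hγ huniq hch hz).1 hzX
  obtain ⟨s, hs, hst, hzs⟩ := h.exists_foot_left hγ hch hz hl
  obtain ⟨t, ht, htt, hzt⟩ := h.exists_foot_right hγ hch hz hr
  have hne : ∀ r, dist z (γ r) = infDist z (trace γ) → r ≠ t₀ := by
    rintro r hzr rfl
    exact absurd (h.normal_foot hγ hch hz hzr).2 (not_le.2 hy)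
  exact ⟨⟨s, hs, hzs, (hch.sign hγ hz hs hzs).2.2.2.1 (lt_of_le_of_ne hst (hne s hzs))⟩,
    ⟨t, ht, hzt, (hch.sign hγ hz ht hzt).2.2.2.2.1 (lt_of_le_of_ne htt (hne t hzt).symm)⟩⟩

/-- Two centres of equal height differ by a tangent vector. Each has feet on both sides of the
vertex, so comparing a left foot of one with a right foot of the other excludes a displacement in
either direction. -/
theorem HasVertex.height_injOn (h : HasVertex γ t₀) (hγ : IsC2OpenArc γ)
    (huniq : ∀ t ∈ Ioo (0 : ℝ) 1, IsLocalMax (curvature γ) t → t = t₀)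
    (hch : IsVertexChart γ t₀ ε) :
    InjOn (height γ t₀) (divider (trace γ) ∩ ball (evolute γ t₀) ε) := by
  have hk := h.curvature_ne_zero h.mem
  have hzero : ∀ z ∈ divider (trace γ) ∩ ball (evolute γ t₀) ε, height γ t₀ z = 0 →
      z = evolute γ t₀ := by
    rintro z ⟨hzX, hz⟩ hz0
    obtain ⟨⟨hl, hr⟩, -⟩ := (h.mem_divider_iff hγ huniq hch hz).1 hzX
    obtain ⟨s, hs, hst, hzs⟩ := h.exists_foot_left hγ hch hz hl
    obtain ⟨t, ht, htt, hzt⟩ := h.exists_foot_right hγ hch hz hr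
    by_cases heq : s = t
    · have hs0 : s = t₀ := le_antisymm hst (heq ▸ htt)
      rw [hs0] at hzs
      obtain ⟨he, -⟩ := h.normal_foot hγ hch hz hzs
      rwa [hz0, zero_smul, add_zero] at he
    · have hlt : s < t := lt_of_le_of_ne (hst.trans htt) heq
      obtain ⟨h1, h2⟩ := h.lt_vertex_lt hγ hch hz hs ht hlt hzs hzt
      exact absurd hz0 (h.height_pos hγ hch hz hs ht h1 h2 hzs hzt).ne'
  have key : ∀ z ∈ divider (trace γ) ∩ ball (evolute γ t₀) ε,
      ∀ w ∈ divider (trace γ) ∩ ball (evolute γ t₀) ε, 0 < height γ t₀ z →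
      0 < height γ t₀ w → ∀ x : ℝ, z - w = x • deriv γ t₀ → x ≤ 0 := by
    rintro z ⟨hzX, hz⟩ w ⟨hwX, hw⟩ hyz hyw x hx
    obtain ⟨⟨s, hs, hzs, hs'⟩, -⟩ := h.feet_of_height_pos hγ huniq hch hz hzX hyz
    obtain ⟨-, t, ht, hwt, ht'⟩ := h.feet_of_height_pos hγ huniq hch hw hwX hyw
    have m := inner_feet_nonneg (z := z) (c := w) (x := γ s) (y := γ t)
      (hzs.trans_le (infDist_le_dist_of_mem (mem_trace ht)))
      (hwt.trans_le (infDist_le_dist_of_mem (mem_trace hs)))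
    rw [hx, inner_smul_right, ← sub_sub_sub_cancel_right _ _ (γ t₀), inner_sub_left] at m
    by_contra! hpos
    nlinarith
  rintro z hz w hw hzw
  have hz0 := ((h.mem_divider_iff hγ huniq hch hz.2).1 hz.1).2
  rcases eq_or_lt_of_le hz0 with h0 | h0
  · rw [hzero z hz h0.symm, hzero w hw (hzw ▸ h0.symm)]
  · have hdec := hγ.frame_decomposition h.mem hk (z - w)
    have hn : inner ℝ (z - w) (unitNormal γ t₀) = 0 := by
      rw [← sub_sub_sub_cancel_right _ _ (evolute γ t₀), inner_sub_left]
      exact sub_eq_zero.2 hzw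
    rw [hn, zero_smul, add_zero] at hdec
    set x := inner ℝ (z - w) (deriv γ t₀) / ‖deriv γ t₀‖ ^ 2
    have h1 := key z hz w hw h0 (hzw ▸ h0) x hdec
    have h2 := key w hw z hz (hzw ▸ h0) h0 (-x) (by rw [neg_smul, ← hdec, neg_sub])
    have hx : x = 0 := by linarith
    rw [hx, zero_smul] at hdec
    exact sub_eq_zero.1 hdec

end DividerSet

/-! ### The cusp is an end point of the Divider -/

namespace DividerSet

open Metric

variable {γ : ℝ → Plane} {t₀ ε : ℝ}

theorem IsVertexChart.mem_feetIn_or (hch : IsVertexChart γ t₀ ε) (h : HasVertex γ t₀) {z : Plane}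
    (hz : z ∈ ball (evolute γ t₀) ε) : z ∈ feetIn γ (Ioc 0 t₀) ∨ z ∈ feetIn γ (Ico t₀ 1) := by
  obtain ⟨y, hy, hy'⟩ := isClosed_closure.exists_infDist_eq_dist
    (show (closure (trace γ)).Nonempty from ⟨_, subset_closure (mem_trace h.mem)⟩) z
  rw [infDist_closure] at hy'
  obtain ⟨s, hs, rfl, -⟩ := hch z hz y hy hy'.symm
  rcases le_total s t₀ with hle | hle
  · exact Or.inl (mem_feetIn ⟨hs.1, hle⟩ hy'.symm)
  · exact Or.inr (mem_feetIn ⟨hle, hs.2⟩ hy'.symm)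

/-- A centre that is moved from the centre of curvature along the tangent has its feet on the side
of this motion. -/
theorem HasVertex.notMem_feetIn_left (h : HasVertex γ t₀) (hγ : IsC2OpenArc γ)
    (hch : IsVertexChart γ t₀ ε) {x : ℝ} (hx : 0 < x)
    (hz : evolute γ t₀ + x • deriv γ t₀ ∈ ball (evolute γ t₀) ε) :
    evolute γ t₀ + x • deriv γ t₀ ∉ feetIn γ (Ioc 0 t₀) := by
  intro hl
  obtain ⟨s, hs, hst, hzs⟩ := h.exists_foot_left hγ hch hz hl
  have hsgn := (hch.sign hγ hz hs hzs).2.2.2.1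
  have m := inner_feet_nonneg
    (hzs.trans_le (infDist_le_dist_of_mem (mem_trace h.mem))) (h.dist_evolute_le hγ hs)
  rw [add_sub_cancel_left, inner_smul_right] at m
  rcases eq_or_lt_of_le hst with heq | hlt
  · subst heq
    have he := (h.normal_foot hγ hch hz hzs).1
    have h1 := congrArg (fun w => inner ℝ w (deriv γ s)) (add_left_cancel he)
    simp only [real_inner_smul_left] at h1
    rw [real_inner_self_eq_norm_sq, real_inner_comm, inner_deriv_unitNormal, mul_zero] at h1
    exact absurd h1 (mul_pos hx (pow_pos (hγ.norm_deriv_pos hs) 2)).ne'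
  · nlinarith [hsgn hlt]

theorem HasVertex.notMem_feetIn_right (h : HasVertex γ t₀) (hγ : IsC2OpenArc γ)
    (hch : IsVertexChart γ t₀ ε) {x : ℝ} (hx : x < 0)
    (hz : evolute γ t₀ + x • deriv γ t₀ ∈ ball (evolute γ t₀) ε) :
    evolute γ t₀ + x • deriv γ t₀ ∉ feetIn γ (Ico t₀ 1) := by
  intro hr
  obtain ⟨s, hs, hst, hzs⟩ := h.exists_foot_right hγ hch hz hr
  have hsgn := (hch.sign hγ hz hs hzs).2.2.2.2.1
  have m := inner_feet_nonneg
    (hzs.trans_le (infDist_le_dist_of_mem (mem_trace h.mem))) (h.dist_evolute_le hγ hs)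
  rw [add_sub_cancel_left, inner_smul_right] at m
  rcases eq_or_lt_of_le hst with heq | hlt
  · subst heq
    have he := (h.normal_foot hγ hch hz hzs).1
    have h1 := congrArg (fun w => inner ℝ w (deriv γ t₀)) (add_left_cancel he)
    simp only [real_inner_smul_left] at h1
    rw [real_inner_self_eq_norm_sq, real_inner_comm, inner_deriv_unitNormal, mul_zero] at h1
    exact absurd h1 (mul_neg_of_neg_of_pos hx (pow_pos (hγ.norm_deriv_pos hs) 2)).ne
  · nlinarith [hsgn hlt]

theorem HasVertex.height_add (h : HasVertex γ t₀) (hγ : IsC2OpenArc γ) (x y : ℝ) :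
    height γ t₀ (evolute γ t₀ + x • deriv γ t₀ + y • unitNormal γ t₀) = y := by
  rw [height, add_assoc, add_sub_cancel_left, inner_add_left, real_inner_smul_left,
    real_inner_smul_left, inner_deriv_unitNormal, real_inner_self_eq_norm_sq,
    hγ.norm_unitNormal h.mem (h.curvature_ne_zero h.mem)]
  ring

/-- The Divider contains centres of all small heights above the centre of curvature. -/
theorem HasVertex.exists_mem_divider_height (h : HasVertex γ t₀) (hγ : IsC2OpenArc γ)
    (huniq : ∀ t ∈ Ioo (0 : ℝ) 1, IsLocalMax (curvature γ) t → t = t₀)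
    (hch : IsVertexChart γ t₀ ε) {δ : ℝ} (hδ : 0 < δ) (hδε : δ ≤ ε) :
    ∃ y₁ > 0, ∀ y ∈ Ico 0 y₁, ∃ z ∈ divider (trace γ), z ∈ ball (evolute γ t₀) δ ∧
      height γ t₀ z = y := by
  have hv := hγ.norm_deriv_pos h.mem
  have hN := hγ.norm_unitNormal h.mem (h.curvature_ne_zero h.mem)
  -- The tangential and the normal displacement get half of `δ` each.
  set x := δ / 2 / ‖deriv γ t₀‖ with hxdef
  have hx : 0 < x := by positivity
  have hxv : x * ‖deriv γ t₀‖ = δ / 2 := div_mul_cancel₀ _ hv.ne'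
  have hball : ∀ x' y : ℝ, |x'| ≤ x → |y| < δ / 2 →
      evolute γ t₀ + x' • deriv γ t₀ + y • unitNormal γ t₀ ∈ ball (evolute γ t₀) δ := by
    intro x' y hx' hy
    rw [mem_ball, add_assoc, dist_self_add_left]
    refine (norm_add_le _ _).trans_lt ?_
    rw [norm_smul, norm_smul, hN, mul_one, Real.norm_eq_abs, Real.norm_eq_abs]
    have := mul_le_mul_of_nonneg_right hx' hv.le
    linarith
  have hball0 : ∀ x' : ℝ, |x'| ≤ x → evolute γ t₀ + x' • deriv γ t₀ ∈ ball (evolute γ t₀) ε := by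
    intro x' hx'
    have := hball x' 0 hx' (by rw [abs_zero]; linarith)
    rw [zero_smul, add_zero] at this
    exact ball_subset_ball hδε this
  have hev : ∀ (x' : ℝ) (A : Set ℝ), evolute γ t₀ + x' • deriv γ t₀ ∉ feetIn γ A →
      ∀ᶠ y in 𝓝 (0 : ℝ), evolute γ t₀ + x' • deriv γ t₀ + y • unitNormal γ t₀ ∉ feetIn γ A := by
    intro x' A hA
    have hc : Continuous fun y : ℝ => evolute γ t₀ + x' • deriv γ t₀ + y • unitNormal γ t₀ := by
      fun_prop
    exact hc.continuousAt.eventually ((isClosed_feetIn γ A).isOpen_compl.mem_nhds (by simpa using hA))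
  have hr := hev x _ (h.notMem_feetIn_left hγ hch hx (hball0 x (abs_of_pos hx).le))
  have hl := hev (-x) _ (h.notMem_feetIn_right hγ hch (neg_neg_of_pos hx)
    (hball0 (-x) (by rw [abs_neg, abs_of_pos hx])))
  obtain ⟨y₀, hy₀, hy⟩ := exists_Icc_subset_of_eventually (hr.and hl)
  refine ⟨min y₀ (δ / 2), lt_min hy₀ (by linarith), fun y hy' => ?_⟩
  obtain ⟨hy0, hy1⟩ := hy'
  rw [lt_min_iff] at hy1
  rcases eq_or_lt_of_le hy0 with h0 | h0
  · refine ⟨evolute γ t₀, h.evolute_mem_divider hγ, mem_ball_self hδ, ?_⟩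
    rw [height, sub_self, inner_zero_left, h0]
  have hyabs : |y| < δ / 2 := by rw [abs_of_pos h0]; exact hy1.2
  obtain ⟨hR, hL⟩ := hy y ⟨by linarith, by linarith [hy1.1]⟩
  set f : ℝ → Plane := fun x' => evolute γ t₀ + x' • deriv γ t₀ + y • unitNormal γ t₀ with hf
  have hfball : ∀ x' ∈ Icc (-x) x, f x' ∈ ball (evolute γ t₀) ε := fun x' hx' =>
    ball_subset_ball hδε (hball x' y (abs_le.2 hx') hyabs)
  have hpre : IsPreconnected (f '' Icc (-x) x) :=
    isPreconnected_Icc.image f (by rw [hf]; fun_prop)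
  have hxx : -x ≤ x := by linarith
  -- The ends of the horizontal segment at height `y` have feet on one side of the vertex only, the
  -- left end on the left and the right end on the right; in between some centre has feet in both
  -- closed sets.
  obtain ⟨_, ⟨x', hx', rfl⟩, hz1, hz2⟩ := isPreconnected_closed_iff.1 hpre _ _
    (isClosed_feetIn γ (Ioc 0 t₀)) (isClosed_feetIn γ (Ico t₀ 1))
    (by
      rintro _ ⟨x', hx', rfl⟩
      exact hch.mem_feetIn_or h (hfball x' hx'))
    ⟨f (-x), mem_image_of_mem f (left_mem_Icc.2 hxx),
      (hch.mem_feetIn_or h (hfball _ (left_mem_Icc.2 hxx))).resolve_right hL⟩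
    ⟨f x, mem_image_of_mem f (right_mem_Icc.2 hxx),
      (hch.mem_feetIn_or h (hfball _ (right_mem_Icc.2 hxx))).resolve_left hR⟩
  have hheight : height γ t₀ (f x') = y := h.height_add hγ x' y
  exact ⟨f x', (h.mem_divider_iff hγ huniq hch (hfball x' hx')).2 ⟨⟨hz1, hz2⟩, by
    rw [hheight]; exact hy0⟩, hball x' y (abs_le.2 hx') hyabs, hheight⟩

/-- A continuous function that is injective on a compact neighbourhood of `c` in `X` and maps a
neighbourhood onto `[0, 1)` exhibits `c` as an end point. -/
theorem isEndPoint_of_injOn_compact {X U C : Set Plane} {c : Plane} {f : Plane → ℝ}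
    (hU : IsOpen U) (hcU : c ∈ X ∩ U) (hf : Continuous f) (hC : IsCompact C) (hUC : X ∩ U ⊆ C)
    (hinj : InjOn f C) (hmem : ∀ z ∈ X ∩ U, f z ∈ Ico (0 : ℝ) 1)
    (hsurj : ∀ r ∈ Ico (0 : ℝ) 1, ∃ z ∈ X ∩ U, f z = r) (hc : f c = 0) : IsEndPoint X c := by
  have : CompactSpace ↥C := isCompact_iff_compactSpace.1 hC
  have hemb : IsEmbedding (C.domRestrict f) :=
    ((hf.comp continuous_subtype_val).isClosedEmbedding (injOn_iff_injective.1 hinj)).isEmbedding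
  have hembU : IsEmbedding ((X ∩ U).domRestrict f) := hemb.comp (IsEmbedding.inclusion hUC)
  have hembI : IsEmbedding (Set.codRestrict ((X ∩ U).domRestrict f) (Ico (0 : ℝ) 1)
      fun z => hmem z z.2) := hembU.codRestrict _ _
  have hsurjI : Function.Surjective (Set.codRestrict ((X ∩ U).domRestrict f) (Ico (0 : ℝ) 1)
      fun z => hmem z z.2) := by
    rintro ⟨r, hr⟩
    obtain ⟨z, hz, rfl⟩ := hsurj r hr
    exact ⟨⟨z, hz⟩, rfl⟩
  exact ⟨U, hcU, hU, hembI.toHomeomorphOfSurjective hsurjI, hc⟩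

theorem HasVertex.isEndPoint_evolute (h : HasVertex γ t₀) (hγ : IsC2OpenArc γ)
    (huniq : ∀ t ∈ Ioo (0 : ℝ) 1, IsLocalMax (curvature γ) t → t = t₀) :
    IsEndPoint (divider (trace γ)) (evolute γ t₀) := by
  obtain ⟨ε, hε, hch⟩ := h.exists_chart hγ
  set c := evolute γ t₀ with hc
  set X := divider (trace γ)
  obtain ⟨y₁, hy₁, hsurj⟩ := h.exists_mem_divider_height hγ huniq hch (half_pos hε)
    (half_le_self hε.le)
  have hsub : closedBall c (ε / 2) ⊆ ball c ε := closedBall_subset_ball (half_lt_self hε)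
  have hCeq : X ∩ closedBall c (ε / 2) = (feetIn γ (Ioc 0 t₀) ∩ feetIn γ (Ico t₀ 1) ∩
      {z | 0 ≤ height γ t₀ z}) ∩ closedBall c (ε / 2) := by
    ext z
    refine and_congr_left fun hz => ?_
    exact h.mem_divider_iff hγ huniq hch (hsub hz)
  have hCcomp : IsCompact (X ∩ closedBall c (ε / 2)) := by
    rw [hCeq]
    exact (isCompact_closedBall c (ε / 2)).inter_left
      (((isClosed_feetIn γ _).inter (isClosed_feetIn γ _)).inter
        (isClosed_le continuous_const (continuous_height γ t₀)))
  have hinj := h.height_injOn hγ huniq hch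
  -- Cutting at height `y₁` makes the range of heights exactly `[0, y₁)`; division by `y₁`
  -- normalizes it to `[0, 1)`.
  set U : Set Plane := ball c (ε / 2) ∩ {z | height γ t₀ z < y₁} with hU
  have hUopen : IsOpen U :=
    isOpen_ball.inter (isOpen_lt (continuous_height γ t₀) continuous_const)
  have hUC : X ∩ U ⊆ X ∩ closedBall c (ε / 2) :=
    inter_subset_inter_right _ (inter_subset_left.trans ball_subset_closedBall)
  have hc0 : height γ t₀ c = 0 := by rw [height, ← hc, sub_self, inner_zero_left]
  have hcU : c ∈ X ∩ U := ⟨h.evolute_mem_divider hγ, mem_ball_self (half_pos hε), by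
    change height γ t₀ c < y₁
    rw [hc0]; exact hy₁⟩
  refine isEndPoint_of_injOn_compact hUopen hcU ((continuous_height γ t₀).div_const y₁) hCcomp hUC
    (fun z hz w hw hzw => hinj ⟨hz.1, hsub hz.2⟩ ⟨hw.1, hsub hw.2⟩
      ((div_left_inj' hy₁.ne').1 hzw))
    (fun z hz => ⟨div_nonneg ((h.mem_divider_iff hγ huniq hch (hsub (hUC hz).2)).1 hz.1).2 hy₁.le,
      (div_lt_one hy₁).2 hz.2.2⟩) (fun r hr => ?_) (by rw [hc0, zero_div])
  obtain ⟨z, hzX, hzb, hzr⟩ := hsurj (r * y₁) ⟨mul_nonneg hr.1 hy₁.le,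
    mul_lt_of_lt_one_left hy₁ hr.2⟩
  refine ⟨z, ⟨hzX, hzb, ?_⟩, ?_⟩
  · change height γ t₀ z < y₁
    rw [hzr]; exact mul_lt_of_lt_one_left hy₁ hr.2
  · rw [hzr, mul_div_cancel_right₀ _ hy₁.ne']

end DividerSet

/-! ### Assembly of the theorem -/

open DividerSet

theorem mainTheorem1 (γ : ℝ → DividerSet.Plane) (hγ : DividerSet.IsC2OpenArc γ)
    (hunb : ¬ Bornology.IsBounded (DividerSet.trace γ))
    (hconst : DividerSet.NoConstantCurvatureArc γ)
    (hmax : ∃! t : ℝ, t ∈ Set.Ioo (0 : ℝ) 1 ∧ IsLocalMax (DividerSet.curvature γ) t) :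
    DividerSet.divider (DividerSet.trace γ)
        ⊆ closure (DividerSet.piSet (DividerSet.trace γ)) ∩ closure (DividerSet.convexSide γ) ∧
    {e | DividerSet.IsEndPoint (DividerSet.divider (DividerSet.trace γ)) e}
        ⊆ DividerSet.maxCurvatureCusps γ ∧
    (∃ c, DividerSet.maxCurvatureCusps γ = {c}) ∧
    (DividerSet.BothEndsUnbounded γ →
      DividerSet.piSet (DividerSet.trace γ) = DividerSet.convexSide γ ∧
      {e | DividerSet.IsEndPoint (DividerSet.divider (DividerSet.trace γ)) e}
        = DividerSet.maxCurvatureCusps γ) := by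
  obtain ⟨t₀, ⟨ht₀, hloc⟩, huniq'⟩ := hmax
  have huniq : ∀ t ∈ Ioo (0 : ℝ) 1, IsLocalMax (curvature γ) t → t = t₀ :=
    fun t ht h => huniq' t ⟨ht, h⟩
  have hcusps : maxCurvatureCusps γ = {evolute γ t₀} := by
    ext c
    constructor
    · rintro ⟨t, ht, hl, -, rfl⟩
      rw [huniq t ht hl]; rfl
    · rintro rfl
      exact ⟨t₀, ht₀, hloc, hγ.isEvoluteCusp ht₀ hloc huniq, rfl⟩
  have hend : {e | IsEndPoint (divider (trace γ)) e} ⊆ maxCurvatureCusps γ := by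
    intro e he
    have heX : e ∈ divider (trace γ) := by
      obtain ⟨U, heU, -⟩ := he
      exact heU.1
    obtain ⟨hpos, t, ht, het, ⟨q, hq, hqt, heq⟩ | ⟨hk, hev⟩⟩ := hγ.two_feet_or_eq_evolute heX
    · exact absurd he (hγ.not_isEndPoint_of_two_feet hconst ht hqt hq hpos het heq)
    · rw [hcusps, mem_singleton_iff]
      by_cases htt : t = t₀
      · rw [hev, htt]
      -- Away from `t₀` the curve enters the osculating disk, so the centre of curvature is farther
      -- from `γ t` than from some other point and `γ t` is no foot.
      · obtain ⟨s, hs, hlt⟩ := hγ.exists_dist_evolute_lt huniq ht htt hk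
        rw [← hev, het] at hlt
        exact absurd (Metric.infDist_le_dist_of_mem (mem_trace hs)) (not_le.2 hlt)
  have hpi := hγ.divider_subset_closure_piSet hconst
  refine ⟨subset_inter hpi (hpi.trans (closure_minimal hγ.piSet_subset_closure_convexSide
    isClosed_closure)), hend, ⟨_, hcusps⟩, fun hboth => ?_⟩
  have hvert : HasVertex γ t₀ := ⟨ht₀,
    hγ.strictMonoOn_curvature ht₀ huniq fun t ht => (hboth t ht).1,
    hγ.strictAntiOn_curvature ht₀ huniq fun t ht => (hboth t ht).2⟩
  refine ⟨(hvert.piSet_subset_convexSide hγ).antisymm hγ.convexSide_subset_piSet,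
    hend.antisymm ?_⟩
  rw [hcusps, singleton_subset_iff]
  exact hvert.isEndPoint_evolute hγ huniq
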